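/- Let $d\in\{2,3\}$ and $k>0$. Let $\Phi$ be the radiating Green function of the Helmholtz equation, $\Phi(x,y)=\frac{i}{4}H^{(1)}_0(k|x-y|)$ if $d=2$ and $\Phi(x,y)=\frac{e^{ik|x-y|}}{4\pi|x-y|}$ if $d=3$. Write $\operatorname{Im}\Phi(x,z)=\frac14J_0(k|x-z|)$, respectively $\frac{k}{4\pi}j_0(k|x-z|)$ with $j_0(t)=\frac{\sin t}{t}$, $j_0(0)=1$, for its imaginary part, extended continuously to $x=z$. Let $\Omega\subset\mathbb R^d$ be a bounded domain with $C^1$ boundary, outward unit normal $\nu$ and surface measure $ds$. Let $x_1,\dots,x_N\in\Omega$ be distinct points, and let $B_1,\dots,B_N\subset\mathbb R^d$ be bounded domains (for instance, radially symmetric Lipschitz domains centered at the origin). For $\epsilon>0$ put $D_j=x_j+\epsilon B_j$ and $D=\bigcup_{j=1}^N D_j$. For $f\in L^2(D)$ let $$u(x)=\int_D f(y)\,\Phi(x,y)\,dy,\qquad I(z)=\int_{\partial\Omega}\Big(\frac{\partial \operatorname{Im}\Phi(x,z)}{\partial\nu(x)}\,u(x)-\operatorname{Im}\Phi(x,z)\,\frac{\partial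 u(x)}{\partial\nu(x)}\Big)\,ds(x),$$ and let $\overline f_{D_j}=\frac1{|D_j|}\int_{D_j}f\,dy$. Then there is $\epsilon_0>0$ such that for all $0<\epsilon<\epsilon_0$ the sets $D_j$ are pairwise disjoint with $\overline{D_j}\subset\Omega$, and, for every $f\in L^2(D)$, the integral defining $u$ converges absolutely at every point of $\partial\Omega$, $u$ is differentiable there, and for every $z\in\mathbb R^d$ the integrand of $I(z)$ is integrable on $\partial\Omega$. Moreover, there is a constant $C$, independent of $\epsilon$, $f$ and $z$, such that for all $0<\epsilon<\epsilon_0$, all $f\in L^2(D)$ and all $z\in\mathbb R^d$, $$\Big|\,I(z)-\epsilon^d\sum_{j=1}^N\overline f_{D_j}\,|B_j|\,\operatorname{Im}\Phi(x_j,z)\Big|\le C\,\epsilon^{d+1}\sum_{j=1}^N\frac1{|D_j|}\int_{D_j}|f|\,dy .$$ In particular, for every $z\in\mathbb R^d$ and every family $f=f_\epsilon\in L^2(D)$ for which the averages of $|f|$ over the $D_j$ remain bounded as $\epsilon\to0$ (for instance, by the Cauchy--Schwarz inequality, when the averages of $|f|^2$ do), $$I(z)=\epsilon^d\sum_{j=1}^N\overline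 f_{D_j}\,|B_j|\,\operatorname{Im}\Phi(x_j,z)+\mathcal O(\epsilon^{d+1})\qquad(\epsilon\to0).$$ -/

import Mathlib

open MeasureTheory Set Filter Topology

noncomputable section

namespace SmallSources

/-- The Bessel function `J₀`, by its (everywhere convergent) power series. -/
def besselJ0 (t : ℝ) : ℝ :=
  ∑' m : ℕ, (-1) ^ m * (t ^ 2 / 4) ^ m / (m.factorial : ℝ) ^ 2

/-- The Bessel function of the second kind `Y₀(t)`, `t > 0`, by its standard expansion
`Y₀(t) = (2/π) (log (t/2) + γ) J₀(t) + (2/π) ∑_{m ≥ 1} (-1)^(m+1) H_m (t²/4)^m / (m!)²`,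
where `γ` is Euler's constant and `H_m = 1 + 1/2 + ⋯ + 1/m` (so the term `m = 0` is zero). -/
def besselY0 (t : ℝ) : ℝ :=
  2 / Real.pi * (Real.log (t / 2) + Real.eulerMascheroniConstant) * besselJ0 t +
    2 / Real.pi *
      ∑' m : ℕ, (-1) ^ (m + 1) * (harmonic m : ℝ) * (t ^ 2 / 4) ^ m / (m.factorial : ℝ) ^ 2

/-- The Hankel function of the first kind of order zero, `H₀⁽¹⁾ = J₀ + i Y₀`. -/
def hankelH0 (t : ℝ) : ℂ := (besselJ0 t : ℂ) + Complex.I * (besselY0 t : ℂ)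

/-- The radiating Green function `Φ(x, y)`, `x ≠ y`, of the Helmholtz equation with wave number
`k`: `(i/4) H₀⁽¹⁾(k|x-y|)` for `d = 2`, and `exp(ik|x-y|) / (4π|x-y|)` for `d = 3`
(only `d = 2, 3` are used). -/
def green (d : ℕ) (k : ℝ) (x y : EuclideanSpace ℝ (Fin d)) : ℂ :=
  if d = 2 then Complex.I / 4 * hankelH0 (k * ‖x - y‖)
  else Complex.exp (Complex.I * (k * ‖x - y‖ : ℝ)) / (4 * Real.pi * ‖x - y‖ : ℝ)

/-- The imaginary part `Im Φ(x, z)` of the Green function, for all `x` and `z`, including its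
continuous value at `x = z`: `(1/4) J₀(k|x-z|)` for `d = 2`, and `(k/4π) j₀(k|x-z|)` with
`j₀(t) = sin t / t`, `j₀(0) = 1`, for `d = 3`. -/
def imGreen (d : ℕ) (k : ℝ) (x z : EuclideanSpace ℝ (Fin d)) : ℝ :=
  if d = 2 then 1 / 4 * besselJ0 (k * ‖x - z‖)
  else k / (4 * Real.pi) * Real.sinc (k * ‖x - z‖)

/-- `imGreen` is indeed the imaginary part of `green` off the diagonal. -/
theorem im_green_eq (d : ℕ) (k : ℝ) (hk : 0 < k) (x z : EuclideanSpace ℝ (Fin d))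
    (hxz : x ≠ z) : (green d k x z).im = imGreen d k x z := by
  have hr : ‖x - z‖ ≠ 0 := norm_ne_zero_iff.mpr (sub_ne_zero.mpr hxz)
  unfold green imGreen
  split_ifs
  · simp [hankelH0, Complex.mul_im]
  · rw [Complex.div_ofReal_im, mul_comm Complex.I, Complex.exp_ofReal_mul_I_im,
      Real.sinc_of_ne_zero (mul_ne_zero hk.ne' hr)]
    field_simp

/-- `ρ` is a `C¹` defining function of `Ω` near `p`: `∇ρ(p) ≠ 0`, and near `p` the set `Ω`
is `{ρ < 0}`. -/
structure IsC1DefiningFunction {d : ℕ} (Ω : Set (EuclideanSpace ℝ (Fin d)))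
    (p : EuclideanSpace ℝ (Fin d)) (ρ : EuclideanSpace ℝ (Fin d) → ℝ) : Prop where
  contDiffAt : ContDiffAt ℝ 1 ρ p
  gradient_ne_zero : gradient ρ p ≠ 0
  eventually_mem_iff : ∀ᶠ q in 𝓝 p, (q ∈ Ω ↔ ρ q < 0)

/-- Bounded domains (non-empty connected open sets) with `C¹` boundary, the domain lying locally
on one side of its boundary. -/
structure IsBoundedC1Domain {d : ℕ} (Ω : Set (EuclideanSpace ℝ (Fin d))) : Prop where
  isOpen : IsOpen Ω
  isConnected : IsConnected Ω
  isBounded : Bornology.IsBounded Ω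
  exists_defining : ∀ p ∈ frontier Ω, ∃ ρ, IsC1DefiningFunction Ω p ρ

/-- The normalized gradient of a defining function at a boundary point of a bounded `C¹` domain
does not depend on the defining function. -/
theorem IsC1DefiningFunction.normal_unique {d : ℕ} {Ω : Set (EuclideanSpace ℝ (Fin d))}
    {p : EuclideanSpace ℝ (Fin d)} {ρ σ : EuclideanSpace ℝ (Fin d) → ℝ} (hΩ : IsOpen Ω)
    (hp : p ∈ frontier Ω) (hρ : IsC1DefiningFunction Ω p ρ) (hσ : IsC1DefiningFunction Ω p σ) :
    ‖gradient ρ p‖⁻¹ • gradient ρ p = ‖gradient σ p‖⁻¹ • gradient σ p := by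
  have zero : ∀ τ, IsC1DefiningFunction Ω p τ → τ p = 0 := by
    intro τ hτ
    have hpn : p ∉ Ω := fun h => (hΩ.frontier_eq ▸ hp).2 h
    have h1 : ¬ τ p < 0 := fun h => hpn (hτ.eventually_mem_iff.self_of_nhds.mpr h)
    refine le_antisymm ?_ (not_lt.mp h1)
    by_contra h
    have h2 : ∀ᶠ q in 𝓝 p, 0 < τ q :=
      hτ.contDiffAt.continuousAt.eventually (lt_mem_nhds (not_le.mp h))
    have h3 : ∃ᶠ q in 𝓝 p, q ∈ Ω := mem_closure_iff_frequently.mp hp.1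
    obtain ⟨q, hq, hq2, hq3⟩ := (h3.and_eventually (h2.and hτ.eventually_mem_iff)).exists
    exact absurd (hq3.mp hq) (not_lt.mpr hq2.le)
  have line : ∀ τ, IsC1DefiningFunction Ω p τ → ∀ v,
      HasDerivAt (fun t : ℝ => τ (p + t • v)) (inner ℝ (gradient τ p) v) 0 := by
    intro τ hτ v
    have h := (hτ.contDiffAt.differentiableAt one_ne_zero).hasGradientAt.hasFDerivAt
    have hl : HasDerivAt (fun t : ℝ => p + t • v) v 0 := by
      simpa using ((hasDerivAt_id (0 : ℝ)).smul_const v).const_add p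
    have h' : HasFDerivAt τ (InnerProductSpace.toDual ℝ _ (gradient τ p)) (p + (0 : ℝ) • v) := by
      simpa using h
    have h2 := h'.comp_hasDerivAt (0 : ℝ) hl
    rw [InnerProductSpace.toDual_apply_apply] at h2
    exact h2
  have hunit : ∀ τ, IsC1DefiningFunction Ω p τ →
      ‖‖gradient τ p‖⁻¹ • gradient τ p‖ = 1 := fun τ hτ => by
    rw [norm_smul, norm_inv, norm_norm, inv_mul_cancel₀ (norm_ne_zero_iff.mpr hτ.gradient_ne_zero)]
  by_contra hne
  set a := ‖gradient ρ p‖⁻¹ • gradient ρ p with ha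
  set b := ‖gradient σ p‖⁻¹ • gradient σ p with hb
  have ha1 : ‖a‖ = 1 := hunit ρ hρ
  have hb1 : ‖b‖ = 1 := hunit σ hσ
  have hab : inner ℝ a b < 1 := inner_lt_one_iff_real_of_norm_eq_one ha1 hb1 |>.mpr hne
  have hav : 0 < inner ℝ (gradient ρ p) (a - b) := by
    have h : 0 < inner ℝ a (a - b) := by
      rw [inner_sub_right, real_inner_self_eq_norm_sq, ha1]; linarith
    rw [ha, real_inner_smul_left, ← ha] at h
    exact pos_of_mul_pos_right h (by positivity)
  have hbv : inner ℝ (gradient σ p) (a - b) < 0 := by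
    have h : inner ℝ b (a - b) < 0 := by
      rw [inner_sub_right, real_inner_self_eq_norm_sq, hb1, real_inner_comm]; linarith
    rw [hb, real_inner_smul_left, ← hb] at h
    exact neg_of_mul_neg_right h (by positivity)
  have hle : 𝓝[>] (0 : ℝ) ≤ 𝓝[≠] 0 := nhdsWithin_mono 0 (fun t (ht : 0 < t) => ht.ne')
  have e1 := ((hasDerivAt_iff_tendsto_slope.mp (line ρ hρ (a - b))).eventually
    (lt_mem_nhds hav)).filter_mono hle
  have e2 := ((hasDerivAt_iff_tendsto_slope.mp (line σ hσ (a - b))).eventually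
    (gt_mem_nhds hbv)).filter_mono hle
  have hc : Tendsto (fun t : ℝ => p + t • (a - b)) (𝓝[>] 0) (𝓝 p) := by
    have : Continuous (fun t : ℝ => p + t • (a - b)) := by fun_prop
    simpa using (this.tendsto 0).mono_left nhdsWithin_le_nhds
  have h0 : ∀ᶠ t : ℝ in 𝓝[>] 0, 0 < t := self_mem_nhdsWithin
  obtain ⟨t, ht1, ht2, ht3, ht4, ht0⟩ := (e1.and (e2.and
    ((hc.eventually hρ.eventually_mem_iff).and
      ((hc.eventually hσ.eventually_mem_iff).and h0)))).exists
  simp only [slope_def_field, zero_smul, add_zero, zero _ hρ, zero _ hσ, sub_zero] at ht1 ht2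
  have h1 : 0 < ρ (p + t • (a - b)) := by
    by_contra h
    exact absurd ht1 (not_lt.mpr (div_nonpos_of_nonpos_of_nonneg (not_lt.mp h) ht0.le))
  have h2 : σ (p + t • (a - b)) < 0 := by
    by_contra h
    exact absurd ht2 (not_lt.mpr (div_nonneg (not_lt.mp h) ht0.le))
  exact absurd (ht3.mp (ht4.mpr h2)) (not_lt.mpr h1.le)

open Classical in
/-- The outward unit normal `ν(p) = ∇ρ(p) / |∇ρ(p)|` at a boundary point `p` of `Ω`, for a `C¹`
defining function `ρ` of `Ω` near `p`; it does not depend on `ρ`. -/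
def outwardNormal {d : ℕ} (Ω : Set (EuclideanSpace ℝ (Fin d)))
    (p : EuclideanSpace ℝ (Fin d)) : EuclideanSpace ℝ (Fin d) :=
  if h : ∃ ρ, IsC1DefiningFunction Ω p ρ then
    ‖gradient h.choose p‖⁻¹ • gradient h.choose p
  else 0

/-- The integrand `∂(Im Φ(·, z))/∂ν u - Im Φ(·, z) ∂u/∂ν` on the boundary of `Ω`. -/
def boundaryIntegrand (d : ℕ) (k : ℝ) (Ω : Set (EuclideanSpace ℝ (Fin d)))
    (u : EuclideanSpace ℝ (Fin d) → ℂ) (z p : EuclideanSpace ℝ (Fin d)) : ℂ :=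
  (fderiv ℝ (fun q => imGreen d k q z) p (outwardNormal Ω p) : ℂ) * u p -
    (imGreen d k p z : ℂ) * fderiv ℝ u p (outwardNormal Ω p)

/-- The imaging functional `I(z)`: the integral of `boundaryIntegrand` over `∂Ω` against surface
measure (the `(d-1)`-dimensional Hausdorff measure, normalized to agree with Lebesgue measure on
`ℝ^(d-1)`). -/
def imagingFunctional (d : ℕ) (k : ℝ) (Ω : Set (EuclideanSpace ℝ (Fin d)))
    (u : EuclideanSpace ℝ (Fin d) → ℂ) (z : EuclideanSpace ℝ (Fin d)) : ℂ :=
  ∫ p in frontier Ω, boundaryIntegrand d k Ω u z p ∂μHE[d - 1]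

/-- The small subregion `x + εB`. -/
def inclusion {d : ℕ} (ε : ℝ) (x : EuclideanSpace ℝ (Fin d))
    (B : Set (EuclideanSpace ℝ (Fin d))) : Set (EuclideanSpace ℝ (Fin d)) :=
  (fun ω => x + ε • ω) '' B

/-- The support `D = ⋃ⱼ (xⱼ + εBⱼ)` of the source. -/
def sourceSet {d N : ℕ} (ε : ℝ) (x : Fin N → EuclideanSpace ℝ (Fin d))
    (B : Fin N → Set (EuclideanSpace ℝ (Fin d))) : Set (EuclideanSpace ℝ (Fin d)) :=
  ⋃ j, inclusion ε (x j) (B j)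

/-- The radiating field `u(p) = ∫_D f(y) Φ(p, y) dy`. -/
def radiatedField (d : ℕ) (k : ℝ) (D : Set (EuclideanSpace ℝ (Fin d)))
    (f : EuclideanSpace ℝ (Fin d) → ℂ) (p : EuclideanSpace ℝ (Fin d)) : ℂ :=
  ∫ y in D, f y * green d k p y

/-- The leading term `ε^d ∑ⱼ f̄_{Dⱼ} |Bⱼ| Im Φ(xⱼ, z)`, with `f̄_{Dⱼ}` the average of `f` over
`Dⱼ = xⱼ + εBⱼ`. -/
def leadingTerm (d : ℕ) (k : ℝ) {N : ℕ} (ε : ℝ) (x : Fin N → EuclideanSpace ℝ (Fin d))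
    (B : Fin N → Set (EuclideanSpace ℝ (Fin d))) (f : EuclideanSpace ℝ (Fin d) → ℂ)
    (z : EuclideanSpace ℝ (Fin d)) : ℂ :=
  (ε : ℂ) ^ d * ∑ j, (⨍ y in inclusion ε (x j) (B j), f y) * (volume.real (B j) : ℂ) *
    (imGreen d k (x j) z : ℂ)

end SmallSources

end

/-! The functional is exactly I(z) = ∫_D f(y) Im Φ(y, z) dy (`imagingFunctional_eq`). Indeed V = Im
Φ(·, z) solves the Helmholtz equation in all of space, so for y ∈ Ω Green's representation formula
gives ∫_{∂Ω} (∂_ν V Φ(·, y) - V ∂_ν Φ(·, y)) ds = V(y) (`integral_frontier_eq`). Multiplying by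
f(y), integrating over D and exchanging integrals is legitimate because D stays away from ∂Ω. The
expansion then only replaces V on Dⱼ by V(xⱼ): V is Lipschitz uniformly in z, Dⱼ lies within O(ε) of
xⱼ, and ∫_{Dⱼ} |f| is ε^d |Bⱼ| times the average of |f|.

Green's formula rests on the divergence theorem for C¹ domains with Hausdorff surface measure
(`IsBoundedC1Domain.integral_fderiv`). Near a boundary point one projects along a direction e
transversal to ∂Ω; Fubini and the fundamental theorem of calculus on lines parallel to e leave an
integral over the projected boundary. `integral_frameProj_eq` turns it into a surface integral with
density ⟪ν, e⟫, by comparing two measures on small, almost flat pieces. Other directions are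
differences of transversal ones, and a partition of unity globalizes.

Both Φ and Im Φ are written as profiles h(|p|²), for which the Helmholtz equation reads 4t h'' + 2d
h' + k² h = 0. The singularity of Φ is not cut out but smoothed: h(|p - y|² + δ²) satisfies the
Helmholtz equation with right-hand side -4δ² h''(|p - y|² + δ²), and 4δ² h''(|p - y|² + δ²) is an
approximate identity at y (`tendsto_integral_kernel`) by the blow-up rate of h'' at 0. The Lipschitz
bound for Im Φ comes from the energy 4t H'² + k² H², which does not increase. -/

namespace SmallSources

open Module
open scoped NNReal ENNReal RealInnerProductSpace

/-! ### Orthonormal frames adapted to a unit vector, and the Jacobian of a projection between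
hyperplanes. -/

section Frame

variable {E : Type*} [NormedAddCommGroup E] [InnerProductSpace ℝ E] {n : ℕ}

/-- A unit vector has an isometric parametrization of its orthogonal complement. -/
theorem exists_orthogonal_isometry (hE : finrank ℝ E = n + 1) {e : E} (he : ‖e‖ = 1) :
    ∃ i : EuclideanSpace ℝ (Fin n) →ₗᵢ[ℝ] E, ∀ x, ⟪e, i x⟫ = 0 := by
  have : Fact (finrank ℝ E = n + 1) := ⟨hE⟩
  have he0 : e ≠ 0 := by rintro rfl; simp at he
  refine ⟨(ℝ ∙ e)ᗮ.subtypeₗᵢ.comp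
    (OrthonormalBasis.fromOrthogonalSpanSingleton n he0).repr.symm.toLinearIsometry, fun x => ?_⟩
  exact Submodule.mem_orthogonal_singleton_iff_inner_right.mp
    ((OrthonormalBasis.fromOrthogonalSpanSingleton n he0).repr.symm x).2

variable [FiniteDimensional ℝ E] {e : E} {i : EuclideanSpace ℝ (Fin n) →ₗᵢ[ℝ] E}

/-- The isometric coordinates `(x, s) ↦ i x + s e` adapted to a unit vector `e`. -/
noncomputable def frameEquiv (hE : finrank ℝ E = n + 1) (he : ‖e‖ = 1) (hi : ∀ x, ⟪e, i x⟫ = 0) :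
    WithLp 2 (EuclideanSpace ℝ (Fin n) × ℝ) ≃ₗᵢ[ℝ] E :=
  LinearIsometry.toLinearIsometryEquiv
    { toFun := fun q => i q.fst + q.snd • e
      map_add' := fun q r => by simp [add_smul]; abel
      map_smul' := fun c q => by simp [mul_smul]
      norm_map' := fun q => by
        have h : ‖i q.fst + q.snd • e‖ ^ 2 = ‖q‖ ^ 2 := by
          rw [norm_add_sq_real, WithLp.prod_norm_sq_eq_of_L2, i.norm_map, norm_smul, he,
            inner_smul_right, real_inner_comm, hi]
          simp
        exact (sq_eq_sq₀ (norm_nonneg _) (norm_nonneg _)).mp h }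
    (by
      rw [hE, (WithLp.linearEquiv 2 ℝ (EuclideanSpace ℝ (Fin n) × ℝ)).finrank_eq]
      simp)

theorem frameEquiv_apply (hE : finrank ℝ E = n + 1) (he : ‖e‖ = 1) (hi : ∀ x, ⟪e, i x⟫ = 0)
    (q : WithLp 2 (EuclideanSpace ℝ (Fin n) × ℝ)) :
    frameEquiv hE he hi q = i q.fst + q.snd • e := rfl

/-- The projection along `e` in the coordinates given by `i`. -/
noncomputable def frameProj (i : EuclideanSpace ℝ (Fin n) →ₗᵢ[ℝ] E) :
    E →L[ℝ] EuclideanSpace ℝ (Fin n) :=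
  ContinuousLinearMap.adjoint i.toContinuousLinearMap

theorem frameProj_isometry (i : EuclideanSpace ℝ (Fin n) →ₗᵢ[ℝ] E) (x) :
    frameProj i (i x) = x := by
  refine ext_inner_right ℝ fun y => ?_
  rw [frameProj, ContinuousLinearMap.adjoint_inner_left]
  exact i.inner_map_map x y

theorem frameProj_self (hi : ∀ x, ⟪e, i x⟫ = 0) : frameProj i e = 0 := by
  refine ext_inner_right ℝ fun y => ?_
  rw [frameProj, ContinuousLinearMap.adjoint_inner_left, inner_zero_left]
  exact hi y

theorem frame_decomp (hE : finrank ℝ E = n + 1) (he : ‖e‖ = 1) (hi : ∀ x, ⟪e, i x⟫ = 0) (x : E) :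
    i (frameProj i x) + ⟪e, x⟫ • e = x := by
  obtain ⟨q, rfl⟩ := (frameEquiv hE he hi).surjective x
  rw [frameEquiv_apply, map_add, map_smul, frameProj_isometry, frameProj_self hi, inner_add_right,
    hi, inner_smul_right, real_inner_self_eq_norm_sq, he]
  simp

theorem norm_sq_frame (hE : finrank ℝ E = n + 1) (he : ‖e‖ = 1) (hi : ∀ x, ⟪e, i x⟫ = 0) (x : E) :
    ‖frameProj i x‖ ^ 2 + ⟪e, x⟫ ^ 2 = ‖x‖ ^ 2 := by
  conv_rhs => rw [← frame_decomp hE he hi x]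
  rw [norm_add_sq_real, i.norm_map, norm_smul, he, inner_smul_right,
    real_inner_comm e (i (frameProj i x)), hi]
  simp

theorem norm_frameProj_le (hE : finrank ℝ E = n + 1) (he : ‖e‖ = 1) (hi : ∀ x, ⟪e, i x⟫ = 0)
    (x : E) : ‖frameProj i x‖ ≤ ‖x‖ := by
  have := norm_sq_frame hE he hi x
  exact (sq_le_sq₀ (norm_nonneg _) (norm_nonneg _)).mp (by nlinarith [sq_nonneg ⟪e, x⟫])

/-- This is what allows Fubini along lines parallel to e. -/
theorem measurePreserving_frame [MeasurableSpace E] [BorelSpace E] (hE : finrank ℝ E = n + 1)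
    (he : ‖e‖ = 1) (hi : ∀ x, ⟪e, i x⟫ = 0) :
    MeasurePreserving (fun q : EuclideanSpace ℝ (Fin n) × ℝ => i q.1 + q.2 • e)
      (volume.prod volume) volume :=
  (frameEquiv hE he hi).measurePreserving.comp (WithLp.volume_preserving_toLp _ _)

/-- The Jacobian of the projection along `e` on the orthogonal complement of `ν`. -/
theorem abs_det_frameProj_comp (hE : finrank ℝ E = n + 1) {ν : E}
    {j : EuclideanSpace ℝ (Fin n) →ₗᵢ[ℝ] E} (he : ‖e‖ = 1) (hi : ∀ x, ⟪e, i x⟫ = 0)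
    (hν : ‖ν‖ = 1) (hj : ∀ x, ⟪ν, j x⟫ = 0) :
    |((frameProj i).comp j.toContinuousLinearMap).det| = |⟪ν, e⟫| := by
  set A := (frameProj j).comp i.toContinuousLinearMap with hA
  have hadj : (frameProj i).comp j.toContinuousLinearMap = ContinuousLinearMap.adjoint A := by
    rw [hA, ContinuousLinearMap.adjoint_comp, frameProj, frameProj,
      ContinuousLinearMap.adjoint_adjoint]
  set L := (frameProj i).comp j.toContinuousLinearMap with hL
  have hLA : ContinuousLinearMap.adjoint L = A := by
    rw [hadj, ContinuousLinearMap.adjoint_adjoint]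
  -- Computing det(L*L) instead of det L is enough, since only |det L| is needed and L*L has an
  -- explicit form.
  have hsq : L.det ^ 2 = (A.comp L).det := by
    have h := ContinuousLinearMap.normDet_sq L
    rw [LinearMap.normDet_eq_abs_det, sq_abs, hLA] at h
    exact_mod_cast h
  -- L*L is the rank-one perturbation x ↦ x - ⟪a, x⟫ a of the identity, where a is the projection of
  -- e to the complement of ν. Its determinant is 1 - |a|², which is ⟪ν, e⟫² by Pythagoras.
  have htr : ((A.comp L : EuclideanSpace ℝ (Fin n) →L[ℝ] _) : EuclideanSpace ℝ (Fin n) →ₗ[ℝ] _)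
      = LinearMap.transvection (innerₛₗ ℝ (frameProj j e)) (-(frameProj j e)) := by
    ext1 x
    have h1 : i (frameProj i (j x)) = j x - ⟪e, j x⟫ • e :=
      eq_sub_of_add_eq (frame_decomp hE he hi (j x))
    have h2 : ⟪frameProj j e, x⟫ = ⟪e, j x⟫ := by
      rw [frameProj, ContinuousLinearMap.adjoint_inner_left]; rfl
    have h3 : (A.comp L) x = frameProj j (i (frameProj i (j x))) := rfl
    rw [ContinuousLinearMap.coe_coe, h3, h1, map_sub, map_smul, frameProj_isometry,
      LinearMap.transvection.apply, innerₛₗ_apply_apply, h2]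
    simp [sub_eq_add_neg]
  have hdet : (A.comp L).det = ⟪ν, e⟫ ^ 2 := by
    have h := norm_sq_frame hE hν hj e
    rw [ContinuousLinearMap.det, htr, LinearMap.transvection.det, innerₛₗ_apply_apply,
      inner_neg_right, real_inner_self_eq_norm_sq]
    rw [he] at h
    linarith
  rw [← sq_eq_sq_iff_abs_eq_abs, hsq, hdet]

end Frame

/-! ### Surface measure and projection along a transversal direction. -/

section LocalComparison

/-- By second countability, countably many of the neighbourhoods cover the space; making them
disjoint, the local inequalities add up. -/
theorem measure_le_of_locally {X : Type*} [TopologicalSpace X] [SecondCountableTopology X]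
    [MeasurableSpace X] [OpensMeasurableSpace X] {α β : Measure X}
    (h : ∀ x, ∃ W ∈ 𝓝 x, ∀ A ⊆ W, MeasurableSet A → α A ≤ β A) : α ≤ β := by
  choose W hW hle using h
  obtain ⟨s, hs, hcov⟩ := TopologicalSpace.countable_cover_nhds
    (f := fun x => interior (W x)) fun x => interior_mem_nhds.mpr (hW x)
  refine Measure.le_intro fun A hA ⟨a, _⟩ => ?_
  have hne : s.Nonempty := by
    obtain ⟨x, hx, -⟩ := mem_iUnion₂.mp (hcov.symm ▸ mem_univ a)
    exact ⟨x, hx⟩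
  obtain ⟨u, rfl⟩ := hs.exists_eq_range hne
  set V : ℕ → Set X := fun m => interior (W (u m)) with hV
  have hVm : ∀ m, MeasurableSet (disjointed V m) :=
    MeasurableSet.disjointed fun m => isOpen_interior.measurableSet
  have hA' : A = ⋃ m, A ∩ disjointed V m := by
    rw [← inter_iUnion, iUnion_disjointed, hV, ← biUnion_range (f := u)
      (g := fun x => interior (W x)), hcov, inter_univ]
  have hd : Pairwise (Function.onFun Disjoint fun m => A ∩ disjointed V m) := fun m m' hm =>
    (disjoint_disjointed V hm).mono inter_subset_right inter_subset_right
  rw [hA', measure_iUnion hd fun m => hA.inter (hVm m),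
    measure_iUnion hd fun m => hA.inter (hVm m)]
  refine ENNReal.tsum_le_tsum fun m => hle (u m) _ ?_ (hA.inter (hVm m))
  exact inter_subset_right.trans ((disjointed_subset V m).trans interior_subset)

theorem euclideanHausdorffMeasure_image_le {X Y : Type*} [EMetricSpace X] [EMetricSpace Y]
    [MeasurableSpace X] [BorelSpace X] [MeasurableSpace Y] [BorelSpace Y] {K : ℝ≥0} {f : X → Y}
    {s : Set X} (hf : LipschitzOnWith K f s) (n : ℕ) :
    μHE[n] (f '' s) ≤ (K : ℝ≥0∞) ^ n * μHE[n] s := by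
  have h := hf.hausdorffMeasure_image_le (d := n) n.cast_nonneg
  rw [ENNReal.rpow_natCast] at h
  simp only [Measure.euclideanHausdorffMeasure_def, Measure.smul_apply, ENNReal.smul_def,
    smul_eq_mul]
  rw [mul_left_comm]
  gcongr

variable {E : Type*} [NormedAddCommGroup E] [InnerProductSpace ℝ E] [FiniteDimensional ℝ E]
  [MeasurableSpace E] [BorelSpace E] {n : ℕ} {e ν : E} {i : EuclideanSpace ℝ (Fin n) →ₗᵢ[ℝ] E}

/-- On sets that are almost flat, with normal close to `ν`, the projection along `e` changes the
`n`-dimensional measure by a factor close to `⟪ν, e⟫`. -/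
theorem exists_flatness (hE : finrank ℝ E = n + 1) (he : ‖e‖ = 1) (hi : ∀ x, ⟪e, i x⟫ = 0)
    (hν : ‖ν‖ = 1) (hc : 0 < ⟪ν, e⟫) {K : ℝ≥0} (hK : 1 < K) :
    ∃ η : ℝ, 0 < η ∧ ∀ A : Set E, (∀ a ∈ A, ∀ b ∈ A, |⟪ν, a - b⟫| ≤ η * ‖a - b‖) →
      volume (frameProj i '' A) ≤ K * ENNReal.ofReal ⟪ν, e⟫ * μHE[n] A ∧
      ENNReal.ofReal ⟪ν, e⟫ * μHE[n] A ≤ K * K * volume (frameProj i '' A) := by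
  obtain ⟨j, hj⟩ := exists_orthogonal_isometry hE hν
  set c := ⟪ν, e⟫ with hcdef
  have hK0 : 0 < K := zero_lt_one.trans hK
  set C : ℝ≥0 := c.toNNReal with hC
  have hC0 : 0 < C := Real.toNNReal_pos.mpr hc
  set L := (frameProj i).comp j.toContinuousLinearMap with hL
  have hdet : ENNReal.ofReal |L.det| = C := by
    rw [hL, abs_det_frameProj_comp hE he hi hν hj, abs_of_pos hc]; rfl
  -- Maps sufficiently close to the linear map L distort volume by a factor between C / K and K C,
  -- where C = |det L| = ⟪ν, e⟫.
  have h1 := addHaar_image_le_mul_of_det_lt volume L (m := K * C) (by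
    rw [hdet]; exact_mod_cast lt_mul_of_one_lt_left hC0 hK)
  have h2 := mul_le_addHaar_image_of_lt_det volume L (m := C / K) (by
    rw [hdet]; exact_mod_cast div_lt_self hC0 hK)
  obtain ⟨δ, ⟨h1, h2⟩, hδ⟩ := ((h1.and h2).and self_mem_nhdsWithin).exists
  have hδ0 : (0 : ℝ) < δ := hδ
  -- η must meet two demands: η / (1 - η) < δ, so that the map below approximates L to within δ, and
  -- (1 - η)^(-n) < K, so that the inverse projection expands the n-dimensional measure by at most
  -- K.
  have t1 : Tendsto (fun η : ℝ => η * (1 - η)⁻¹) (𝓝[>] 0) (𝓝 0) := by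
    have : ContinuousAt (fun η : ℝ => η * (1 - η)⁻¹) 0 := by fun_prop (disch := simp)
    simpa using this.tendsto.mono_left nhdsWithin_le_nhds
  have t2 : Tendsto (fun η : ℝ => ((1 - η)⁻¹) ^ n) (𝓝[>] 0) (𝓝 1) := by
    have : ContinuousAt (fun η : ℝ => ((1 - η)⁻¹) ^ n) 0 := by fun_prop (disch := simp)
    simpa using this.tendsto.mono_left nhdsWithin_le_nhds
  have t3 : ∀ᶠ η : ℝ in 𝓝[>] 0, η < 1 :=
    nhdsWithin_le_nhds (gt_mem_nhds zero_lt_one)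
  obtain ⟨η, hη1, hη2, hη3, hη0⟩ := ((t1.eventually (gt_mem_nhds hδ0)).and
    ((t2.eventually (gt_mem_nhds (show (1 : ℝ) < K from hK))).and
      (t3.and self_mem_nhdsWithin))).exists
  have hη0 : 0 < η := hη0
  have h1η : 0 < 1 - η := sub_pos.mpr hη3
  refine ⟨η, hη0, fun A hA => ?_⟩
  -- By Pythagoras the squared projection is at least (1 - η²)‖a - b‖², hence at least (1 - η)²‖a -
  -- b‖². So A is a Lipschitz graph over the complement of ν, parametrized by `g` below.
  have anti : ∀ a ∈ A, ∀ b ∈ A, ‖a - b‖ ≤ (1 - η)⁻¹ * ‖frameProj j (a - b)‖ := by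
    intro a ha b hb
    rw [le_inv_mul_iff₀ h1η]
    refine (sq_le_sq₀ (by positivity) (norm_nonneg _)).mp ?_
    have hsq := norm_sq_frame hE hν hj (a - b)
    have hle : ⟪ν, a - b⟫ ^ 2 ≤ (η * ‖a - b‖) ^ 2 := sq_le_sq' (abs_le.mp (hA a ha b hb)).1
      (abs_le.mp (hA a ha b hb)).2
    nlinarith [mul_nonneg (mul_nonneg hη0.le h1η.le) (sq_nonneg ‖a - b‖)]
  have hinj : InjOn (frameProj j) A := by
    intro a ha b hb hab
    have := anti a ha b hb
    rw [map_sub, hab, sub_self, norm_zero, mul_zero] at this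
    exact sub_eq_zero.mp (norm_le_zero_iff.mp this)
  set g := Function.invFunOn (frameProj j) A with hg
  have hgA : ∀ x ∈ frameProj j '' A, g x ∈ A := fun x hx => Function.invFunOn_mem hx
  have hgx : ∀ x ∈ frameProj j '' A, frameProj j (g x) = x := fun x hx => Function.invFunOn_eq hx
  have hga : ∀ a ∈ A, g (frameProj j a) = a := fun a ha =>
    hinj (hgA _ (mem_image_of_mem _ ha)) ha (hgx _ (mem_image_of_mem _ ha))
  have himg : g '' (frameProj j '' A) = A := by
    rw [image_image]
    exact (image_congr hga).trans (image_id A)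
  have himg' : (fun x => frameProj i (g x)) '' (frameProj j '' A) = frameProj i '' A := by
    rw [← image_image (frameProj i) g, himg]
  -- Passing from the tangent coordinates to the projection along e differs from L only through the
  -- ν-component of a - b, which flatness makes small.
  have happ : ApproximatesLinearOn (fun x => frameProj i (g x)) L (frameProj j '' A) δ := by
    intro x hx y hy
    set a := g x with ha
    set b := g y with hb
    have hd : x - y = frameProj j (a - b) := by rw [map_sub, hgx x hx, hgx y hy]
    have hdec := frame_decomp hE hν hj (a - b)
    have hrem : frameProj i a - frameProj i b - L (x - y) =
        frameProj i (⟪ν, a - b⟫ • ν) := by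
      have h3 : L (x - y) = frameProj i (j (x - y)) := rfl
      rw [h3, ← map_sub, ← map_sub, hd, ← eq_sub_of_add_eq' hdec]
    calc ‖frameProj i a - frameProj i b - L (x - y)‖ ≤ ‖⟪ν, a - b⟫ • ν‖ := by
          rw [hrem]; exact norm_frameProj_le hE he hi _
      _ = |⟪ν, a - b⟫| := by rw [norm_smul, hν, mul_one, Real.norm_eq_abs]
      _ ≤ η * ‖a - b‖ := hA _ (hgA x hx) _ (hgA y hy)
      _ ≤ η * ((1 - η)⁻¹ * ‖frameProj j (a - b)‖) := by
          gcongr; exact anti _ (hgA x hx) _ (hgA y hy)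
      _ ≤ δ * ‖x - y‖ := by rw [hd, ← mul_assoc]; gcongr
  have r1 := h1 _ _ happ
  have r2 := h2 _ _ happ
  rw [himg'] at r1 r2
  have lip1 : LipschitzOnWith 1 (frameProj j) A := LipschitzOnWith.of_dist_le_mul fun a _ b _ => by
    rw [dist_eq_norm, dist_eq_norm, ← map_sub, NNReal.coe_one, one_mul]
    exact norm_frameProj_le hE hν hj _
  obtain ⟨M, hM⟩ : ∃ M : ℝ≥0, (M : ℝ) = (1 - η)⁻¹ := ⟨⟨_, (inv_pos.mpr h1η).le⟩, rfl⟩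
  have lip2 : LipschitzOnWith M g (frameProj j '' A) :=
    LipschitzOnWith.of_dist_le_mul fun x hx y hy => by
      rw [dist_eq_norm, dist_eq_norm]
      have := anti _ (hgA x hx) _ (hgA y hy)
      rwa [map_sub, hgx x hx, hgx y hy, ← hM] at this
  have m1 := euclideanHausdorffMeasure_image_le lip1 n
  have m2 := euclideanHausdorffMeasure_image_le lip2 n
  rw [himg] at m2
  rw [EuclideanSpace.euclideanHausdorffMeasure_eq_volume] at m1 m2
  rw [ENNReal.coe_one, one_pow, one_mul] at m1
  have hpow : (M : ℝ≥0∞) ^ n ≤ K := by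
    rw [← hM] at hη2
    exact_mod_cast hη2.le
  have hCK : (C : ℝ≥0∞) = K * ((C / K : ℝ≥0) : ℝ≥0∞) := by
    rw [← ENNReal.coe_mul, mul_div_cancel₀ _ hK0.ne']
  change _ ≤ K * (C : ℝ≥0∞) * _ ∧ (C : ℝ≥0∞) * _ ≤ _
  constructor
  · refine r1.trans ?_
    rw [ENNReal.coe_mul]
    gcongr
  · calc (C : ℝ≥0∞) * μHE[n] A ≤ C * (K * volume (frameProj j '' A)) := by
          gcongr
          exact m2.trans (by gcongr)
      _ = K * K * (((C / K : ℝ≥0) : ℝ≥0∞) * volume (frameProj j '' A)) := by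
          rw [hCK]; ring
      _ ≤ K * K * volume (frameProj i '' A) := by gcongr

/-- Apply `exists_flatness` with e = ν and K = 2: the measure is at most four times the volume of a
bounded projection. -/
theorem exists_flatness_measure_lt_top (hE : finrank ℝ E = n + 1) (hν : ‖ν‖ = 1) :
    ∃ η : ℝ, 0 < η ∧ ∀ A : Set E, (∀ a ∈ A, ∀ b ∈ A, |⟪ν, a - b⟫| ≤ η * ‖a - b‖) →
      Bornology.IsBounded A → μHE[n] A < ∞ := by
  obtain ⟨j, hj⟩ := exists_orthogonal_isometry hE hν
  have h1 : ⟪ν, ν⟫ = 1 := by rw [real_inner_self_eq_norm_sq, hν, one_pow]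
  obtain ⟨η, hη, h⟩ := exists_flatness hE hν hj hν (by rw [h1]; exact one_pos) one_lt_two
  refine ⟨η, hη, fun A hA hb => ?_⟩
  have h2 := (h A hA).2
  rw [h1, ENNReal.ofReal_one, one_mul] at h2
  have hb' : Bornology.IsBounded (frameProj j '' A) :=
    (frameProj j).lipschitz.isBounded_image hb
  exact h2.trans_lt (ENNReal.mul_lt_top (ENNReal.mul_lt_top ENNReal.coe_lt_top ENNReal.coe_lt_top) hb'.measure_lt_top)

/-- The change of variables formula for the projection along `e` of a hypersurface with normal
`N`. -/
theorem integral_frameProj_eq {F : Type*} [NormedAddCommGroup F] [NormedSpace ℝ F]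
    (hE : finrank ℝ E = n + 1) (he : ‖e‖ = 1)
    (hi : ∀ x, ⟪e, i x⟫ = 0) {S : Set E} (hS : MeasurableSet S) (hinj : InjOn (frameProj i) S)
    {N : E → E} (hN : ContinuousOn N S) (hN1 : ∀ q ∈ S, ‖N q‖ = 1)
    (hNe : ∀ q ∈ S, 0 < ⟪N q, e⟫)
    (hflat : ∀ q ∈ S, ∀ η : ℝ, 0 < η → ∃ W ∈ 𝓝 q, ∀ a ∈ S ∩ W, ∀ b ∈ S ∩ W,
      |⟪N q, a - b⟫| ≤ η * ‖a - b‖)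
    {φ : E → F} {ψ : EuclideanSpace ℝ (Fin n) → F} (h1 : ∀ m ∈ S, ψ (frameProj i m) = φ m)
    (h0 : ∀ x, x ∉ frameProj i '' S → ψ x = 0) :
    ∫ x, ψ x = ∫ m in S, ⟪N m, e⟫ • φ m ∂μHE[n] := by
  have : CompleteSpace E := FiniteDimensional.complete ℝ E
  have : StandardBorelSpace S := hS.standardBorel
  set f : S → EuclideanSpace ℝ (Fin n) := fun m => frameProj i m with hf
  have hfc : Continuous f := (frameProj i).continuous.comp continuous_subtype_val
  -- The Lusin–Souslin theorem: an injective Borel map out of a standard Borel space has Borel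
  -- images.
  have hfe : MeasurableEmbedding f := hfc.measurable.measurableEmbedding
    fun a b hab => Subtype.ext (hinj a.2 b.2 hab)
  have hve : MeasurableEmbedding (Subtype.val : S → E) := MeasurableEmbedding.subtype_coe hS
  have hcc : Continuous fun m : S => ⟪N m, e⟫ :=
    (continuousOn_iff_continuous_domRestrict.mp hN).inner continuous_const
  have hdens : Measurable fun m : S => ENNReal.ofReal ⟪N m, e⟫ :=
    hcc.measurable.ennreal_ofReal
  -- The formula amounts to α = β, that is, Lebesgue measure pulled back by the projection equals
  -- surface measure with density ⟪N, e⟫. The two are compared locally up to powers of an arbitrary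
  -- K > 1, then globally by `measure_le_of_locally`, and finally K → 1.
  set α : Measure S := Measure.comap f volume with hα
  set β : Measure S := (Measure.comap Subtype.val μHE[n]).withDensity
    (fun m : S => ENNReal.ofReal ⟪N m, e⟫) with hβ
  -- One factor K pays for the oscillation of the density near q; the remaining K, respectively K²,
  -- is the loss in `exists_flatness`.
  have key : ∀ K : ℝ≥0, 1 < K → ∀ q : S, ∃ W ∈ 𝓝 q, ∀ A ⊆ W, MeasurableSet A →
      α A ≤ K ^ 2 * β A ∧ β A ≤ K ^ 3 * α A := by
    intro K hK q
    have hK0 : (0 : ℝ) < K := zero_lt_one.trans hK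
    have hq := hNe q q.2
    obtain ⟨η, hη, hfl⟩ := exists_flatness hE he hi (hN1 q q.2) hq hK
    obtain ⟨W, hW, hWf⟩ := hflat q q.2 η hη
    have e1 : ∀ᶠ m : S in 𝓝 q, ⟪N m, e⟫ < K * ⟪N q, e⟫ :=
      hcc.continuousAt.eventually (gt_mem_nhds (lt_mul_of_one_lt_left hq hK))
    have e2 : ∀ᶠ m : S in 𝓝 q, ⟪N q, e⟫ < K * ⟪N m, e⟫ :=
      (hcc.const_mul (K : ℝ)).continuousAt.eventually
        (lt_mem_nhds (lt_mul_of_one_lt_left hq hK))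
    have e3 : ∀ᶠ m : S in 𝓝 q, (m : E) ∈ W := continuous_subtype_val.continuousAt hW
    refine ⟨_, e1.and (e2.and e3), fun A hA hAm => ?_⟩
    have hfl' := hfl (Subtype.val '' A) (by
      rintro _ ⟨a, ha, rfl⟩ _ ⟨b, hb, rfl⟩
      exact hWf a ⟨a.2, (hA ha).2.2⟩ b ⟨b.2, (hA hb).2.2⟩)
    have hαA : α A = volume (frameProj i '' (Subtype.val '' A)) := by
      rw [hα, hfe.comap_apply, image_image]
    have hμA : Measure.comap Subtype.val μHE[n] A = μHE[n] (Subtype.val '' A) := by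
      rw [hve.comap_apply]
    have hβA : β A = ∫⁻ m in A, ENNReal.ofReal ⟪N m, e⟫ ∂(Measure.comap Subtype.val μHE[n]) := by
      rw [hβ, withDensity_apply _ hAm]
    have hβ1 : β A ≤ K * (ENNReal.ofReal ⟪N q, e⟫ * μHE[n] (Subtype.val '' A)) := by
      rw [hβA, ← hμA, ← mul_assoc, ← setLIntegral_const]
      refine setLIntegral_mono measurable_const fun m hm => ?_
      rw [← ENNReal.ofReal_coe_nnreal, ← ENNReal.ofReal_mul hK0.le]
      exact ENNReal.ofReal_le_ofReal (hA hm).1.le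
    have hβ2 : ENNReal.ofReal ⟪N q, e⟫ * μHE[n] (Subtype.val '' A) ≤ K * β A := by
      rw [hβA, ← hμA, ← setLIntegral_const, ← lintegral_const_mul _ hdens]
      refine setLIntegral_mono (hdens.const_mul _) fun m hm => ?_
      rw [← ENNReal.ofReal_coe_nnreal, ← ENNReal.ofReal_mul hK0.le]
      exact ENNReal.ofReal_le_ofReal (hA hm).2.1.le
    constructor
    · calc α A ≤ K * (ENNReal.ofReal ⟪N q, e⟫ * μHE[n] (Subtype.val '' A)) := by
            rw [hαA, ← mul_assoc]; exact hfl'.1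
        _ ≤ K * (K * β A) := by gcongr
        _ = K ^ 2 * β A := by ring
    · calc β A ≤ K * (ENNReal.ofReal ⟪N q, e⟫ * μHE[n] (Subtype.val '' A)) := hβ1
        _ ≤ K * (K * K * α A) := by rw [hαA]; exact mul_le_mul_right hfl'.2 _
        _ = K ^ 3 * α A := by ring
  have lim : ∀ (p : ℕ) (x : ℝ≥0∞), Tendsto (fun K : ℝ≥0 => (K : ℝ≥0∞) ^ p * x) (𝓝[>] 1) (𝓝 x) := by
    intro p x
    have h : Tendsto (fun K : ℝ≥0 => (K : ℝ≥0∞) ^ p) (𝓝[>] 1) (𝓝 1) := by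
      have h' : Continuous fun K : ℝ≥0 => ((K ^ p : ℝ≥0) : ℝ≥0∞) :=
        ENNReal.continuous_coe.comp (continuous_pow p)
      simpa using (h'.tendsto 1).mono_left nhdsWithin_le_nhds
    simpa using ENNReal.Tendsto.mul_const h (Or.inl one_ne_zero)
  have hαβ : α = β := by
    refine le_antisymm (Measure.le_iff.mpr fun A _ => ?_) (Measure.le_iff.mpr fun A _ => ?_)
    · refine ge_of_tendsto (lim 2 (β A)) ?_
      filter_upwards [self_mem_nhdsWithin] with K hK
      refine (measure_le_of_locally (β := (K ^ 2 : ℝ≥0) • β) fun q => ?_) A |>.trans (by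
        simp [ENNReal.smul_def])
      obtain ⟨W, hW, h⟩ := key K hK q
      exact ⟨W, hW, fun A hA hAm => (h A hA hAm).1.trans (by simp [ENNReal.smul_def])⟩
    · refine ge_of_tendsto (lim 3 (α A)) ?_
      filter_upwards [self_mem_nhdsWithin] with K hK
      refine (measure_le_of_locally (β := (K ^ 3 : ℝ≥0) • α) fun q => ?_) A |>.trans (by
        simp [ENNReal.smul_def])
      obtain ⟨W, hW, h⟩ := key K hK q
      exact ⟨W, hW, fun A hA hAm => (h A hA hAm).2.trans (by simp [ENNReal.smul_def])⟩
  have hrange : range f = frameProj i '' S := by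
    rw [hf, ← image_univ, ← image_image (frameProj i) Subtype.val, image_univ, Subtype.range_coe]
  calc ∫ x, ψ x = ∫ x in range f, ψ x :=
        (setIntegral_eq_integral_of_forall_compl_eq_zero fun x hx => h0 x (hrange ▸ hx)).symm
    _ = ∫ x, ψ x ∂(Measure.map f α) := by rw [hα, hfe.map_comap]
    _ = ∫ m, ψ (f m) ∂α := hfe.integral_map _
    _ = ∫ m : S, φ m ∂β := by rw [← hαβ]; exact integral_congr_ae (ae_of_all _ fun m => h1 m m.2)
    _ = ∫ m : S, ⟪N m, e⟫ • φ m ∂(Measure.comap Subtype.val μHE[n]) := by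
        rw [hβ, integral_withDensity_eq_integral_toReal_smul hdens (by simp)]
        refine integral_congr_ae (ae_of_all _ fun m => ?_)
        simp only
        rw [ENNReal.toReal_ofReal (hNe m m.2).le]
    _ = ∫ m in S, ⟪N m, e⟫ • φ m ∂μHE[n] :=
        integral_subtype_comap hS fun m => ⟪N m, e⟫ • φ m

end LocalComparison

/-! ### Geometry of the boundary: normal, flatness, finite surface measure. -/

section DefiningFunction

variable {d : ℕ} {Ω : Set (EuclideanSpace ℝ (Fin d))} {p e : EuclideanSpace ℝ (Fin d)}
  {ρ : EuclideanSpace ℝ (Fin d) → ℝ}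

theorem IsC1DefiningFunction.eq_zero (hΩ : IsOpen Ω) (hp : p ∈ frontier Ω)
    (hρ : IsC1DefiningFunction Ω p ρ) : ρ p = 0 := by
  have hpn : p ∉ Ω := fun h => (hΩ.frontier_eq ▸ hp).2 h
  have h1 : ¬ ρ p < 0 := fun h => hpn (hρ.eventually_mem_iff.self_of_nhds.mpr h)
  refine le_antisymm ?_ (not_lt.mp h1)
  by_contra h
  have h2 : ∀ᶠ q in 𝓝 p, 0 < ρ q :=
    hρ.contDiffAt.continuousAt.eventually (lt_mem_nhds (not_le.mp h))
  have h3 : ∃ᶠ q in 𝓝 p, q ∈ Ω := mem_closure_iff_frequently.mp hp.1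
  obtain ⟨q, hq, hq2, hq3⟩ := (h3.and_eventually (h2.and hρ.eventually_mem_iff)).exists
  exact absurd (hq3.mp hq) (not_lt.mpr hq2.le)

theorem outwardNormal_eq (hΩ : IsOpen Ω) (hp : p ∈ frontier Ω)
    (hρ : IsC1DefiningFunction Ω p ρ) :
    outwardNormal Ω p = ‖gradient ρ p‖⁻¹ • gradient ρ p := by
  have h : ∃ ρ, IsC1DefiningFunction Ω p ρ := ⟨ρ, hρ⟩
  rw [outwardNormal, dif_pos h]
  exact IsC1DefiningFunction.normal_unique hΩ hp h.choose_spec hρ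

theorem IsC1DefiningFunction.norm_outwardNormal (hΩ : IsOpen Ω) (hp : p ∈ frontier Ω)
    (hρ : IsC1DefiningFunction Ω p ρ) : ‖outwardNormal Ω p‖ = 1 := by
  rw [outwardNormal_eq hΩ hp hρ, norm_smul, norm_inv, norm_norm,
    inv_mul_cancel₀ (norm_ne_zero_iff.mpr hρ.gradient_ne_zero)]

theorem inner_gradient {q v : EuclideanSpace ℝ (Fin d)} :
    ⟪gradient ρ q, v⟫ = fderiv ℝ ρ q v := by
  rw [gradient, InnerProductSpace.toDual_symm_apply]

/-- Near a boundary point the defining function is `C¹` and increasing in the directions `e`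
pointing outwards. -/
theorem IsC1DefiningFunction.exists_ball (hρ : IsC1DefiningFunction Ω p ρ)
    (he : 0 < ⟪gradient ρ p, e⟫) :
    ∃ r > 0, ContDiffOn ℝ 1 ρ (Metric.ball p r) ∧ ContinuousOn (gradient ρ) (Metric.ball p r) ∧
      (∀ q ∈ Metric.ball p r, (q ∈ Ω ↔ ρ q < 0)) ∧
      ∀ q ∈ Metric.ball p r, 0 < ⟪gradient ρ q, e⟫ := by
  have h1 : ∀ᶠ q in 𝓝 p, ContDiffAt ℝ 1 ρ q := hρ.contDiffAt.eventually (by simp)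
  obtain ⟨r, hr, hball⟩ := Metric.eventually_nhds_iff_ball.mp h1
  have hC : ContDiffOn ℝ 1 ρ (Metric.ball p r) := fun q hq => (hball q hq).contDiffWithinAt
  have hg : ContinuousOn (gradient ρ) (Metric.ball p r) :=
    (LinearIsometryEquiv.continuous _).comp_continuousOn
      (hC.continuousOn_fderiv_of_isOpen Metric.isOpen_ball le_rfl)
  have h2 : ∀ᶠ q in 𝓝 p, 0 < ⟪gradient ρ q, e⟫ :=
    ((hg.continuousAt (Metric.ball_mem_nhds p hr)).inner continuousAt_const).eventually
      (lt_mem_nhds he)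
  obtain ⟨s, hs, hball2⟩ := Metric.eventually_nhds_iff_ball.mp (h2.and hρ.eventually_mem_iff)
  have hsub1 : Metric.ball p (min r s) ⊆ Metric.ball p r := Metric.ball_subset_ball (min_le_left _ _)
  have hsub2 : Metric.ball p (min r s) ⊆ Metric.ball p s :=
    Metric.ball_subset_ball (min_le_right _ _)
  exact ⟨min r s, lt_min hr hs, hC.mono hsub1, hg.mono hsub1, fun q hq => (hball2 q (hsub2 hq)).2,
    fun q hq => (hball2 q (hsub2 hq)).1⟩

theorem IsC1DefiningFunction.of_mem_ball {r : ℝ} (hC : ContDiffOn ℝ 1 ρ (Metric.ball p r))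
    (hm : ∀ q ∈ Metric.ball p r, (q ∈ Ω ↔ ρ q < 0))
    (hpos : ∀ q ∈ Metric.ball p r, 0 < ⟪gradient ρ q, e⟫) {q : EuclideanSpace ℝ (Fin d)}
    (hq : q ∈ Metric.ball p r) : IsC1DefiningFunction Ω q ρ where
  contDiffAt := hC.contDiffAt (Metric.isOpen_ball.mem_nhds hq)
  gradient_ne_zero h := by
    have := hpos q hq
    rw [h, inner_zero_left] at this
    exact lt_irrefl _ this
  eventually_mem_iff := by
    filter_upwards [Metric.isOpen_ball.mem_nhds hq] with x hx using hm x hx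

/-- Strict differentiability at p bounds ρ a - ρ b - ρ'(p)(a - b) by a small multiple of ‖a - b‖,
and ρ vanishes at both boundary points. -/
theorem IsC1DefiningFunction.flat (hΩ : IsOpen Ω) (hp : p ∈ frontier Ω)
    (hρ : IsC1DefiningFunction Ω p ρ) (hdef : ∀ᶠ q in 𝓝 p, IsC1DefiningFunction Ω q ρ)
    {η : ℝ} (hη : 0 < η) :
    ∃ W ∈ 𝓝 p, ∀ a ∈ frontier Ω ∩ W, ∀ b ∈ frontier Ω ∩ W,
      |⟪outwardNormal Ω p, a - b⟫| ≤ η * ‖a - b‖ := by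
  have hg : 0 < ‖gradient ρ p‖ := norm_pos_iff.mpr hρ.gradient_ne_zero
  have hst := hρ.contDiffAt.hasStrictFDerivAt one_ne_zero
  obtain ⟨c, hc⟩ : ∃ c : ℝ≥0, (c : ℝ) = η * ‖gradient ρ p‖ := ⟨⟨_, by positivity⟩, rfl⟩
  have hc0 : 0 < c := by rw [← NNReal.coe_pos, hc]; positivity
  obtain ⟨W, hW, happ⟩ := hst.approximates_deriv_on_nhds (c := c) (Or.inr hc0)
  refine ⟨_, inter_mem hW hdef, fun a ha b hb => ?_⟩
  have h := happ a ha.2.1 b hb.2.1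
  rw [ha.2.2.eq_zero hΩ ha.1, hb.2.2.eq_zero hΩ hb.1, sub_zero, zero_sub, norm_neg, hc,
    Real.norm_eq_abs, ← inner_gradient] at h
  rw [outwardNormal_eq hΩ hp hρ, real_inner_smul_left, abs_mul, abs_inv, abs_norm,
    inv_mul_le_iff₀ hg]
  linarith

/-- The pointwise choice in `outwardNormal` does no harm: near p all normals may be computed from
one and the same defining function. -/
theorem IsBoundedC1Domain.continuousOn_outwardNormal (hΩ : IsBoundedC1Domain Ω) :
    ContinuousOn (outwardNormal Ω) (frontier Ω) := by
  intro p hp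
  obtain ⟨ρ, hρ⟩ := hΩ.exists_defining p hp
  have hpos : 0 < ⟪gradient ρ p, gradient ρ p⟫ := real_inner_self_pos.mpr hρ.gradient_ne_zero
  obtain ⟨r, hr, hC, hg, hm, hpos⟩ := hρ.exists_ball hpos
  have hb := Metric.ball_mem_nhds p hr
  have h1 : ContinuousAt (fun q => ‖gradient ρ q‖⁻¹ • gradient ρ q) p :=
    ((hg.continuousAt hb).norm.inv₀ (norm_ne_zero_iff.mpr hρ.gradient_ne_zero)).smul
      (hg.continuousAt hb)
  refine h1.continuousWithinAt.congr_of_eventuallyEq ?_ (outwardNormal_eq hΩ.isOpen hp hρ)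
  filter_upwards [self_mem_nhdsWithin, mem_nhdsWithin_of_mem_nhds hb] with q hq hqb
  exact outwardNormal_eq hΩ.isOpen hq (IsC1DefiningFunction.of_mem_ball hC hm hpos hqb)

theorem IsBoundedC1Domain.isCompact_frontier (hΩ : IsBoundedC1Domain Ω) :
    IsCompact (frontier Ω) :=
  hΩ.isBounded.isCompact_closure.of_isClosed_subset isClosed_frontier frontier_subset_closure

theorem IsBoundedC1Domain.eventually_defining (hΩ : IsBoundedC1Domain Ω) (hp : p ∈ frontier Ω) :
    ∃ ρ, IsC1DefiningFunction Ω p ρ ∧ ∀ᶠ q in 𝓝 p, IsC1DefiningFunction Ω q ρ := by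
  obtain ⟨ρ, hρ⟩ := hΩ.exists_defining p hp
  have hpos : 0 < ⟪gradient ρ p, gradient ρ p⟫ := real_inner_self_pos.mpr hρ.gradient_ne_zero
  obtain ⟨r, hr, hC, hg, hm, hpos⟩ := hρ.exists_ball hpos
  refine ⟨ρ, hρ, ?_⟩
  filter_upwards [Metric.ball_mem_nhds p hr] with q hq
  exact IsC1DefiningFunction.of_mem_ball hC hm hpos hq

theorem IsBoundedC1Domain.norm_outwardNormal (hΩ : IsBoundedC1Domain Ω) (hp : p ∈ frontier Ω) :
    ‖outwardNormal Ω p‖ = 1 := by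
  obtain ⟨ρ, hρ⟩ := hΩ.exists_defining p hp
  exact hρ.norm_outwardNormal hΩ.isOpen hp

/-- Near each of its points the compact boundary is flat enough to have finite measure. -/
theorem IsBoundedC1Domain.measure_frontier_lt_top {n : ℕ} (hd : d = n + 1)
    (hΩ : IsBoundedC1Domain Ω) : μHE[n] (frontier Ω) < ∞ := by
  have hE : finrank ℝ (EuclideanSpace ℝ (Fin d)) = n + 1 := by simp [hd]
  refine hΩ.isCompact_frontier.measure_lt_top_of_nhdsWithin fun p hp => ?_
  obtain ⟨ρ, hρ, hev⟩ := hΩ.eventually_defining hp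
  obtain ⟨η, hη, h⟩ := exists_flatness_measure_lt_top hE (hΩ.norm_outwardNormal hp)
  obtain ⟨W, hW, hfl⟩ := hρ.flat hΩ.isOpen hp hev hη
  exact ⟨frontier Ω ∩ W, inter_mem self_mem_nhdsWithin (mem_nhdsWithin_of_mem_nhds hW),
    h _ hfl (hΩ.isCompact_frontier.isBounded.subset inter_subset_left)⟩

end DefiningFunction

/-! ### The divergence theorem near a boundary point. -/

section LocalDivergence

variable {d n : ℕ} {Ω : Set (EuclideanSpace ℝ (Fin d))} {p e : EuclideanSpace ℝ (Fin d)}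
  {ρ : EuclideanSpace ℝ (Fin d) → ℝ} {r : ℝ}

theorem hasDerivAt_line {q : EuclideanSpace ℝ (Fin d)} {t : ℝ}
    (h : DifferentiableAt ℝ ρ (q + t • e)) :
    HasDerivAt (fun t : ℝ => ρ (q + t • e)) ⟪gradient ρ (q + t • e), e⟫ t := by
  rw [inner_gradient]
  have hl : HasDerivAt (fun t : ℝ => q + t • e) e t := by
    simpa using ((hasDerivAt_id t).smul_const e).const_add q
  exact h.hasFDerivAt.comp_hasDerivAt t hl

theorem convex_setOf_line_mem_ball (q e p : EuclideanSpace ℝ (Fin d)) (r : ℝ) :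
    Convex ℝ {t : ℝ | q + t • e ∈ Metric.ball p r} := by
  have h : {t : ℝ | q + t • e ∈ Metric.ball p r} =
      (AffineMap.lineMap q (q + e) : ℝ →ᵃ[ℝ] _) ⁻¹' Metric.ball p r := by
    ext t
    rw [mem_preimage, AffineMap.lineMap_apply, vsub_eq_sub, add_sub_cancel_left, vadd_eq_add,
      add_comm]
    rfl
  rw [h]
  exact (convex_ball p r).affine_preimage _

theorem defining_lt_along (hC : ContDiffOn ℝ 1 ρ (Metric.ball p r))
    (hpos : ∀ q ∈ Metric.ball p r, 0 < ⟪gradient ρ q, e⟫) {q : EuclideanSpace ℝ (Fin d)} {a b : ℝ}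
    (ha : q + a • e ∈ Metric.ball p r) (hb : q + b • e ∈ Metric.ball p r) (hab : a < b) :
    ρ (q + a • e) < ρ (q + b • e) := by
  have hmem : ∀ t ∈ Icc a b, q + t • e ∈ Metric.ball p r := by
    intro t ht
    exact (convex_setOf_line_mem_ball q e p r).ordConnected.out ha hb ht
  have hd : ∀ t ∈ Icc a b, HasDerivAt (fun t : ℝ => ρ (q + t • e)) ⟪gradient ρ (q + t • e), e⟫ t :=
    fun t ht => hasDerivAt_line ((hC.differentiableOn one_ne_zero).differentiableAt
      (Metric.isOpen_ball.mem_nhds (hmem t ht)))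
  have hmono : StrictMonoOn (fun t : ℝ => ρ (q + t • e)) (Icc a b) := by
    refine strictMonoOn_of_deriv_pos (convex_Icc a b)
      (fun t ht => (hd t ht).continuousAt.continuousWithinAt) fun t ht => ?_
    rw [(hd t (interior_subset ht)).deriv]
    exact hpos _ (hmem t (interior_subset ht))
  exact hmono (left_mem_Icc.mpr hab.le) (right_mem_Icc.mpr hab.le) hab

/-- Moving backwards along e makes ρ negative, so q is a limit of points of Ω without belonging to
it. -/
theorem mem_frontier_of_eq_zero
    (hC : ContDiffOn ℝ 1 ρ (Metric.ball p r)) (hm : ∀ q ∈ Metric.ball p r, (q ∈ Ω ↔ ρ q < 0))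
    (hpos : ∀ q ∈ Metric.ball p r, 0 < ⟪gradient ρ q, e⟫) {q : EuclideanSpace ℝ (Fin d)}
    (hq : q ∈ Metric.ball p r) (h0 : ρ q = 0) : q ∈ frontier Ω := by
  have hqn : q ∉ Ω := fun h => lt_irrefl (0 : ℝ) (h0 ▸ (hm q hq).mp h)
  refine ⟨?_, fun h => hqn (interior_subset h)⟩
  have hc : Tendsto (fun t : ℝ => q + t • e) (𝓝[<] 0) (𝓝 q) := by
    have : Continuous (fun t : ℝ => q + t • e) := by fun_prop
    simpa using (this.tendsto 0).mono_left nhdsWithin_le_nhds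
  refine mem_closure_of_tendsto hc ?_
  filter_upwards [hc.eventually (Metric.isOpen_ball.mem_nhds hq), self_mem_nhdsWithin] with t ht ht0
  have := defining_lt_along hC hpos ht (b := 0) (by simpa using hq) ht0
  rw [zero_smul, add_zero, h0] at this
  exact (hm _ ht).mpr this

/-- The divergence theorem for functions supported near a boundary point, in a direction pointing
outwards. -/
theorem integral_fderiv_of_tsupport_subset_ball {F : Type*} [NormedAddCommGroup F]
    [NormedSpace ℝ F] [CompleteSpace F] (hd : d = n + 1) (hΩ : IsOpen Ω) (he : ‖e‖ = 1)
    (hC : ContDiffOn ℝ 1 ρ (Metric.ball p r)) (hg : ContinuousOn (gradient ρ) (Metric.ball p r))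
    (hm : ∀ q ∈ Metric.ball p r, (q ∈ Ω ↔ ρ q < 0))
    (hpos : ∀ q ∈ Metric.ball p r, 0 < ⟪gradient ρ q, e⟫)
    {φ : EuclideanSpace ℝ (Fin d) → F} (hφ : ContDiff ℝ 1 φ)
    (hsupp : tsupport φ ⊆ Metric.ball p r) :
    ∫ x in Ω, fderiv ℝ φ x e = ∫ m in frontier Ω, ⟪outwardNormal Ω m, e⟫ • φ m ∂μHE[n] := by
  have hE : finrank ℝ (EuclideanSpace ℝ (Fin d)) = n + 1 := by simp [hd]
  obtain ⟨i, hi⟩ := exists_orthogonal_isometry hE he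
  have hdef := fun q hq => IsC1DefiningFunction.of_mem_ball (q := q) hC hm hpos hq
  set S := frontier Ω ∩ Metric.ball p r with hS
  have hSm : MeasurableSet S := isClosed_frontier.measurableSet.inter measurableSet_ball
  have hS0 : ∀ q ∈ S, ρ q = 0 := fun q hq => (hdef q hq.2).eq_zero hΩ hq.1
  have hcs : HasCompactSupport φ :=
    Metric.isCompact_of_isClosed_isBounded (isClosed_tsupport φ)
      (Metric.isBounded_ball.subset hsupp)
  have hφ0 : ∀ x ∉ Metric.ball p r, φ x = 0 := fun x hx =>
    image_eq_zero_of_notMem_tsupport fun h => hx (hsupp h)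
  have hφ'0 : ∀ x ∉ Metric.ball p r, fderiv ℝ φ x = 0 := fun x hx =>
    image_eq_zero_of_notMem_tsupport fun h => hx (hsupp (tsupport_fderiv_subset ℝ h))
  have hφ'c : Continuous fun x => fderiv ℝ φ x e :=
    (hφ.continuous_fderiv one_ne_zero).clm_apply continuous_const
  have hdec : ∀ x, i (frameProj i x) + ⟪e, x⟫ • e = x := frame_decomp hE he hi
  have hlt : ∀ (x) (a b : ℝ), i x + a • e ∈ Metric.ball p r → i x + b • e ∈ Metric.ball p r → a < b →
      ρ (i x + a • e) < ρ (i x + b • e) := fun x a b ha hb => defining_lt_along hC hpos ha hb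
  -- Two points of S on one line parallel to e would be two zeros of ρ, which is strictly increasing
  -- along that line inside the ball.
  have hinj : InjOn (frameProj i) S := by
    intro a ha b hb hab
    have ha' := hdec a
    have hb' := hdec b
    rw [← hab] at hb'
    have key : ⟪e, a⟫ = ⟪e, b⟫ := by
      by_contra hne
      rcases lt_or_gt_of_ne hne with h | h
      · have := hlt (frameProj i a) _ _ (ha'.symm ▸ ha.2) (hb'.symm ▸ hb.2) h
        rw [ha', hb', hS0 a ha, hS0 b hb] at this
        exact lt_irrefl _ this
      · have := hlt (frameProj i a) _ _ (hb'.symm ▸ hb.2) (ha'.symm ▸ ha.2) h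
        rw [ha', hb', hS0 a ha, hS0 b hb] at this
        exact lt_irrefl _ this
    rw [← ha', ← hb', key]
  classical
  set ψ : EuclideanSpace ℝ (Fin n) → F :=
    fun x => if h : ∃ m ∈ S, frameProj i m = x then φ h.choose else 0 with hψ
  have hψ1 : ∀ m ∈ S, ψ (frameProj i m) = φ m := by
    intro m hm
    have h : ∃ m' ∈ S, frameProj i m' = frameProj i m := ⟨m, hm, rfl⟩
    rw [hψ]
    simp only
    rw [dif_pos h, hinj h.choose_spec.1 hm h.choose_spec.2]
  have hψ0 : ∀ x, x ∉ frameProj i '' S → ψ x = 0 := fun x hx => dif_neg hx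
  -- The fundamental theorem of calculus on each line parallel to e: the line yields the value of φ
  -- at its unique point of S, or zero if it misses S.
  have hinner : ∀ x, ∫ s : ℝ, Ω.indicator (fun x => fderiv ℝ φ x e) (i x + s • e) = ψ x := by
    intro x
    set g : ℝ → F := fun s => φ (i x + s • e) with hgdef
    have hgC : ContDiff ℝ 1 g := hφ.comp (by fun_prop)
    have hgd : ∀ s : ℝ, deriv g s = fderiv ℝ φ (i x + s • e) e := by
      intro s
      have hl : HasDerivAt (fun t : ℝ => i x + t • e) e s := by
        simpa using ((hasDerivAt_id s).smul_const e).const_add (i x)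
      exact ((hφ.differentiable one_ne_zero _).hasFDerivAt.comp_hasDerivAt s hl).deriv
    have hiso : Isometry fun s : ℝ => i x + s • e := Isometry.of_dist_eq fun s t => by
      rw [dist_eq_norm, add_sub_add_left_eq_sub, ← sub_smul, norm_smul, he, mul_one, dist_eq_norm]
    have hgs : HasCompactSupport g := hcs.comp_isClosedEmbedding hiso.isClosedEmbedding
    by_cases h : ∃ m ∈ S, frameProj i m = x
    · obtain ⟨m, hmS, rfl⟩ := h
      rw [hψ1 m hmS]
      have hmdec := hdec m
      have hmb : i (frameProj i m) + ⟪e, m⟫ • e ∈ Metric.ball p r := hmdec.symm ▸ hmS.2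
      -- Inside the ball the line is in Ω exactly before it reaches m. Outside the ball Ω is not
      -- controlled, but there the derivative of φ vanishes.
      have hfun : (fun s : ℝ => Ω.indicator (fun x => fderiv ℝ φ x e) (i (frameProj i m) + s • e))
          = (Iio ⟪e, m⟫).indicator (deriv g) := by
        ext1 s
        by_cases hs : i (frameProj i m) + s • e ∈ Metric.ball p r
        · have hiff : i (frameProj i m) + s • e ∈ Ω ↔ s < ⟪e, m⟫ := by
            rw [hm _ hs]
            constructor
            · intro hneg
              by_contra hge
              rcases (not_lt.mp hge).eq_or_lt with h | h
              · rw [← h, hmdec, hS0 m hmS] at hneg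
                exact lt_irrefl _ hneg
              · have := hlt _ _ _ hmb hs h
                rw [hmdec, hS0 m hmS] at this
                exact lt_asymm this hneg
            · intro h
              have := hlt _ _ _ hs hmb h
              rwa [hmdec, hS0 m hmS] at this
          by_cases hsm : s < ⟪e, m⟫
          · rw [indicator_of_mem (hiff.mpr hsm), indicator_of_mem (mem_Iio.mpr hsm), hgd]
          · rw [indicator_of_notMem (fun h => hsm (hiff.mp h)),
              indicator_of_notMem (fun h => hsm (mem_Iio.mp h))]
        · have : fderiv ℝ φ (i (frameProj i m) + s • e) e = 0 := by rw [hφ'0 _ hs]; rfl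
          simp only [indicator, hgd, this, ite_self]
      rw [hfun, integral_indicator measurableSet_Iio, ← integral_Iic_eq_integral_Iio,
        hgs.integral_Iic_deriv_eq hgC, hgdef]
      simp only
      rw [hmdec]
    · have hz : ψ x = 0 := dif_neg h
      rw [hz]
      -- On a line that misses S, ρ has no zero on the interval inside the ball, hence a constant
      -- sign: the indicator either keeps all of the derivative of a compactly supported function,
      -- whose integral is zero, or kills it.
      have hJ : IsPreconnected {s : ℝ | i x + s • e ∈ Metric.ball p r} :=
        (convex_setOf_line_mem_ball (i x) e p r).isPreconnected
      have hne : ∀ s : ℝ, i x + s • e ∈ Metric.ball p r → ρ (i x + s • e) ≠ 0 := by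
        intro s hs h0
        refine h ⟨_, ⟨mem_frontier_of_eq_zero hC hm hpos hs h0, hs⟩, ?_⟩
        rw [map_add, map_smul, frameProj_isometry, frameProj_self hi, smul_zero, add_zero]
      have hcont : ContinuousOn (fun s : ℝ => ρ (i x + s • e))
          {s : ℝ | i x + s • e ∈ Metric.ball p r} :=
        hC.continuousOn.comp (by fun_prop) fun s hs => hs
      have hg0 : ∫ s, deriv g s = 0 :=
        integral_eq_zero_of_hasDerivAt_of_integrable
          (fun s => (hgC.differentiable one_ne_zero s).hasDerivAt)
          ((hgC.continuous_deriv le_rfl).integrable_of_hasCompactSupport hgs.deriv)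
          (hgC.continuous.integrable_of_hasCompactSupport hgs)
      by_cases hneg : ∃ s : ℝ, i x + s • e ∈ Metric.ball p r ∧ ρ (i x + s • e) < 0
      · obtain ⟨s₁, hs₁, hn₁⟩ := hneg
        have hall : ∀ s : ℝ, i x + s • e ∈ Metric.ball p r → i x + s • e ∈ Ω := by
          intro s hs
          rw [hm _ hs]
          by_contra hge
          obtain ⟨t, ht, ht0⟩ := hJ.intermediate_value hs₁ hs hcont
            (show (0 : ℝ) ∈ Icc _ _ from ⟨hn₁.le, not_lt.mp hge⟩)
          exact hne t ht ht0
        rw [← hg0]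
        refine integral_congr_ae (ae_of_all _ fun s => ?_)
        simp only
        by_cases hs : i x + s • e ∈ Metric.ball p r
        · rw [indicator_of_mem (hall s hs), hgd]
        · have : fderiv ℝ φ (i x + s • e) e = 0 := by rw [hφ'0 _ hs]; rfl
          simp only [indicator, hgd, this, ite_self]
      · push Not at hneg
        refine integral_eq_zero_of_ae (ae_of_all _ fun s => ?_)
        by_cases hs : i x + s • e ∈ Metric.ball p r
        · exact indicator_of_notMem (fun h => not_lt.mpr (hneg s hs) ((hm _ hs).mp h)) _
        · have : fderiv ℝ φ (i x + s • e) e = 0 := by rw [hφ'0 _ hs]; rfl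
          simp only [indicator, this, ite_self, Pi.zero_apply]
  have hmp := measurePreserving_frame hE he hi
  have hint : Integrable (Ω.indicator fun x => fderiv ℝ φ x e) :=
    (hφ'c.integrable_of_hasCompactSupport (hcs.fderiv_apply ℝ e)).indicator hΩ.measurableSet
  calc ∫ x in Ω, fderiv ℝ φ x e = ∫ x, Ω.indicator (fun x => fderiv ℝ φ x e) x :=
        (integral_indicator hΩ.measurableSet).symm
    _ = ∫ q, Ω.indicator (fun x => fderiv ℝ φ x e) (i q.1 + q.2 • e)
          ∂(volume : Measure (EuclideanSpace ℝ (Fin n))).prod (volume : Measure ℝ) := by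
        conv_lhs => rw [← hmp.map_eq]
        rw [integral_map hmp.measurable.aemeasurable]
        rw [hmp.map_eq]
        exact hint.aestronglyMeasurable
    _ = ∫ x, ψ x := by
        rw [integral_prod]
        · exact integral_congr_ae (ae_of_all _ hinner)
        · exact hmp.integrable_comp_of_integrable hint
    _ = ∫ m in S, ⟪outwardNormal Ω m, e⟫ • φ m ∂μHE[n] := by
        refine integral_frameProj_eq hE he hi hSm hinj ?_ ?_ ?_ ?_ hψ1 hψ0
        · refine ContinuousOn.congr (f := fun q => ‖gradient ρ q‖⁻¹ • gradient ρ q) ?_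
            fun q hq => outwardNormal_eq hΩ hq.1 (hdef q hq.2)
          have hg' := hg.mono (inter_subset_right (s := frontier Ω))
          exact (hg'.norm.inv₀ fun q hq =>
            norm_ne_zero_iff.mpr (hdef q hq.2).gradient_ne_zero).smul hg'
        · exact fun q hq => (hdef q hq.2).norm_outwardNormal hΩ hq.1
        · intro q hq
          rw [outwardNormal_eq hΩ hq.1 (hdef q hq.2), real_inner_smul_left]
          have := norm_pos_iff.mpr (hdef q hq.2).gradient_ne_zero
          have := hpos q hq.2
          positivity
        · intro q hq η hη
          obtain ⟨W, hW, h⟩ := (hdef q hq.2).flat hΩ hq.1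
            (by filter_upwards [Metric.isOpen_ball.mem_nhds hq.2] with x hx using hdef x hx) hη
          exact ⟨W, hW, fun a ha b hb => h a ⟨ha.1.1, ha.2⟩ b ⟨hb.1.1, hb.2⟩⟩
    _ = ∫ m in frontier Ω, ⟪outwardNormal Ω m, e⟫ • φ m ∂μHE[n] := by
        refine (setIntegral_eq_of_subset_of_forall_sdiff_eq_zero
          isClosed_frontier.measurableSet inter_subset_left fun q hq => ?_).symm
        rw [hφ0 q fun h => hq.2 ⟨hq.1, h⟩, smul_zero]

end LocalDivergence

/-! ### The global divergence theorem. -/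

section Divergence

variable {d n : ℕ} {Ω : Set (EuclideanSpace ℝ (Fin d))}
  {F : Type*} [NormedAddCommGroup F]

theorem IsBoundedC1Domain.integrableOn_frontier (hd : d = n + 1) (hΩ : IsBoundedC1Domain Ω)
    {f : EuclideanSpace ℝ (Fin d) → F} (hf : ContinuousOn f (frontier Ω)) :
    IntegrableOn f (frontier Ω) μHE[n] := by
  obtain ⟨C, hC⟩ := hΩ.isCompact_frontier.exists_bound_of_continuousOn hf
  have : IsFiniteMeasure ((μHE[n] : Measure (EuclideanSpace ℝ (Fin d))).restrict (frontier Ω)) :=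
    isFiniteMeasure_restrict.mpr (hΩ.measure_frontier_lt_top hd).ne
  exact Integrable.of_bound (hf.aestronglyMeasurable isClosed_frontier.measurableSet) C
    (ae_restrict_of_forall_mem isClosed_frontier.measurableSet hC)

theorem IsBoundedC1Domain.integrableOn_of_continuous (hΩ : IsBoundedC1Domain Ω)
    {f : EuclideanSpace ℝ (Fin d) → F} (hf : Continuous f) : IntegrableOn f Ω :=
  (hf.continuousOn.integrableOn_compact hΩ.isBounded.isCompact_closure).mono_set subset_closure

variable [NormedSpace ℝ F]

theorem IsBoundedC1Domain.integrableOn_inner_smul (hd : d = n + 1) (hΩ : IsBoundedC1Domain Ω)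
    {f : EuclideanSpace ℝ (Fin d) → F} (hf : Continuous f) (w : EuclideanSpace ℝ (Fin d)) :
    IntegrableOn (fun m => ⟪outwardNormal Ω m, w⟫ • f m) (frontier Ω) μHE[n] :=
  hΩ.integrableOn_frontier hd
    ((hΩ.continuousOn_outwardNormal.inner continuousOn_const).smul hf.continuousOn)

/-- Integration by parts against the constant function 1. -/
theorem integral_fderiv_eq_zero_of_hasCompactSupport {φ : EuclideanSpace ℝ (Fin d) → F}
    (hφ : ContDiff ℝ 1 φ) (hs : HasCompactSupport φ) (w : EuclideanSpace ℝ (Fin d)) :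
    ∫ x, fderiv ℝ φ x w = 0 := by
  have h := integral_smul_fderiv_eq_neg_fderiv_smul_of_integrable (𝕜 := ℝ)
    (μ := (volume : Measure (EuclideanSpace ℝ (Fin d)))) (f := fun _ => (1 : ℝ)) (g := φ) (v := w)
    (by simp) (by
      simp only [one_smul]
      exact ((hφ.continuous_fderiv one_ne_zero).clm_apply
        continuous_const).integrable_of_hasCompactSupport (hs.fderiv_apply ℝ w))
    (by simpa using hφ.continuous.integrable_of_hasCompactSupport hs)
    (fun x _ => differentiableAt_const _) (fun x _ => hφ.differentiable one_ne_zero x)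
  simpa using h

variable [CompleteSpace F]

/-- The local formula is known for directions having positive product with the gradient g of ρ at p.
Both sides are linear in the direction, and w = (w + K g) - K g with both terms of this kind for
large K. -/
theorem IsBoundedC1Domain.exists_ball_integral_fderiv (hd : d = n + 1) (hΩ : IsBoundedC1Domain Ω)
    {p : EuclideanSpace ℝ (Fin d)} (hp : p ∈ frontier Ω) (w : EuclideanSpace ℝ (Fin d)) :
    ∃ r > 0, ∀ φ : EuclideanSpace ℝ (Fin d) → F, ContDiff ℝ 1 φ → tsupport φ ⊆ Metric.ball p r →
      ∫ x in Ω, fderiv ℝ φ x w =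
        ∫ m in frontier Ω, ⟪outwardNormal Ω m, w⟫ • φ m ∂μHE[n] := by
  obtain ⟨ρ, hρ⟩ := hΩ.exists_defining p hp
  have step : ∀ e, 0 < ⟪gradient ρ p, e⟫ →
      ∃ r > 0, ∀ φ : EuclideanSpace ℝ (Fin d) → F, ContDiff ℝ 1 φ →
        tsupport φ ⊆ Metric.ball p r → ∫ x in Ω, fderiv ℝ φ x e =
          ∫ m in frontier Ω, ⟪outwardNormal Ω m, e⟫ • φ m ∂μHE[n] := by
    intro e he
    have he0 : e ≠ 0 := by rintro rfl; simp at he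
    have hen : 0 < ‖e‖ := norm_pos_iff.mpr he0
    have he1 : ‖‖e‖⁻¹ • e‖ = 1 := by
      rw [norm_smul, norm_inv, norm_norm, inv_mul_cancel₀ hen.ne']
    have hpos : 0 < ⟪gradient ρ p, ‖e‖⁻¹ • e⟫ := by
      rw [real_inner_smul_right]; positivity
    obtain ⟨r, hr, hC, hg, hm, hpos⟩ := hρ.exists_ball hpos
    refine ⟨r, hr, fun φ hφ hs => ?_⟩
    have h := integral_fderiv_of_tsupport_subset_ball hd hΩ.isOpen he1 hC hg hm hpos hφ hs
    simp only [map_smul, real_inner_smul_right, ← smul_smul] at h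
    rw [integral_smul, integral_smul] at h
    exact smul_right_injective F (inv_ne_zero hen.ne') h
  set g := gradient ρ p with hg
  have hgg : 0 < ⟪g, g⟫ := real_inner_self_pos.mpr hρ.gradient_ne_zero
  -- This K makes the product equal to 1.
  obtain ⟨K, hK⟩ : ∃ K : ℝ, 0 < ⟪g, w⟫ + K * ⟪g, g⟫ :=
    ⟨(1 - ⟪g, w⟫) / ⟪g, g⟫, by rw [div_mul_cancel₀ _ hgg.ne']; linarith⟩
  obtain ⟨r₁, hr₁, h₁⟩ := step g hgg
  obtain ⟨r₂, hr₂, h₂⟩ := step (w + K • g) (by rwa [inner_add_right, real_inner_smul_right])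
  refine ⟨min r₁ r₂, lt_min hr₁ hr₂, fun φ hφ hs => ?_⟩
  have e₁ := h₁ φ hφ (hs.trans (Metric.ball_subset_ball (min_le_left _ _)))
  have e₂ := h₂ φ hφ (hs.trans (Metric.ball_subset_ball (min_le_right _ _)))
  have hc := hφ.continuous_fderiv one_ne_zero
  simp only [map_add, map_smul, inner_add_right, real_inner_smul_right, add_smul,
    ← smul_smul] at e₂
  have i₁ : ∀ v, IntegrableOn (fun x => fderiv ℝ φ x v) Ω := fun v =>
    hΩ.integrableOn_of_continuous (hc.clm_apply continuous_const)
  have i₂ : IntegrableOn (fun x => K • fderiv ℝ φ x g) Ω := (i₁ g).smul K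
  have i₃ := hΩ.integrableOn_inner_smul hd hφ.continuous
  have i₄ : IntegrableOn (fun m => K • ⟪outwardNormal Ω m, g⟫ • φ m) (frontier Ω) μHE[n] :=
    (i₃ g).smul K
  rw [integral_add (i₁ w) i₂, integral_add (i₃ w) i₄, integral_smul, integral_smul, e₁] at e₂
  exact add_right_cancel e₂

open scoped Manifold ContDiff in
/-- The **divergence theorem** on bounded `C¹` domains, for one partial derivative. -/
theorem IsBoundedC1Domain.integral_fderiv (hd : d = n + 1) (hΩ : IsBoundedC1Domain Ω)
    {φ : EuclideanSpace ℝ (Fin d) → F} (hφ : ContDiff ℝ 1 φ) (w : EuclideanSpace ℝ (Fin d)) :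
    ∫ x in Ω, fderiv ℝ φ x w =
      ∫ m in frontier Ω, ⟪outwardNormal Ω m, w⟫ • φ m ∂μHE[n] := by
  choose! r hr hloc using fun p (hp : p ∈ frontier Ω) =>
    hΩ.exists_ball_integral_fderiv (F := F) hd hp w
  obtain ⟨t, htΩ, hcov⟩ := hΩ.isCompact_frontier.elim_nhds_subcover
    (fun p => Metric.ball p (r p)) fun p hp => Metric.ball_mem_nhds p (hr p hp)
  -- The index `none` stands for Ω itself: the corresponding piece of φ has compact support in Ω, so
  -- both of its integrals vanish. The other indices are the boundary balls.
  set U : Option t → Set (EuclideanSpace ℝ (Fin d)) := fun o =>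
    o.elim Ω fun p => Metric.ball (p : EuclideanSpace ℝ (Fin d)) (r p) with hU
  have hUo : ∀ o, IsOpen (U o) := by
    rintro (_ | p)
    · exact hΩ.isOpen
    · exact Metric.isOpen_ball
  have hUb : ∀ o, Bornology.IsBounded (U o) := by
    rintro (_ | p)
    · exact hΩ.isBounded
    · exact Metric.isBounded_ball
  have hUcov : closure Ω ⊆ ⋃ o, U o := by
    intro x hx
    by_cases hxΩ : x ∈ Ω
    · exact mem_iUnion.mpr ⟨none, hxΩ⟩
    · have hxf : x ∈ frontier Ω := hΩ.isOpen.frontier_eq ▸ ⟨hx, hxΩ⟩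
      obtain ⟨p, hp, hxp⟩ := mem_iUnion₂.mp (hcov hxf)
      exact mem_iUnion.mpr ⟨some ⟨p, hp⟩, hxp⟩
  obtain ⟨f, hf⟩ := SmoothPartitionOfUnity.exists_isSubordinate
    𝓘(ℝ, EuclideanSpace ℝ (Fin d)) isClosed_closure U hUo hUcov
  have hfs : ∀ o, ContDiff ℝ 1 (f o) := fun o => (f o).contMDiff.contDiff.of_le (by simp)
  set ψ : Option t → EuclideanSpace ℝ (Fin d) → F := fun o x => f o x • φ x with hψ
  have hψC : ∀ o, ContDiff ℝ 1 (ψ o) := fun o => (hfs o).smul hφ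
  have hψs : ∀ o, tsupport (ψ o) ⊆ U o := fun o =>
    (closure_mono (Function.support_smul_subset_left (f o) φ)).trans (hf o)
  have hψc : ∀ o, HasCompactSupport (ψ o) := fun o =>
    Metric.isCompact_of_isClosed_isBounded (isClosed_tsupport _) ((hUb o).subset (hψs o))
  have hsum : ∀ x ∈ closure Ω, φ x = ∑ o, ψ o x := by
    intro x hx
    have h1 := f.sum_eq_one hx
    rw [finsum_eq_sum_of_fintype] at h1
    rw [hψ, ← Finset.sum_smul, h1, one_smul]
  have hfd : ∀ x ∈ Ω, fderiv ℝ φ x w = ∑ o, fderiv ℝ (ψ o) x w := by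
    intro x hx
    have hev : φ =ᶠ[𝓝 x] fun x => ∑ o, ψ o x := by
      filter_upwards [hΩ.isOpen.mem_nhds hx] with y hy using hsum y (subset_closure hy)
    rw [hev.fderiv_eq, fderiv_fun_sum fun o _ => (hψC o).differentiable one_ne_zero x,
      sum_apply]
  have hpart : ∀ o, ∫ x in Ω, fderiv ℝ (ψ o) x w =
      ∫ m in frontier Ω, ⟪outwardNormal Ω m, w⟫ • ψ o m ∂μHE[n] := by
    rintro (_ | p)
    · have h0 : ∀ x ∉ Ω, ψ none x = 0 := fun x hx =>
        image_eq_zero_of_notMem_tsupport fun h => hx (hψs none h)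
      have h0' : ∀ x ∉ Ω, fderiv ℝ (ψ none) x w = 0 := fun x hx => by
        rw [image_eq_zero_of_notMem_tsupport fun h =>
          hx (hψs none (tsupport_fderiv_subset ℝ h))]
        rfl
      rw [setIntegral_eq_integral_of_forall_compl_eq_zero h0',
        integral_fderiv_eq_zero_of_hasCompactSupport (hψC none) (hψc none),
        setIntegral_eq_zero_of_forall_eq_zero]
      intro m hm
      rw [h0 m fun h => (hΩ.isOpen.frontier_eq ▸ hm).2 h, smul_zero]
    · exact hloc p (htΩ p p.2) _ (hψC _) (hψs (some p))
  calc ∫ x in Ω, fderiv ℝ φ x w = ∫ x in Ω, ∑ o, fderiv ℝ (ψ o) x w :=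
        setIntegral_congr_fun hΩ.isOpen.measurableSet hfd
    _ = ∑ o, ∫ x in Ω, fderiv ℝ (ψ o) x w := integral_finsetSum _ fun o _ =>
        hΩ.integrableOn_of_continuous
          (((hψC o).continuous_fderiv one_ne_zero).clm_apply continuous_const)
    _ = ∑ o, ∫ m in frontier Ω, ⟪outwardNormal Ω m, w⟫ • ψ o m ∂μHE[n] :=
        Finset.sum_congr rfl fun o _ => hpart o
    _ = ∫ m in frontier Ω, ∑ o, ⟪outwardNormal Ω m, w⟫ • ψ o m ∂μHE[n] :=
        (integral_finsetSum _ fun o _ =>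
          hΩ.integrableOn_inner_smul hd (hψC o).continuous w).symm
    _ = ∫ m in frontier Ω, ⟪outwardNormal Ω m, w⟫ • φ m ∂μHE[n] := by
        refine setIntegral_congr_fun isClosed_frontier.measurableSet fun m hm => ?_
        rw [← Finset.smul_sum, ← hsum m (frontier_subset_closure hm)]

end Divergence

/-! ### Everywhere convergent real power series and their derivatives. -/

section PowerSeries

/-- The coefficients of an everywhere convergent power series. -/
def IsEntireCoeff (a : ℕ → ℝ) : Prop := ∀ R : ℝ, 0 ≤ R → Summable fun m => |a m| * R ^ m

/-- The sum of a real power series. -/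
noncomputable def powerSum (a : ℕ → ℝ) (t : ℝ) : ℝ := ∑' m, a m * t ^ m

/-- The coefficients of the derivative of a power series. -/
def derivCoeff (a : ℕ → ℝ) (m : ℕ) : ℝ := (m + 1) * a (m + 1)

variable {a : ℕ → ℝ}

theorem IsEntireCoeff.of_bound {C : ℝ} (h : ∀ m, |a m| ≤ C ^ m / m.factorial) :
    IsEntireCoeff a := by
  intro R hR
  refine Summable.of_nonneg_of_le (fun m => by positivity) (fun m => ?_)
    (Real.summable_pow_div_factorial (C * R))
  calc |a m| * R ^ m ≤ C ^ m / m.factorial * R ^ m := by gcongr; exact h m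
    _ = (C * R) ^ m / m.factorial := by rw [mul_pow]; ring

theorem IsEntireCoeff.hasSum (h : IsEntireCoeff a) (t : ℝ) :
    HasSum (fun m => a m * t ^ m) (powerSum a t) := by
  refine Summable.hasSum (Summable.of_norm ?_)
  simpa [abs_mul, abs_pow] using h |t| (abs_nonneg t)

theorem IsEntireCoeff.derivCoeff (h : IsEntireCoeff a) : IsEntireCoeff (derivCoeff a) := by
  intro R hR
  -- Convergence at radius 2(R + 1) absorbs the factor m + 1 ≤ 2^(m+1); using R + 1 instead of R
  -- makes the shift of the exponent by one harmless also for R < 1.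
  have h1 := (summable_nat_add_iff 1).mpr (h (2 * (R + 1)) (by positivity))
  refine Summable.of_nonneg_of_le (fun m => by positivity) (fun m => ?_) h1
  have e1 : ((m : ℝ) + 1) ≤ 2 ^ (m + 1) := by exact_mod_cast (Nat.lt_two_pow_self (n := m + 1)).le
  have e2 : R ^ m ≤ (R + 1) ^ (m + 1) :=
    calc R ^ m ≤ (R + 1) ^ m := by gcongr; linarith
      _ ≤ (R + 1) ^ (m + 1) := pow_le_pow_right₀ (by linarith) (Nat.le_succ m)
  rw [SmallSources.derivCoeff, abs_mul, abs_of_nonneg (by positivity : (0 : ℝ) ≤ (m : ℝ) + 1),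
    mul_pow]
  calc ((m : ℝ) + 1) * |a (m + 1)| * R ^ m = |a (m + 1)| * (((m : ℝ) + 1) * R ^ m) := by ring
    _ ≤ |a (m + 1)| * (2 ^ (m + 1) * (R + 1) ^ (m + 1)) := by gcongr

theorem IsEntireCoeff.hasDerivAt (h : IsEntireCoeff a) (t : ℝ) :
    HasDerivAt (powerSum a) (powerSum (SmallSources.derivCoeff a) t) t := by
  set R := |t| + 1 with hR
  have hR0 : 0 ≤ R := by positivity
  have hu : Summable fun m : ℕ => |a m| * (m * R ^ (m - 1)) := by
    refine (summable_nat_add_iff 1).mp ((h.derivCoeff R hR0).congr fun m => ?_)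
    rw [SmallSources.derivCoeff, abs_mul, abs_of_nonneg (by positivity : (0 : ℝ) ≤ (m : ℝ) + 1)]
    push_cast
    ring
  have key := hasDerivAt_tsum_of_isPreconnected (t := Metric.ball (0 : ℝ) R) (y₀ := t) (y := t)
    (g := fun m y => a m * y ^ m) (g' := fun m y => a m * (m * y ^ (m - 1))) hu
    Metric.isOpen_ball (convex_ball (0 : ℝ) R).isPreconnected
    (fun m y _ => (hasDerivAt_pow m y).const_mul (a m))
    (fun m y hy => by
      rw [norm_mul, norm_mul, norm_pow, Real.norm_natCast, Real.norm_eq_abs (a m)]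
      have : ‖y‖ ≤ R := (mem_ball_zero_iff.mp hy).le
      gcongr)
    (by rw [mem_ball_zero_iff, Real.norm_eq_abs]; linarith) (h.hasSum t).summable
    (by rw [mem_ball_zero_iff, Real.norm_eq_abs]; linarith)
  have hs : HasSum (fun m : ℕ => a m * (m * t ^ (m - 1)))
      (powerSum (SmallSources.derivCoeff a) t) := by
    have h1 := h.derivCoeff.hasSum t
    rw [← hasSum_nat_add_iff' 1]
    simp only [Finset.range_one, Finset.sum_singleton, Nat.cast_zero, zero_mul, mul_zero, sub_zero]
    refine h1.congr_fun fun m => ?_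
    rw [SmallSources.derivCoeff, Nat.add_sub_cancel]
    push_cast
    ring
  rw [← hs.tsum_eq]
  exact key

/-- The series of `t P''(t)`. -/
theorem IsEntireCoeff.hasSum_mul_deriv (h : IsEntireCoeff a) (t : ℝ) :
    HasSum (fun m : ℕ => ((m + 1) * m * a (m + 1)) * t ^ m)
      (t * powerSum (SmallSources.derivCoeff (SmallSources.derivCoeff a)) t) := by
  rw [← hasSum_nat_add_iff' 1]
  simp only [Finset.range_one, Finset.sum_singleton, Nat.cast_zero, zero_mul, mul_zero, sub_zero]
  refine ((h.derivCoeff.derivCoeff.hasSum t).mul_left t).congr_fun fun m => ?_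
  simp only [SmallSources.derivCoeff]
  push_cast
  ring

theorem powerSum_zero (a : ℕ → ℝ) : powerSum a 0 = a 0 := by
  rw [powerSum, tsum_eq_single 0 fun m hm => by rw [zero_pow hm, mul_zero], pow_zero, mul_one]

end PowerSeries

/-! ### Radial solutions as functions of the squared distance. -/

section Profile

/-- `p ↦ h (|p|²)` solves the Helmholtz equation in `ℝᵈ` where `|p|² ∈ s`; `h₁` and `h₂` are the
first two derivatives of `h`. -/
structure IsHelmholtzProfile {F : Type*} [NormedAddCommGroup F] [NormedSpace ℝ F] (d : ℕ) (k : ℝ)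
    (s : Set ℝ) (h h₁ h₂ : ℝ → F) : Prop where
  hasDerivAt : ∀ t ∈ s, HasDerivAt h (h₁ t) t
  hasDerivAt_one : ∀ t ∈ s, HasDerivAt h₁ (h₂ t) t
  continuousOn_two : ContinuousOn h₂ s
  ode : ∀ t ∈ s, (4 * t) • h₂ t + (2 * d : ℝ) • h₁ t + k ^ 2 • h t = 0

/-- The energy estimate for regular radial solutions of the Helmholtz equation. -/
theorem IsHelmholtzProfile.energy_le {d : ℕ} {k : ℝ} {H H₁ H₂ : ℝ → ℝ}
    (h : IsHelmholtzProfile d k univ H H₁ H₂) (hd : 1 ≤ d) {t : ℝ} (ht : 0 ≤ t) :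
    4 * t * H₁ t ^ 2 ≤ k ^ 2 * H 0 ^ 2 := by
  -- With r = √t, this is the energy (dH/dr)² + k² H². The equation gives G' = -4(d - 1) H₁², so the
  -- drag of the first-order term makes it nonincreasing.
  set G : ℝ → ℝ := fun t => 4 * t * H₁ t ^ 2 + k ^ 2 * H t ^ 2 with hG
  have hGd : ∀ t, HasDerivAt G (-4 * (d - 1) * H₁ t ^ 2) t := by
    intro t
    have h0 := h.hasDerivAt t (mem_univ t)
    have h1 := h.hasDerivAt_one t (mem_univ t)
    have hode := h.ode t (mem_univ t)
    simp only [smul_eq_mul] at hode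
    have := (((hasDerivAt_id t).const_mul 4).mul (h1.pow 2)).add ((h0.pow 2).const_mul (k ^ 2))
    refine this.congr_deriv ?_
    simp only [id, Pi.pow_apply, Nat.cast_ofNat, Nat.add_one_sub_one, pow_one, mul_one]
    linear_combination 2 * H₁ t * hode
  have hanti : AntitoneOn G (Ici 0) := by
    refine antitoneOn_of_deriv_nonpos (convex_Ici 0)
      (fun t _ => (hGd t).continuousAt.continuousWithinAt)
      (fun t _ => (hGd t).differentiableAt.differentiableWithinAt) fun t _ => ?_
    rw [(hGd t).deriv]
    have : (1 : ℝ) ≤ d := by exact_mod_cast hd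
    nlinarith [mul_nonneg (sub_nonneg.mpr this) (sq_nonneg (H₁ t))]
  have := hanti (mem_Ici.mpr le_rfl) (mem_Ici.mpr ht) ht
  simp only [hG, mul_zero, zero_mul, zero_add] at this
  nlinarith [mul_nonneg (sq_nonneg k) (sq_nonneg (H t))]

/-- The recursion is the differential equation read off coefficient by coefficient. -/
theorem isHelmholtzProfile_powerSum {d : ℕ} {k : ℝ} {a : ℕ → ℝ} (ha : IsEntireCoeff a)
    (hrec : ∀ m : ℕ, (m + 1) * (4 * m + 2 * d) * a (m + 1) = -k ^ 2 * a m) :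
    IsHelmholtzProfile d k univ (powerSum a) (powerSum (derivCoeff a))
      (powerSum (derivCoeff (derivCoeff a))) where
  hasDerivAt t _ := ha.hasDerivAt t
  hasDerivAt_one t _ := ha.derivCoeff.hasDerivAt t
  continuousOn_two := fun t _ =>
    (ha.derivCoeff.derivCoeff.hasDerivAt t).continuousAt.continuousWithinAt
  ode t _ := by
    have h := (((ha.hasSum_mul_deriv t).mul_left 4).add
      ((ha.derivCoeff.hasSum t).mul_left (2 * d : ℝ))).add ((ha.hasSum t).mul_left (k ^ 2))
    have hz : ∀ m : ℕ, 4 * ((m + 1) * m * a (m + 1) * t ^ m) +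
        2 * d * (derivCoeff a m * t ^ m) + k ^ 2 * (a m * t ^ m) = 0 := by
      intro m
      rw [derivCoeff]
      linear_combination t ^ m * hrec m
    simp only [hz] at h
    simp only [smul_eq_mul]
    rw [mul_assoc]
    exact h.unique hasSum_zero

end Profile

/-! ### Power series of J₀, of the regular part of Y₀, and of sinc. -/

section Bessel

/-- The power series coefficients of `J₀(k √t)`. -/
noncomputable def besselJ0Coeff (k : ℝ) (m : ℕ) : ℝ :=
  (-1) ^ m * (k ^ 2 / 4) ^ m / (m.factorial : ℝ) ^ 2

/-- The power series coefficients of the regular part of `Y₀(k √t)`. -/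
noncomputable def besselY0Coeff (k : ℝ) (m : ℕ) : ℝ :=
  (-1) ^ (m + 1) * (harmonic m : ℝ) * (k ^ 2 / 4) ^ m / (m.factorial : ℝ) ^ 2

/-- The power series coefficients of `sinc (k √t)`. -/
noncomputable def sincCoeff (k : ℝ) (m : ℕ) : ℝ :=
  (-1) ^ m * (k ^ 2) ^ m / ((2 * m + 1).factorial : ℝ)

theorem isEntireCoeff_besselJ0Coeff (k : ℝ) : IsEntireCoeff (besselJ0Coeff k) := by
  refine IsEntireCoeff.of_bound (C := k ^ 2 / 4) fun m => ?_
  rw [besselJ0Coeff, abs_div, abs_mul, abs_pow, abs_neg, abs_one, one_pow, one_mul,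
    abs_of_nonneg (by positivity : (0 : ℝ) ≤ (k ^ 2 / 4) ^ m), abs_of_nonneg (by positivity)]
  have : (1 : ℝ) ≤ m.factorial := by exact_mod_cast m.factorial_pos
  gcongr
  nlinarith

theorem harmonic_le_two_pow (m : ℕ) : (harmonic m : ℝ) ≤ 2 ^ m := by
  induction m with
  | zero => simp
  | succ m ih =>
    rw [harmonic_succ, pow_succ]
    push_cast
    have h1 : ((m : ℝ) + 1)⁻¹ ≤ 1 := inv_le_one_of_one_le₀ (by linarith [m.cast_nonneg (α := ℝ)])
    have h2 : (1 : ℝ) ≤ 2 ^ m := one_le_pow₀ one_le_two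
    linarith

theorem harmonic_cast_nonneg (m : ℕ) : (0 : ℝ) ≤ harmonic m := by
  rw [harmonic]
  push_cast
  positivity

theorem isEntireCoeff_besselY0Coeff (k : ℝ) : IsEntireCoeff (besselY0Coeff k) := by
  refine IsEntireCoeff.of_bound (C := 2 * (k ^ 2 / 4)) fun m => ?_
  rw [besselY0Coeff, abs_div, abs_mul, abs_mul, abs_pow, abs_neg, abs_one, one_pow, one_mul,
    abs_of_nonneg (by positivity : (0 : ℝ) ≤ (k ^ 2 / 4) ^ m),
    abs_of_nonneg (harmonic_cast_nonneg m), abs_of_nonneg (by positivity), mul_pow]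
  have : (1 : ℝ) ≤ m.factorial := by exact_mod_cast m.factorial_pos
  gcongr
  · exact harmonic_le_two_pow m
  · nlinarith

theorem isEntireCoeff_sincCoeff (k : ℝ) : IsEntireCoeff (sincCoeff k) := by
  refine IsEntireCoeff.of_bound (C := k ^ 2) fun m => ?_
  rw [sincCoeff, abs_div, abs_mul, abs_pow, abs_neg, abs_one, one_pow, one_mul,
    abs_of_nonneg (by positivity : (0 : ℝ) ≤ (k ^ 2) ^ m), abs_of_nonneg (by positivity)]
  have : m.factorial ≤ (2 * m + 1).factorial := Nat.factorial_le (by omega)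
  gcongr

theorem besselJ0Coeff_succ (k : ℝ) (m : ℕ) :
    ((m : ℝ) + 1) ^ 2 * besselJ0Coeff k (m + 1) = -(k ^ 2 / 4) * besselJ0Coeff k m := by
  rw [besselJ0Coeff, besselJ0Coeff, Nat.factorial_succ]
  push_cast
  have : (m.factorial : ℝ) ≠ 0 := by positivity
  field_simp
  ring

theorem besselY0Coeff_eq (k : ℝ) (m : ℕ) :
    besselY0Coeff k m = -(harmonic m : ℝ) * besselJ0Coeff k m := by
  rw [besselY0Coeff, besselJ0Coeff, pow_succ]
  ring

/-- For d = 2, inserting (log t / 2) A + S into the radial equation, with A a solution, leaves the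
cross term 4 A'. The regular part S must cancel it, and this recursion with harmonic numbers says
that it does. -/
theorem besselY0Coeff_succ (k : ℝ) (m : ℕ) :
    4 * ((m : ℝ) + 1) ^ 2 * besselY0Coeff k (m + 1) + k ^ 2 * besselY0Coeff k m +
      4 * ((m + 1) * besselJ0Coeff k (m + 1)) = 0 := by
  have h := besselJ0Coeff_succ k m
  rw [besselY0Coeff_eq, besselY0Coeff_eq, harmonic_succ]
  push_cast
  have hm : (m : ℝ) + 1 ≠ 0 := by positivity
  have h2 : ((m : ℝ) + 1) * besselJ0Coeff k (m + 1) =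
      ((m : ℝ) + 1) ^ 2 * besselJ0Coeff k (m + 1) * ((m : ℝ) + 1)⁻¹ := by
    field_simp
  rw [h2]
  linear_combination (-4 * (harmonic m : ℝ)) * h

theorem sincCoeff_succ (k : ℝ) (m : ℕ) :
    ((m : ℝ) + 1) * (4 * m + 6) * sincCoeff k (m + 1) = -k ^ 2 * sincCoeff k m := by
  rw [sincCoeff, sincCoeff, show 2 * (m + 1) + 1 = (2 * m + 1) + 1 + 1 by ring,
    Nat.factorial_succ, Nat.factorial_succ]
  push_cast
  have : ((2 * m + 1).factorial : ℝ) ≠ 0 := by positivity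
  field_simp
  ring

theorem besselJ0_eq_powerSum (k r : ℝ) : besselJ0 (k * r) = powerSum (besselJ0Coeff k) (r ^ 2) := by
  rw [besselJ0, powerSum]
  refine tsum_congr fun m => ?_
  rw [besselJ0Coeff, show (k * r) ^ 2 / 4 = k ^ 2 / 4 * r ^ 2 by ring, mul_pow]
  ring

theorem besselY0_eq_powerSum (k r : ℝ) :
    besselY0 (k * r) = 2 / Real.pi * (Real.log (k * r / 2) + Real.eulerMascheroniConstant) *
      powerSum (besselJ0Coeff k) (r ^ 2) + 2 / Real.pi * powerSum (besselY0Coeff k) (r ^ 2) := by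
  rw [besselY0, besselJ0_eq_powerSum]
  congr 2
  rw [powerSum]
  refine tsum_congr fun m => ?_
  rw [besselY0Coeff, show (k * r) ^ 2 / 4 = k ^ 2 / 4 * r ^ 2 by ring, mul_pow]
  ring

theorem sinc_eq_powerSum (k r : ℝ) : Real.sinc (k * r) = powerSum (sincCoeff k) (r ^ 2) := by
  by_cases h : k * r = 0
  · rw [h, Real.sinc_zero]
    rcases mul_eq_zero.mp h with rfl | rfl
    · rw [powerSum, tsum_eq_single 0]
      · simp [sincCoeff]
      · intro m hm
        rw [sincCoeff, zero_pow two_ne_zero, zero_pow hm]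
        simp
    · rw [zero_pow two_ne_zero, powerSum_zero]
      simp [sincCoeff]
  · rw [Real.sinc_of_ne_zero h, powerSum]
    have h1 := (Real.hasSum_sin (k * r)).div_const (k * r)
    rw [← h1.tsum_eq]
    refine tsum_congr fun m => ?_
    have hk : k ≠ 0 := left_ne_zero_of_mul h
    have hr : r ≠ 0 := right_ne_zero_of_mul h
    rw [sincCoeff, pow_succ, show (k * r) ^ (2 * m) = (k ^ 2) ^ m * (r ^ 2) ^ m by
      rw [pow_mul, mul_pow, mul_pow]]
    field_simp

/-- The imaginary part of the Green function is a regular radial solution of the Helmholtz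
equation. -/
theorem exists_profile_imGreen {d : ℕ} (hd : d = 2 ∨ d = 3) (k : ℝ) :
    ∃ H H₁ H₂ : ℝ → ℝ, IsHelmholtzProfile d k univ H H₁ H₂ ∧
      ∀ x z, imGreen d k x z = H (‖x - z‖ ^ 2) := by
  have smul : ∀ (c : ℝ) {H H₁ H₂ : ℝ → ℝ}, IsHelmholtzProfile d k univ H H₁ H₂ →
      IsHelmholtzProfile d k univ (fun t => c * H t) (fun t => c * H₁ t) (fun t => c * H₂ t) :=
    fun c H H₁ H₂ h =>
    { hasDerivAt := fun t ht => (h.hasDerivAt t ht).const_mul c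
      hasDerivAt_one := fun t ht => (h.hasDerivAt_one t ht).const_mul c
      continuousOn_two := continuousOn_const.mul h.continuousOn_two
      ode := fun t ht => by
        have := h.ode t ht
        simp only [smul_eq_mul] at this ⊢
        linear_combination c * this }
  rcases hd with rfl | rfl
  · refine ⟨_, _, _, smul (1 / 4) (isHelmholtzProfile_powerSum (isEntireCoeff_besselJ0Coeff k)
      fun m => ?_), fun x z => ?_⟩
    · push_cast
      linear_combination 4 * besselJ0Coeff_succ k m
    · rw [imGreen, if_pos rfl, besselJ0_eq_powerSum]
  · refine ⟨_, _, _, smul (k / (4 * Real.pi)) (isHelmholtzProfile_powerSum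
      (isEntireCoeff_sincCoeff k) fun m => ?_), fun x z => ?_⟩
    · push_cast
      linear_combination sincCoeff_succ k m
    · rw [imGreen, if_neg (by norm_num), sinc_eq_powerSum]

end Bessel

/-! ### Radial profiles of the Green function and their singularity at the origin. -/

section Green

/-- In the variable t = |x - y|², Y₀ is (2/π)((log t / 2 + κ) A + S) with entire A and S, so the
equation reduces to those for A and S. After multiplication by t², only the second derivative of the
logarithm survives in the limit. -/
theorem exists_profile_green_two {k : ℝ} (hk : 0 < k) :
    ∃ h h₁ h₂ : ℝ → ℂ, IsHelmholtzProfile 2 k (Ioi 0) h h₁ h₂ ∧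
      (∀ x y, x ≠ y → green 2 k x y = h (‖x - y‖ ^ 2)) ∧
      Tendsto (fun t => √t ^ 4 • h₂ t) (𝓝[>] 0) (𝓝 ((1 / (4 * Real.pi) : ℝ) : ℂ)) := by
  set A := powerSum (besselJ0Coeff k) with hA
  set A₁ := powerSum (derivCoeff (besselJ0Coeff k)) with hA₁
  set A₂ := powerSum (derivCoeff (derivCoeff (besselJ0Coeff k))) with hA₂
  set S := powerSum (besselY0Coeff k) with hS
  set S₁ := powerSum (derivCoeff (besselY0Coeff k)) with hS₁
  set S₂ := powerSum (derivCoeff (derivCoeff (besselY0Coeff k))) with hS₂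
  have eA := isEntireCoeff_besselJ0Coeff k
  have eS := isEntireCoeff_besselY0Coeff k
  have dA : ∀ t, HasDerivAt A (A₁ t) t := eA.hasDerivAt
  have dA₁ : ∀ t, HasDerivAt A₁ (A₂ t) t := eA.derivCoeff.hasDerivAt
  have cA₂ : Continuous A₂ := continuous_iff_continuousAt.mpr fun t =>
    (eA.derivCoeff.derivCoeff.hasDerivAt t).continuousAt
  have dS : ∀ t, HasDerivAt S (S₁ t) t := eS.hasDerivAt
  have dS₁ : ∀ t, HasDerivAt S₁ (S₂ t) t := eS.derivCoeff.hasDerivAt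
  have cS₂ : Continuous S₂ := continuous_iff_continuousAt.mpr fun t =>
    (eS.derivCoeff.derivCoeff.hasDerivAt t).continuousAt
  have cA : Continuous A := continuous_iff_continuousAt.mpr fun t => (dA t).continuousAt
  have cA₁ : Continuous A₁ := continuous_iff_continuousAt.mpr fun t => (dA₁ t).continuousAt
  have oA : ∀ t, 4 * t * A₂ t + 4 * A₁ t + k ^ 2 * A t = 0 := by
    intro t
    have h := (isHelmholtzProfile_powerSum (d := 2) eA fun m => by
      push_cast
      linear_combination 4 * besselJ0Coeff_succ k m).ode t (mem_univ t)
    simp only [smul_eq_mul] at h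
    push_cast at h
    linear_combination h
  have oS : ∀ t, 4 * t * S₂ t + 4 * S₁ t + k ^ 2 * S t + 4 * A₁ t = 0 := by
    intro t
    have h := ((((eS.hasSum_mul_deriv t).mul_left 4).add
      ((eS.derivCoeff.hasSum t).mul_left 4)).add ((eS.hasSum t).mul_left (k ^ 2))).add
      ((eA.derivCoeff.hasSum t).mul_left 4)
    have hz : ∀ m : ℕ, 4 * ((m + 1) * m * besselY0Coeff k (m + 1) * t ^ m) +
        4 * (derivCoeff (besselY0Coeff k) m * t ^ m) + k ^ 2 * (besselY0Coeff k m * t ^ m) +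
        4 * (derivCoeff (besselJ0Coeff k) m * t ^ m) = 0 := by
      intro m
      rw [derivCoeff, derivCoeff]
      linear_combination t ^ m * besselY0Coeff_succ k m
    simp only [hz] at h
    have := h.unique hasSum_zero
    linear_combination this
  -- κ collects the constants in log(k√t / 2) + γ = log t / 2 + κ.
  set κ := Real.log (k / 2) + Real.eulerMascheroniConstant with hκ
  have hπ : Real.pi ≠ 0 := Real.pi_ne_zero
  set Y : ℝ → ℝ := fun t => 2 / Real.pi * ((Real.log t / 2 + κ) * A t + S t) with hY
  set Y₁ : ℝ → ℝ := fun t =>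
    2 / Real.pi * (t⁻¹ / 2 * A t + (Real.log t / 2 + κ) * A₁ t + S₁ t) with hY₁
  set Y₂ : ℝ → ℝ := fun t => 2 / Real.pi * (-(t ^ 2)⁻¹ / 2 * A t + t⁻¹ * A₁ t +
    (Real.log t / 2 + κ) * A₂ t + S₂ t) with hY₂
  have dlog : ∀ t : ℝ, 0 < t → HasDerivAt (fun t => Real.log t / 2 + κ) (t⁻¹ / 2) t :=
    fun t ht => ((Real.hasDerivAt_log ht.ne').div_const 2).add_const κ
  have dY : ∀ t, 0 < t → HasDerivAt Y (Y₁ t) t := by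
    intro t ht
    exact (((dlog t ht).mul (dA t)).add (dS t)).const_mul (2 / Real.pi)
  have dY₁ : ∀ t, 0 < t → HasDerivAt Y₁ (Y₂ t) t := by
    intro t ht
    refine ((((((hasDerivAt_inv ht.ne').div_const 2).mul (dA t)).add
      ((dlog t ht).mul (dA₁ t))).add (dS₁ t)).const_mul (2 / Real.pi)).congr_deriv ?_
    simp only [hY₂]
    ring
  have oY : ∀ t, 0 < t → 4 * t * Y₂ t + 4 * Y₁ t + k ^ 2 * Y t = 0 := by
    intro t ht
    simp only [hY, hY₁, hY₂]
    have h1 := oA t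
    have h2 := oS t
    field_simp
    linear_combination (t * (Real.log t + 2 * κ)) * h1 + 2 * t * h2
  have cY₂ : ContinuousOn Y₂ (Ioi 0) := by
    have cl : ContinuousOn Real.log (Ioi 0) := Real.continuousOn_log.mono fun t ht => ne_of_gt ht
    have ci : ContinuousOn (fun t : ℝ => t⁻¹) (Ioi 0) :=
      continuousOn_inv₀.mono fun t ht => ne_of_gt ht
    have ci2 : ContinuousOn (fun t : ℝ => (t ^ 2)⁻¹) (Ioi 0) :=
      (continuousOn_pow 2).inv₀ fun t ht => pow_ne_zero 2 (ne_of_gt ht)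
    exact continuousOn_const.mul (((((ci2.neg.div_const 2).mul cA.continuousOn).add
      (ci.mul cA₁.continuousOn)).add (((cl.div_const 2).add continuousOn_const).mul
        cA₂.continuousOn)).add cS₂.continuousOn)
  refine ⟨fun t => Complex.I / 4 * ((A t : ℂ) + Complex.I * (Y t : ℂ)),
    fun t => Complex.I / 4 * ((A₁ t : ℂ) + Complex.I * (Y₁ t : ℂ)),
    fun t => Complex.I / 4 * ((A₂ t : ℂ) + Complex.I * (Y₂ t : ℂ)), ⟨?_, ?_, ?_, ?_⟩, ?_, ?_⟩
  · intro t ht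
    exact ((dA t).ofReal_comp.add ((dY t ht).ofReal_comp.const_mul Complex.I)).const_mul _
  · intro t ht
    exact ((dA₁ t).ofReal_comp.add ((dY₁ t ht).ofReal_comp.const_mul Complex.I)).const_mul _
  · exact continuousOn_const.mul ((Complex.continuous_ofReal.comp cA₂).continuousOn.add
      (continuousOn_const.mul (Complex.continuous_ofReal.comp_continuousOn cY₂)))
  · intro t ht
    have h1 : (4 * t * A₂ t + 4 * A₁ t + k ^ 2 * A t : ℂ) = 0 := by exact_mod_cast oA t
    have h2 : (4 * t * Y₂ t + 4 * Y₁ t + k ^ 2 * Y t : ℂ) = 0 := by exact_mod_cast oY t ht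
    simp only [Complex.real_smul]
    push_cast
    linear_combination Complex.I / 4 * h1 + Complex.I / 4 * Complex.I * h2
  · intro x y hxy
    have hr : 0 < ‖x - y‖ := norm_pos_iff.mpr (sub_ne_zero.mpr hxy)
    have hlog : Real.log (k * ‖x - y‖ / 2) + Real.eulerMascheroniConstant =
        Real.log (‖x - y‖ ^ 2) / 2 + κ := by
      rw [hκ, mul_div_right_comm, Real.log_mul (by positivity) hr.ne', Real.log_pow]
      push_cast
      ring
    rw [green, if_pos rfl, hankelH0, besselJ0_eq_powerSum, besselY0_eq_powerSum, hlog]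
    simp only [hY, ← hA, ← hS]
    congr 4
    ring
  -- Multiplying out t² h₂ leaves only t log t, which tends to zero, and continuous terms. The limit
  -- is (i/4) · i · (2/π) · (-1/2) = 1/(4π).
  · have e : ∀ᶠ t : ℝ in 𝓝[>] 0,
        Complex.I / 4 * (((t ^ 2 * A₂ t : ℝ) : ℂ) + Complex.I * ((2 / Real.pi *
          (-1 / 2 * A t + t * A₁ t + (t * (Real.log t * t) / 2 + t ^ 2 * κ) * A₂ t +
            t ^ 2 * S₂ t) : ℝ) : ℂ)) =
        √t ^ 4 • (Complex.I / 4 * ((A₂ t : ℂ) + Complex.I * (Y₂ t : ℂ))) := by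
      filter_upwards [self_mem_nhdsWithin] with t ht
      have ht0 : (0 : ℝ) < t := ht
      have h4 : √t ^ 4 = t ^ 2 := by
        rw [show 4 = 2 * 2 by norm_num, pow_mul, Real.sq_sqrt ht0.le]
      have hY2 : 2 / Real.pi * (-1 / 2 * A t + t * A₁ t + (t * (Real.log t * t) / 2 +
          t ^ 2 * κ) * A₂ t + t ^ 2 * S₂ t) = t ^ 2 * Y₂ t := by
        simp only [hY₂]
        field_simp
      rw [hY2, h4, Complex.real_smul]
      push_cast
      ring
    refine Tendsto.congr' e ?_
    have l0 : Tendsto (fun t : ℝ => t) (𝓝[>] 0) (𝓝 0) := nhdsWithin_le_nhds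
    have ll : Tendsto (fun t : ℝ => Real.log t * t) (𝓝[>] 0) (𝓝 0) := by
      simpa using tendsto_log_mul_rpow_nhdsGT_zero one_pos
    have lim : ∀ {f : ℝ → ℝ}, Continuous f → Tendsto f (𝓝[>] 0) (𝓝 (f 0)) :=
      fun hf => (hf.tendsto 0).mono_left nhdsWithin_le_nhds
    have hA0 : A 0 = 1 := by rw [hA, powerSum_zero]; simp [besselJ0Coeff]
    have r1 : Tendsto (fun t => t ^ 2 * A₂ t) (𝓝[>] 0) (𝓝 (0 ^ 2 * A₂ 0)) :=
      (l0.pow 2).mul (lim cA₂)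
    have r2 : Tendsto (fun t => 2 / Real.pi *
          (-1 / 2 * A t + t * A₁ t + (t * (Real.log t * t) / 2 + t ^ 2 * κ) * A₂ t +
            t ^ 2 * S₂ t)) (𝓝[>] 0) (𝓝 (2 / Real.pi *
          (-1 / 2 * A 0 + 0 * A₁ 0 + (0 * 0 / 2 + 0 ^ 2 * κ) * A₂ 0 + 0 ^ 2 * S₂ 0))) :=
      (((((lim cA).const_mul _).add (l0.mul (lim cA₁))).add
        ((((l0.mul ll).div_const 2).add ((l0.pow 2).mul_const κ)).mul (lim cA₂))).add
        ((l0.pow 2).mul (lim cS₂))).const_mul _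
    have r3 := ((((Complex.continuous_ofReal.tendsto _).comp r1).add
      (((Complex.continuous_ofReal.tendsto _).comp r2).const_mul Complex.I)).const_mul
        (Complex.I / 4))
    have hval : (Complex.I / 4) * (((0 ^ 2 * A₂ 0 : ℝ) : ℂ) + Complex.I * ((2 / Real.pi *
          (-1 / 2 * A 0 + 0 * A₁ 0 + (0 * 0 / 2 + 0 ^ 2 * κ) * A₂ 0 + 0 ^ 2 * S₂ 0) : ℝ) : ℂ)) =
        ((1 / (4 * Real.pi) : ℝ) : ℂ) := by
      rw [hA0]
      push_cast
      have hπ' : (Real.pi : ℂ) ≠ 0 := by exact_mod_cast hπ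
      field_simp
      linear_combination (-1 : ℂ) * Complex.I_sq
    rw [← hval]
    exact r3

/-- Everything is elementary in s = √t: h₂ has the denominator 16π s⁵, and its numerator tends to 3.
-/
theorem exists_profile_green_three {k : ℝ} :
    ∃ h h₁ h₂ : ℝ → ℂ, IsHelmholtzProfile 3 k (Ioi 0) h h₁ h₂ ∧
      (∀ x y, x ≠ y → green 3 k x y = h (‖x - y‖ ^ 2)) ∧
      Tendsto (fun t => √t ^ 5 • h₂ t) (𝓝[>] 0) (𝓝 ((3 / (16 * Real.pi) : ℝ) : ℂ)) := by
  have hπ : (Real.pi : ℂ) ≠ 0 := by exact_mod_cast Real.pi_ne_zero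
  set E : ℝ → ℂ := fun t => Complex.exp (Complex.I * (k * √t : ℝ)) with hE
  have hs0 : ∀ t ∈ Ioi (0 : ℝ), ((√t : ℝ) : ℂ) ≠ 0 := fun t ht => by
    exact_mod_cast (Real.sqrt_pos.mpr ht).ne'
  have ds : ∀ t ∈ Ioi (0 : ℝ), HasDerivAt (fun t : ℝ => ((√t : ℝ) : ℂ))
      (1 / (2 * ((√t : ℝ) : ℂ))) t := fun t ht => by
    have := (Real.hasDerivAt_sqrt (ne_of_gt ht)).ofReal_comp
    push_cast at this
    exact this
  have dE : ∀ t ∈ Ioi (0 : ℝ), HasDerivAt E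
      (E t * (Complex.I * (k * (1 / (2 * ((√t : ℝ) : ℂ)))))) t := fun t ht => by
    have h1 := (((ds t ht).const_mul (k : ℂ)).const_mul Complex.I).cexp
    refine (h1.congr_deriv ?_).congr_of_eventuallyEq (Eventually.of_forall fun s => ?_)
    · simp only [hE]
      push_cast
      ring
    · simp only [hE]
      push_cast
      rfl
  have cs : Continuous fun t : ℝ => ((√t : ℝ) : ℂ) :=
    Complex.continuous_ofReal.comp Real.continuous_sqrt
  have cE : Continuous E := by
    simp only [hE]
    fun_prop
  have hsq : ∀ t ∈ Ioi (0 : ℝ), (t : ℂ) = ((√t : ℝ) : ℂ) ^ 2 := fun t ht => by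
    exact_mod_cast (Real.sq_sqrt (le_of_lt ht)).symm
  refine ⟨fun t => E t / (4 * Real.pi * (√t : ℝ)),
    fun t => E t * (Complex.I * k * (√t : ℝ) - 1) / (8 * Real.pi * ((√t : ℝ) : ℂ) ^ 3),
    fun t => E t * (3 - 3 * Complex.I * k * (√t : ℝ) - k ^ 2 * ((√t : ℝ) : ℂ) ^ 2) /
      (16 * Real.pi * ((√t : ℝ) : ℂ) ^ 5), ⟨?_, ?_, ?_, ?_⟩, ?_, ?_⟩
  · intro t ht
    have hs := hs0 t ht
    refine ((dE t ht).div ((ds t ht).const_mul (4 * Real.pi : ℂ))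
      (mul_ne_zero (mul_ne_zero (by norm_num) hπ) hs)).congr_deriv ?_
    field_simp
    ring
  · intro t ht
    have hs := hs0 t ht
    refine (((dE t ht).mul (((ds t ht).const_mul (Complex.I * k)).sub_const 1)).div
      (((ds t ht).pow 3).const_mul (8 * Real.pi : ℂ))
      (mul_ne_zero (mul_ne_zero (by norm_num) hπ) (pow_ne_zero 3 hs))).congr_deriv ?_
    simp only [Pi.mul_apply, Pi.pow_apply]
    push_cast
    field_simp
    ring_nf
    simp only [Complex.I_sq]
    ring
  · refine (cE.continuousOn.mul (Continuous.continuousOn (by fun_prop))).div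
      (Continuous.continuousOn (by fun_prop)) fun t ht => ?_
    exact mul_ne_zero (mul_ne_zero (by norm_num) hπ) (pow_ne_zero 5 (hs0 t ht))
  · intro t ht
    have hs := hs0 t ht
    simp only [Complex.real_smul]
    push_cast
    rw [hsq t ht]
    field_simp
    ring
  · intro x y hxy
    rw [green, if_neg (by norm_num)]
    simp only [hE]
    rw [Real.sqrt_sq (norm_nonneg _)]
    push_cast
    rfl
  · have e : ∀ᶠ t : ℝ in 𝓝[>] 0,
        E t * (3 - 3 * Complex.I * k * (√t : ℝ) - k ^ 2 * ((√t : ℝ) : ℂ) ^ 2) /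
          (16 * Real.pi) =
        √t ^ 5 • (E t * (3 - 3 * Complex.I * k * (√t : ℝ) - k ^ 2 * ((√t : ℝ) : ℂ) ^ 2) /
          (16 * Real.pi * ((√t : ℝ) : ℂ) ^ 5)) := by
      filter_upwards [self_mem_nhdsWithin] with t ht
      have hs := hs0 t ht
      rw [Complex.real_smul]
      push_cast
      field_simp
    refine Tendsto.congr' e ?_
    have hc : Continuous fun t : ℝ =>
        E t * (3 - 3 * Complex.I * k * (√t : ℝ) - k ^ 2 * ((√t : ℝ) : ℂ) ^ 2) /
          (16 * Real.pi) := by fun_prop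
    have := (hc.tendsto 0).mono_left (nhdsWithin_le_nhds (s := Ioi 0))
    simpa [hE] using this

/-- The Green function is a radial solution of the Helmholtz equation with the singularity of a
fundamental solution. -/
theorem exists_profile_green {d : ℕ} (hd : d = 2 ∨ d = 3) {k : ℝ} (hk : 0 < k) :
    ∃ h h₁ h₂ : ℝ → ℂ, IsHelmholtzProfile d k (Ioi 0) h h₁ h₂ ∧
      (∀ x y, x ≠ y → green d k x y = h (‖x - y‖ ^ 2)) ∧
      ∃ c : ℝ, 4 * c * volume.real (Metric.ball (0 : EuclideanSpace ℝ (Fin d)) 1) = 1 ∧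
        Tendsto (fun t => √t ^ (d + 2) • h₂ t) (𝓝[>] 0) (𝓝 (c : ℂ)) := by
  have hπ := Real.pi_pos
  rcases hd with rfl | rfl
  · obtain ⟨h, h₁, h₂, hp, hg, hl⟩ := exists_profile_green_two hk
    refine ⟨h, h₁, h₂, hp, hg, _, ?_, hl⟩
    rw [Measure.real, EuclideanSpace.volume_ball_fin_two]
    simp [hπ.le]
    field_simp
  · obtain ⟨h, h₁, h₂, hp, hg, hl⟩ := exists_profile_green_three (k := k)
    refine ⟨h, h₁, h₂, hp, hg, _, ?_, hl⟩
    rw [Measure.real, EuclideanSpace.volume_ball_fin_three, ENNReal.ofReal_one, one_pow, one_mul,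
      ENNReal.toReal_ofReal (by positivity)]
    field_simp
    norm_num

end Green

/-! ### The kernel produced by smoothing the singularity. -/

section ApproximateIdentity

/-- An explicit antiderivative for the radial integral of (1 + |w|²)^(-(d+2)/2) in polar
coordinates; it gives both integrability and the exact mass of the kernel. -/
theorem hasDerivAt_div_sqrt_one_add_sq_pow (d : ℕ) (y : ℝ) :
    HasDerivAt (fun y : ℝ => (y / √(1 + y ^ 2)) ^ d)
      (d * (y ^ (d - 1) * (√(1 + y ^ 2) ^ (d + 2))⁻¹)) y := by
  have h0 : 0 < 1 + y ^ 2 := by positivity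
  have hs : 0 < √(1 + y ^ 2) := Real.sqrt_pos.mpr h0
  have hsq : √(1 + y ^ 2) ^ 2 = 1 + y ^ 2 := Real.sq_sqrt h0.le
  have h1 : HasDerivAt (fun y : ℝ => √(1 + y ^ 2)) (y / √(1 + y ^ 2)) y := by
    have := (((hasDerivAt_pow 2 y).const_add 1).sqrt h0.ne')
    refine this.congr_deriv ?_
    field_simp
    push_cast
    ring
  have h2 : HasDerivAt (fun y : ℝ => y / √(1 + y ^ 2)) ((√(1 + y ^ 2) ^ 3)⁻¹) y := by
    refine ((hasDerivAt_id y).div h1 hs.ne').congr_deriv ?_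
    simp only [id]
    field_simp
    linear_combination hsq
  refine (h2.pow d).congr_deriv ?_
  rcases d with _ | d
  · simp
  · rw [Nat.add_sub_cancel, div_pow, show d + 1 + 2 = d + 3 by ring, pow_add _ d 3]
    field_simp

theorem tendsto_div_sqrt_one_add_sq_pow (d : ℕ) :
    Tendsto (fun y : ℝ => (y / √(1 + y ^ 2)) ^ d) atTop (𝓝 1) := by
  have h1 : Tendsto (fun y : ℝ => √((y⁻¹) ^ 2 + 1)) atTop (𝓝 1) := by
    have hc : Continuous fun x : ℝ => √(x ^ 2 + 1) := by fun_prop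
    have h := (hc.tendsto 0).comp tendsto_inv_atTop_zero
    rw [zero_pow two_ne_zero, zero_add, Real.sqrt_one] at h
    exact h
  have h2 : Tendsto (fun y : ℝ => y / √(1 + y ^ 2)) atTop (𝓝 1) := by
    have h3 := h1.inv₀ one_ne_zero
    rw [inv_one] at h3
    refine h3.congr' ?_
    filter_upwards [eventually_gt_atTop 0] with y hy
    have : (y⁻¹) ^ 2 + 1 = (1 + y ^ 2) / y ^ 2 := by field_simp
    rw [this, Real.sqrt_div (by positivity), Real.sqrt_sq hy.le, inv_div]
  simpa using h2.pow d

variable {d : ℕ}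

theorem integrable_inv_sqrt_one_add_sq (hd : 1 ≤ d) :
    Integrable fun w : EuclideanSpace ℝ (Fin d) => (√(1 + ‖w‖ ^ 2) ^ (d + 2))⁻¹ := by
  have : Nontrivial (EuclideanSpace ℝ (Fin d)) := by
    have : Nonempty (Fin d) := ⟨⟨0, hd⟩⟩
    infer_instance
  rw [integrable_fun_norm_addHaar volume (f := fun y => (√(1 + y ^ 2) ^ (d + 2))⁻¹)]
  simp only [finrank_euclideanSpace, Fintype.card_fin, smul_eq_mul]
  have h := integrableOn_Ioi_deriv_of_nonneg' (a := 0)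
    (fun y _ => hasDerivAt_div_sqrt_one_add_sq_pow d y)
    (fun y (hy : 0 < y) => by positivity) (tendsto_div_sqrt_one_add_sq_pow d)
  have hd0 : (d : ℝ) ≠ 0 := by positivity
  exact (h.const_mul (d : ℝ)⁻¹).congr (ae_of_all _ fun y => by
    simp only
    rw [inv_mul_cancel_left₀ hd0])

/-- The factor d from polar coordinates cancels the one in the antiderivative. This mass explains
the normalization 4c|B₁| = 1 of the singularity. -/
theorem integral_inv_sqrt_one_add_sq (hd : 1 ≤ d) :
    ∫ w : EuclideanSpace ℝ (Fin d), (√(1 + ‖w‖ ^ 2) ^ (d + 2))⁻¹ =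
      volume.real (Metric.ball (0 : EuclideanSpace ℝ (Fin d)) 1) := by
  have : Nontrivial (EuclideanSpace ℝ (Fin d)) := by
    have : Nonempty (Fin d) := ⟨⟨0, hd⟩⟩
    infer_instance
  rw [integral_fun_norm_addHaar volume (fun y => (√(1 + y ^ 2) ^ (d + 2))⁻¹)]
  simp only [finrank_euclideanSpace, Fintype.card_fin, smul_eq_mul, nsmul_eq_mul]
  have h := integral_Ioi_of_hasDerivAt_of_nonneg' (a := 0)
    (fun y _ => hasDerivAt_div_sqrt_one_add_sq_pow d y)
    (fun y (hy : 0 < y) => by positivity) (tendsto_div_sqrt_one_add_sq_pow d)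
  rw [integral_const_mul, zero_div, zero_pow (by omega), sub_zero] at h
  linear_combination volume.real (Metric.ball (0 : EuclideanSpace ℝ (Fin d)) 1) * h

theorem exists_bound_of_tendsto_nhdsGT {f : ℝ → ℂ} {c : ℂ} (hf : ContinuousOn f (Ioi 0))
    (hl : Tendsto f (𝓝[>] 0) (𝓝 c)) (T : ℝ) : ∃ M, 0 ≤ M ∧ ∀ t, 0 < t → t ≤ T → ‖f t‖ ≤ M := by
  have h1 : ∀ᶠ t in 𝓝[>] (0 : ℝ), ‖f t‖ < ‖c‖ + 1 :=
    hl.norm.eventually (gt_mem_nhds (lt_add_one _))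
  obtain ⟨a, ha, hsub⟩ := mem_nhdsGT_iff_exists_Ioo_subset.mp h1
  have ha0 : (0 : ℝ) < a := ha
  obtain ⟨M, hM⟩ := (isCompact_Icc (a := a) (b := T)).exists_bound_of_continuousOn
    (hf.mono fun t ht => ha0.trans_le ht.1)
  refine ⟨max (‖c‖ + 1) M, le_max_of_le_left (by positivity), fun t ht htT => ?_⟩
  rcases lt_or_ge t a with h | h
  · exact (le_of_lt (hsub ⟨ht, h⟩)).trans (le_max_left _ _)
  · exact (hM t ⟨h, htT⟩).trans (le_max_right _ _)

/-- The kernels `4 δ² h₂(|p - y|² + δ²)` are an approximate identity at `y`. -/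
theorem tendsto_integral_kernel (hd : 1 ≤ d) {Ω : Set (EuclideanSpace ℝ (Fin d))}
    (hΩ : IsOpen Ω) (hb : Bornology.IsBounded Ω) {y : EuclideanSpace ℝ (Fin d)} (hy : y ∈ Ω)
    {v : EuclideanSpace ℝ (Fin d) → ℝ} (hv : Continuous v) {h₂ : ℝ → ℂ}
    (hh : ContinuousOn h₂ (Ioi 0)) {c : ℝ}
    (hc : 4 * c * volume.real (Metric.ball (0 : EuclideanSpace ℝ (Fin d)) 1) = 1)
    (hl : Tendsto (fun t => √t ^ (d + 2) • h₂ t) (𝓝[>] 0) (𝓝 (c : ℂ))) :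
    Tendsto (fun δ : ℝ => ∫ p in Ω, (4 * δ ^ 2 * v p) • h₂ (‖p - y‖ ^ 2 + δ ^ 2)) (𝓝[>] 0)
      (𝓝 (v y : ℂ)) := by
  -- The part of h₂ that stays bounded near 0. After the rescaling p = y + δw, all powers of δ
  -- cancel, and what remains is an integrable weight times κ at an argument tending to 0.
  set κ : ℝ → ℂ := fun t => √t ^ (d + 2) • h₂ t with hκ
  have hκc : ContinuousOn κ (Ioi 0) :=
    (Real.continuous_sqrt.pow (d + 2)).continuousOn.smul hh
  set G : ℝ → EuclideanSpace ℝ (Fin d) → ℂ := fun δ =>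
    Ω.indicator fun p => (4 * δ ^ 2 * v p) • h₂ (‖p - y‖ ^ 2 + δ ^ 2) with hG
  have hGm : ∀ δ, 0 < δ → StronglyMeasurable (G δ) := by
    intro δ hδ
    have hcont : Continuous fun p : EuclideanSpace ℝ (Fin d) =>
        (4 * δ ^ 2 * v p) • h₂ (‖p - y‖ ^ 2 + δ ^ 2) :=
      (continuous_const.mul hv).smul (hh.comp_continuous (by fun_prop) fun p => by
        have : 0 < ‖p - y‖ ^ 2 + δ ^ 2 := by positivity
        exact this)
    exact hcont.stronglyMeasurable.indicator hΩ.measurableSet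
  have hscale : ∀ δ, 0 < δ → ∫ p in Ω, (4 * δ ^ 2 * v p) • h₂ (‖p - y‖ ^ 2 + δ ^ 2) =
      ∫ w, δ ^ d • G δ (y + δ • w) := by
    intro δ hδ
    rw [integral_smul, Measure.integral_comp_smul volume (fun x => G δ (y + x)),
      integral_add_left_eq_self (G δ) y, finrank_euclideanSpace, Fintype.card_fin,
      abs_of_pos (by positivity), smul_inv_smul₀ (by positivity), hG,
      integral_indicator hΩ.measurableSet]
  have hform : ∀ δ, 0 < δ → ∀ w, y + δ • w ∈ Ω → δ ^ d • G δ (y + δ • w) =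
      (4 * v (y + δ • w) * (√(1 + ‖w‖ ^ 2) ^ (d + 2))⁻¹) •
        κ (‖δ • w‖ ^ 2 + δ ^ 2) := by
    intro δ hδ w hw
    have hs : 0 < √(1 + ‖w‖ ^ 2) := Real.sqrt_pos.mpr (by positivity)
    have hsq : √(‖δ • w‖ ^ 2 + δ ^ 2) = δ * √(1 + ‖w‖ ^ 2) := by
      rw [norm_smul, Real.norm_eq_abs, mul_pow, sq_abs,
        show δ ^ 2 * ‖w‖ ^ 2 + δ ^ 2 = δ ^ 2 * (1 + ‖w‖ ^ 2) by ring,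
        Real.sqrt_mul (by positivity), Real.sqrt_sq hδ.le]
    simp only [hG, hκ]
    rw [indicator_of_mem hw, add_sub_cancel_left, smul_smul, smul_smul, hsq, mul_pow]
    congr 1
    field_simp
    ring
  obtain ⟨R, hR⟩ := (Metric.isBounded_iff_subset_closedBall y).mp hb
  -- For δ < 1 and points of Ω, the argument |p - y|² + δ² does not exceed R² + 1.
  obtain ⟨M, hM0, hM⟩ := exists_bound_of_tendsto_nhdsGT hκc hl (R ^ 2 + 1)
  obtain ⟨V, hV⟩ := hb.isCompact_closure.exists_bound_of_continuousOn hv.continuousOn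
  have hV0 : 0 ≤ V := (norm_nonneg _).trans (hV y (subset_closure hy))
  have hev1 : ∀ᶠ δ : ℝ in 𝓝[>] 0, 0 < δ ∧ δ < 1 :=
    eventually_mem_nhdsWithin.and (nhdsWithin_le_nhds (gt_mem_nhds one_pos))
  have hmain : Tendsto (fun δ : ℝ => ∫ w, δ ^ d • G δ (y + δ • w)) (𝓝[>] 0)
      (𝓝 (∫ w : EuclideanSpace ℝ (Fin d),
        (4 * v y * (√(1 + ‖w‖ ^ 2) ^ (d + 2))⁻¹) • (c : ℂ))) := by
    refine tendsto_integral_filter_of_dominated_convergence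
      (fun w => 4 * V * M * (√(1 + ‖w‖ ^ 2) ^ (d + 2))⁻¹) ?_ ?_
      ((integrable_inv_sqrt_one_add_sq hd).const_mul _) ?_
    · filter_upwards [hev1] with δ hδ
      have hmeas : Measurable fun w : EuclideanSpace ℝ (Fin d) => y + δ • w := by fun_prop
      exact (((hGm δ hδ.1).comp_measurable hmeas).const_smul (δ ^ d)).aestronglyMeasurable
    · filter_upwards [hev1] with δ hδ
      refine ae_of_all _ fun w => ?_
      by_cases hw : y + δ • w ∈ Ω
      · rw [hform δ hδ.1 w hw, norm_smul, norm_mul, norm_mul, norm_inv]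
        have h1 : ‖κ (‖δ • w‖ ^ 2 + δ ^ 2)‖ ≤ M := by
          have hδ0 := hδ.1
          refine hM _ (by positivity) ?_
          have : ‖δ • w‖ ≤ R := by
            have := mem_closedBall_iff_norm.mp (hR hw)
            rwa [add_sub_cancel_left] at this
          have h3 : ‖δ • w‖ ^ 2 ≤ R ^ 2 := by gcongr
          have h4 : δ ^ 2 ≤ 1 := pow_le_one₀ hδ.1.le hδ.2.le
          linarith
        have h2 := hV _ (subset_closure hw)
        have h4 : ‖(4 : ℝ)‖ = 4 := by norm_num
        have h5 : ‖√(1 + ‖w‖ ^ 2) ^ (d + 2)‖ = √(1 + ‖w‖ ^ 2) ^ (d + 2) :=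
          Real.norm_of_nonneg (by positivity)
        rw [h4, h5]
        calc 4 * ‖v (y + δ • w)‖ * (√(1 + ‖w‖ ^ 2) ^ (d + 2))⁻¹ * ‖κ (‖δ • w‖ ^ 2 + δ ^ 2)‖
            ≤ 4 * V * (√(1 + ‖w‖ ^ 2) ^ (d + 2))⁻¹ * M := by gcongr
          _ = 4 * V * M * (√(1 + ‖w‖ ^ 2) ^ (d + 2))⁻¹ := by ring
      · simp only [hG]
        rw [indicator_of_notMem hw, smul_zero, norm_zero]
        positivity
    · refine ae_of_all _ fun w => ?_
      have hcw : Tendsto (fun δ : ℝ => y + δ • w) (𝓝[>] 0) (𝓝 y) := by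
        have : Continuous fun δ : ℝ => y + δ • w := by fun_prop
        simpa using (this.tendsto 0).mono_left nhdsWithin_le_nhds
      have hct : Tendsto (fun δ : ℝ => ‖δ • w‖ ^ 2 + δ ^ 2) (𝓝[>] 0) (𝓝[>] 0) := by
        refine tendsto_nhdsWithin_iff.mpr ⟨?_, ?_⟩
        · have : Continuous fun δ : ℝ => ‖δ • w‖ ^ 2 + δ ^ 2 := by fun_prop
          simpa using (this.tendsto 0).mono_left nhdsWithin_le_nhds
        · filter_upwards [hev1] with δ hδ
          have hδ0 := hδ.1
          have : 0 < ‖δ • w‖ ^ 2 + δ ^ 2 := by positivity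
          exact this
      have h1 := (((hv.tendsto y).comp hcw).const_mul 4).mul_const
        ((√(1 + ‖w‖ ^ 2) ^ (d + 2))⁻¹)
      refine (h1.smul (hl.comp hct)).congr' ?_
      filter_upwards [hev1, hcw.eventually (hΩ.mem_nhds hy)] with δ hδ hw
      exact (hform δ hδ.1 w hw).symm
  have hval : ∫ w : EuclideanSpace ℝ (Fin d),
      (4 * v y * (√(1 + ‖w‖ ^ 2) ^ (d + 2))⁻¹) • (c : ℂ) = (v y : ℂ) := by
    rw [integral_smul_const, integral_const_mul, integral_inv_sqrt_one_add_sq hd,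
      Complex.real_smul, ← Complex.ofReal_mul]
    congr 1
    linear_combination v y * hc
  rw [hval] at hmain
  refine hmain.congr' ?_
  filter_upwards [hev1] with δ hδ using (hscale δ hδ.1).symm

end ApproximateIdentity

/-! ### Calculus of radial functions. -/

section Radial

variable {d : ℕ} {F : Type*} [NormedAddCommGroup F] [NormedSpace ℝ F]

/-- The shift s covers both the original profiles, s = 0, and the smoothed ones, s = δ². -/
theorem hasFDerivAt_radial {f : ℝ → F} {f' : F} {s : ℝ} {z p : EuclideanSpace ℝ (Fin d)}
    (hf : HasDerivAt f f' (‖p - z‖ ^ 2 + s)) :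
    HasFDerivAt (fun q => f (‖q - z‖ ^ 2 + s))
      ((innerSL ℝ (p - z)).smulRight ((2 : ℝ) • f')) p := by
  have h1 : HasFDerivAt (fun q : EuclideanSpace ℝ (Fin d) => ‖q - z‖ ^ 2 + s)
      ((2 : ℝ) • innerSL ℝ (p - z)) p := by
    have := ((hasFDerivAt_id p).sub_const z).norm_sq.add_const s
    refine this.congr_fderiv ?_
    ext v
    simp
  refine (hf.hasFDerivAt.comp p h1).congr_fderiv ?_
  ext v
  simp
  module

theorem contDiffAt_one_of_hasDerivAt {s : Set ℝ} (hs : IsOpen s) {f f' : ℝ → F}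
    (hf : ∀ t ∈ s, HasDerivAt f (f' t) t) (hf' : ContinuousOn f' s) {t : ℝ} (ht : t ∈ s) :
    ContDiffAt ℝ 1 f t := by
  have h : ContDiffOn ℝ (0 + 1) f s := by
    rw [contDiffOn_succ_iff_deriv_of_isOpen hs]
    refine ⟨fun t ht => (hf t ht).differentiableAt.differentiableWithinAt, by simp, ?_⟩
    exact contDiffOn_zero.mpr (hf'.congr fun t ht => (hf t ht).deriv)
  exact (h.contDiffAt (hs.mem_nhds ht)).of_le (by simp)

theorem contDiff_radial {s : Set ℝ} (hs : IsOpen s) {f f' : ℝ → F}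
    (hf : ∀ t ∈ s, HasDerivAt f (f' t) t) (hf' : ContinuousOn f' s) {c : ℝ}
    {z : EuclideanSpace ℝ (Fin d)} (hc : ∀ q : EuclideanSpace ℝ (Fin d), ‖q - z‖ ^ 2 + c ∈ s) :
    ContDiff ℝ 1 fun q : EuclideanSpace ℝ (Fin d) => f (‖q - z‖ ^ 2 + c) :=
  contDiff_iff_contDiffAt.mpr fun q =>
    (contDiffAt_one_of_hasDerivAt hs hf hf' (hc q)).comp q
      (((contDiff_id.sub contDiff_const).norm_sq ℝ).add contDiff_const).contDiffAt

theorem IsHelmholtzProfile.continuousOn {k : ℝ} {s : Set ℝ} {h h₁ h₂ : ℝ → F}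
    (hp : IsHelmholtzProfile d k s h h₁ h₂) : ContinuousOn h s :=
  fun t ht => (hp.hasDerivAt t ht).continuousAt.continuousWithinAt

theorem IsHelmholtzProfile.continuousOn_one {k : ℝ} {s : Set ℝ} {h h₁ h₂ : ℝ → F}
    (hp : IsHelmholtzProfile d k s h h₁ h₂) : ContinuousOn h₁ s :=
  fun t ht => (hp.hasDerivAt_one t ht).continuousAt.continuousWithinAt

end Radial

/-! ### Green's representation formula. -/

section Representation

variable {d n : ℕ} {Ω : Set (EuclideanSpace ℝ (Fin d))} {k : ℝ} {H H₁ H₂ : ℝ → ℝ}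
  {h h₁ h₂ : ℝ → ℂ}

/-- Green's second identity for a regular and a regularized singular radial solution. -/
theorem integral_frontier_regularized (hd : d = n + 1) (hΩ : IsBoundedC1Domain Ω)
    (hH : IsHelmholtzProfile d k univ H H₁ H₂) (hh : IsHelmholtzProfile d k (Ioi 0) h h₁ h₂)
    (y z : EuclideanSpace ℝ (Fin d)) {δ : ℝ} (hδ : 0 < δ) :
    ∫ p in frontier Ω, ((2 * H₁ (‖p - z‖ ^ 2) * ⟪p - z, outwardNormal Ω p⟫) •
        h (‖p - y‖ ^ 2 + δ ^ 2) -
      (2 * H (‖p - z‖ ^ 2) * ⟪p - y, outwardNormal Ω p⟫) • h₁ (‖p - y‖ ^ 2 + δ ^ 2)) ∂μHE[n] =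
    ∫ p in Ω, (4 * δ ^ 2 * H (‖p - z‖ ^ 2)) • h₂ (‖p - y‖ ^ 2 + δ ^ 2) := by
  have hpos : ∀ q : EuclideanSpace ℝ (Fin d), ‖q - y‖ ^ 2 + δ ^ 2 ∈ Ioi (0 : ℝ) := fun q => by
    have : 0 < ‖q - y‖ ^ 2 + δ ^ 2 := by positivity
    exact this
  have hu : ∀ q : EuclideanSpace ℝ (Fin d), ‖q - z‖ ^ 2 + 0 ∈ (univ : Set ℝ) := fun q => mem_univ _
  set b := EuclideanSpace.basisFun (Fin d) ℝ with hb
  -- The field U∇V - V∇U with V = H(|p - z|²) and U = h(|p - y|² + δ²). The summand 0 puts V in the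
  -- shifted form of the radial lemmas.
  set X : Fin d → EuclideanSpace ℝ (Fin d) → ℂ := fun i p =>
    (2 * H₁ (‖p - z‖ ^ 2 + 0) * ⟪p - z, b i⟫) • h (‖p - y‖ ^ 2 + δ ^ 2) -
      (2 * H (‖p - z‖ ^ 2 + 0) * ⟪p - y, b i⟫) • h₁ (‖p - y‖ ^ 2 + δ ^ 2) with hX
  have hlin : ∀ (x : EuclideanSpace ℝ (Fin d)) (i : Fin d),
      ContDiff ℝ 1 fun p => ⟪p - x, b i⟫ := fun x i =>
    (contDiff_id.sub contDiff_const).inner ℝ contDiff_const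
  have hXC : ∀ i, ContDiff ℝ 1 (X i) := fun i =>
    (((contDiff_const.mul (contDiff_radial isOpen_univ hH.hasDerivAt_one hH.continuousOn_two hu)).mul
      (hlin z i)).smul (contDiff_radial isOpen_Ioi hh.hasDerivAt hh.continuousOn_one hpos)).sub
    (((contDiff_const.mul (contDiff_radial isOpen_univ hH.hasDerivAt hH.continuousOn_one hu)).mul
      (hlin y i)).smul (contDiff_radial isOpen_Ioi hh.hasDerivAt_one hh.continuousOn_two hpos))
  have hXd : ∀ i p, fderiv ℝ (X i) p (b i) =
      (4 * H₂ (‖p - z‖ ^ 2 + 0) * ⟪p - z, b i⟫ ^ 2 + 2 * H₁ (‖p - z‖ ^ 2 + 0)) •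
        h (‖p - y‖ ^ 2 + δ ^ 2) -
      H (‖p - z‖ ^ 2 + 0) • ((2 : ℝ) • h₁ (‖p - y‖ ^ 2 + δ ^ 2) +
        (4 * ⟪p - y, b i⟫ ^ 2) • h₂ (‖p - y‖ ^ 2 + δ ^ 2)) := by
    intro i p
    have e1 : ∀ x : EuclideanSpace ℝ (Fin d),
        HasFDerivAt (fun p => ⟪p - x, b i⟫) (innerSL ℝ (b i)) p := by
      intro x
      have := ((innerSL ℝ (b i)).hasFDerivAt (x := p - x)).comp p
        ((hasFDerivAt_id p).sub_const x)
      refine (this.congr_fderiv (by ext; simp)).congr_of_eventuallyEq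
        (Eventually.of_forall fun q => ?_)
      simp [real_inner_comm]
    have hbi : ⟪b i, b i⟫ = 1 := by
      rw [real_inner_self_eq_norm_sq, b.norm_eq_one, one_pow]
    have dH₁ := hasFDerivAt_radial (hH.hasDerivAt_one _ (hu p))
    have dH := hasFDerivAt_radial (hH.hasDerivAt _ (hu p))
    have dh₁ := hasFDerivAt_radial (hh.hasDerivAt_one _ (hpos p))
    have dh := hasFDerivAt_radial (hh.hasDerivAt _ (hpos p))
    have key := (((dH₁.const_mul 2).mul (e1 z)).smul dh).sub
      (((dH.const_mul 2).mul (e1 y)).smul dh₁)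
    have key' : HasFDerivAt (X i) _ p := key
    rw [key'.fderiv]
    simp [inner_sub_left]
    ring
  -- The equation for h at |p - y|² + δ² has the coefficient 4(|p - y|² + δ²), while the Laplacian
  -- of U only contains 4|p - y|². Hence ΔU + k²U = -4δ² h₂, and the terms with k² cancel in UΔV -
  -- VΔU.
  have hdiv : ∀ p, ∑ i, fderiv ℝ (X i) p (b i) =
      (4 * δ ^ 2 * H (‖p - z‖ ^ 2)) • h₂ (‖p - y‖ ^ 2 + δ ^ 2) := by
    intro p
    have hsq : ∀ x : EuclideanSpace ℝ (Fin d), ∑ i, ⟪x, b i⟫ ^ 2 = ‖x‖ ^ 2 := fun x => by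
      rw [← b.sum_sq_norm_inner_left x]
      simp
    have o1 := hH.ode _ (hu p)
    have o2 := hh.ode _ (hpos p)
    have s1 : ∑ i, fderiv ℝ (X i) p (b i) =
        (4 * H₂ (‖p - z‖ ^ 2 + 0) * (∑ i, ⟪p - z, b i⟫ ^ 2) + d * (2 * H₁ (‖p - z‖ ^ 2 + 0))) •
          h (‖p - y‖ ^ 2 + δ ^ 2) -
        H (‖p - z‖ ^ 2 + 0) • ((d * 2 : ℝ) • h₁ (‖p - y‖ ^ 2 + δ ^ 2) +
          (4 * ∑ i, ⟪p - y, b i⟫ ^ 2) • h₂ (‖p - y‖ ^ 2 + δ ^ 2)) := by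
      simp only [hXd]
      rw [Finset.sum_sub_distrib, ← Finset.sum_smul, ← Finset.smul_sum, Finset.sum_add_distrib,
        Finset.sum_add_distrib, ← Finset.sum_smul, ← Finset.mul_sum, ← Finset.mul_sum]
      simp only [Finset.sum_const, Finset.card_univ, Fintype.card_fin, nsmul_eq_mul,
        Complex.real_smul]
      push_cast
      simp only [← Finset.sum_mul, ← Finset.mul_sum]
      ring
    rw [s1, hsq, hsq]
    simp only [add_zero, smul_eq_mul] at o1 o2 ⊢
    simp only [Complex.real_smul] at o2 ⊢
    have o1' : (4 * ‖p - z‖ ^ 2 * H₂ (‖p - z‖ ^ 2) + 2 * d * H₁ (‖p - z‖ ^ 2) +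
        k ^ 2 * H (‖p - z‖ ^ 2) : ℂ) = 0 := by exact_mod_cast o1
    push_cast at o2 ⊢
    linear_combination h (‖p - y‖ ^ 2 + δ ^ 2) * o1' - (H (‖p - z‖ ^ 2) : ℂ) * o2
  have hbdry : ∀ p, (2 * H₁ (‖p - z‖ ^ 2) * ⟪p - z, outwardNormal Ω p⟫) •
        h (‖p - y‖ ^ 2 + δ ^ 2) -
      (2 * H (‖p - z‖ ^ 2) * ⟪p - y, outwardNormal Ω p⟫) • h₁ (‖p - y‖ ^ 2 + δ ^ 2) =
      ∑ i, ⟪outwardNormal Ω p, b i⟫ • X i p := by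
    intro p
    have hin : ∀ x : EuclideanSpace ℝ (Fin d),
        ∑ i, ⟪outwardNormal Ω p, b i⟫ * ⟪x, b i⟫ = ⟪x, outwardNormal Ω p⟫ := fun x => by
      rw [← b.sum_inner_mul_inner x]
      refine Finset.sum_congr rfl fun i _ => ?_
      rw [real_inner_comm (b i), mul_comm]
    simp only [hX, smul_sub, smul_smul, add_zero]
    rw [Finset.sum_sub_distrib, ← Finset.sum_smul, ← Finset.sum_smul, ← hin, ← hin,
      Finset.mul_sum, Finset.mul_sum]
    congr 2
    · exact Finset.sum_congr rfl fun i _ => by ring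
    · exact Finset.sum_congr rfl fun i _ => by ring
  simp only [hbdry, ← hdiv]
  rw [integral_finsetSum _ fun i _ => hΩ.integrableOn_inner_smul hd (hXC i).continuous (b i),
    integral_finsetSum _ fun i _ => hΩ.integrableOn_of_continuous
      (((hXC i).continuous_fderiv one_ne_zero).clm_apply continuous_const)]
  exact Finset.sum_congr rfl fun i _ => (hΩ.integral_fderiv hd (hXC i) (b i)).symm

/-- Green's representation formula for the regular radial solutions of the Helmholtz equation. -/
theorem integral_frontier_eq (hd : d = n + 1) (hΩ : IsBoundedC1Domain Ω)
    (hH : IsHelmholtzProfile d k univ H H₁ H₂) (hh : IsHelmholtzProfile d k (Ioi 0) h h₁ h₂)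
    {c : ℝ} (hc : 4 * c * volume.real (Metric.ball (0 : EuclideanSpace ℝ (Fin d)) 1) = 1)
    (hl : Tendsto (fun t => √t ^ (d + 2) • h₂ t) (𝓝[>] 0) (𝓝 (c : ℂ)))
    {y : EuclideanSpace ℝ (Fin d)} (hy : y ∈ Ω) (z : EuclideanSpace ℝ (Fin d)) :
    ∫ p in frontier Ω, ((2 * H₁ (‖p - z‖ ^ 2) * ⟪p - z, outwardNormal Ω p⟫) •
        h (‖p - y‖ ^ 2) -
      (2 * H (‖p - z‖ ^ 2) * ⟪p - y, outwardNormal Ω p⟫) • h₁ (‖p - y‖ ^ 2)) ∂μHE[n] =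
    (H (‖y - z‖ ^ 2) : ℂ) := by
  have cH : Continuous H := continuousOn_univ.mp hH.continuousOn
  have cH₁ : Continuous H₁ := continuousOn_univ.mp hH.continuousOn_one
  have cν := hΩ.continuousOn_outwardNormal
  set α : EuclideanSpace ℝ (Fin d) → ℝ := fun p =>
    2 * H₁ (‖p - z‖ ^ 2) * ⟪p - z, outwardNormal Ω p⟫ with hα
  set β : EuclideanSpace ℝ (Fin d) → ℝ := fun p =>
    2 * H (‖p - z‖ ^ 2) * ⟪p - y, outwardNormal Ω p⟫ with hβ
  have cα : ContinuousOn α (frontier Ω) :=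
    (Continuous.continuousOn (by fun_prop)).mul
      (ContinuousOn.inner (Continuous.continuousOn (by fun_prop)) cν)
  have cβ : ContinuousOn β (frontier Ω) :=
    (Continuous.continuousOn (by fun_prop)).mul
      (ContinuousOn.inner (Continuous.continuousOn (by fun_prop)) cν)
  have hne : ∀ p ∈ frontier Ω, 0 < ‖p - y‖ ^ 2 := by
    intro p hp
    have : p ≠ y := by
      rintro rfl
      exact (hΩ.isOpen.frontier_eq ▸ hp).2 hy
    have := norm_pos_iff.mpr (sub_ne_zero.mpr this)
    positivity
  have hK := hΩ.isCompact_frontier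
  -- Since y is not on the boundary, the boundary integrand is continuous on this compact set,
  -- including δ = 0; this supplies a constant majorant for dominated convergence.
  set T : Set (EuclideanSpace ℝ (Fin d) × ℝ) := frontier Ω ×ˢ Icc 0 1 with hT
  have hTc : IsCompact T := hK.prod isCompact_Icc
  set Ψ : EuclideanSpace ℝ (Fin d) × ℝ → ℂ := fun q =>
    α q.1 • h (‖q.1 - y‖ ^ 2 + q.2 ^ 2) - β q.1 • h₁ (‖q.1 - y‖ ^ 2 + q.2 ^ 2) with hΨ
  have hmaps : MapsTo (fun q : EuclideanSpace ℝ (Fin d) × ℝ => ‖q.1 - y‖ ^ 2 + q.2 ^ 2) T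
      (Ioi 0) := fun q hq => add_pos_of_pos_of_nonneg (hne q.1 hq.1) (sq_nonneg _)
  have hfst : MapsTo (Prod.fst : EuclideanSpace ℝ (Fin d) × ℝ → _) T (frontier Ω) :=
    fun q hq => hq.1
  have ct : Continuous fun q : EuclideanSpace ℝ (Fin d) × ℝ => ‖q.1 - y‖ ^ 2 + q.2 ^ 2 := by
    fun_prop
  have cΨ : ContinuousOn Ψ T :=
    ((cα.comp continuous_fst.continuousOn hfst).smul
      (hh.continuousOn.comp ct.continuousOn hmaps)).sub
    ((cβ.comp continuous_fst.continuousOn hfst).smul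
      (hh.continuousOn_one.comp ct.continuousOn hmaps))
  obtain ⟨M, hM⟩ := hTc.exists_bound_of_continuousOn cΨ
  have hsec : ∀ δ ∈ Icc (0 : ℝ) 1, ContinuousOn (fun p => Ψ (p, δ)) (frontier Ω) := fun δ hδ =>
    cΨ.comp (Continuous.continuousOn (by fun_prop)) fun p hp => ⟨hp, hδ⟩
  have hev : ∀ᶠ δ : ℝ in 𝓝[>] 0, 0 < δ ∧ δ < 1 :=
    eventually_mem_nhdsWithin.and (nhdsWithin_le_nhds (gt_mem_nhds one_pos))
  have hmeas : MeasurableSet (frontier Ω) := isClosed_frontier.measurableSet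
  have : IsFiniteMeasure ((μHE[n] : Measure (EuclideanSpace ℝ (Fin d))).restrict (frontier Ω)) :=
    isFiniteMeasure_restrict.mpr (hΩ.measure_frontier_lt_top hd).ne
  have lim1 : Tendsto (fun δ : ℝ => ∫ p in frontier Ω, Ψ (p, δ) ∂μHE[n]) (𝓝[>] 0)
      (𝓝 (∫ p in frontier Ω, Ψ (p, 0) ∂μHE[n])) := by
    refine tendsto_integral_filter_of_dominated_convergence (fun _ => M) ?_ ?_
      (integrable_const M) ?_
    · filter_upwards [hev] with δ hδ
      exact (hsec δ ⟨hδ.1.le, hδ.2.le⟩).aestronglyMeasurable hmeas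
    · filter_upwards [hev] with δ hδ
      exact ae_restrict_of_forall_mem hmeas fun p hp => hM _ ⟨hp, hδ.1.le, hδ.2.le⟩
    · refine ae_restrict_of_forall_mem hmeas fun p hp => ?_
      have h1 : ContinuousOn (fun δ => Ψ (p, δ)) (Icc 0 1) :=
        cΨ.comp (Continuous.continuousOn (by fun_prop)) fun δ hδ => ⟨hp, hδ⟩
      refine (h1 0 (left_mem_Icc.mpr zero_le_one)).tendsto.mono_left ?_
      refine le_inf nhdsWithin_le_nhds (le_principal_iff.mpr ?_)
      filter_upwards [hev] with δ hδ using ⟨hδ.1.le, hδ.2.le⟩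
  have cv : Continuous fun p : EuclideanSpace ℝ (Fin d) => H (‖p - z‖ ^ 2) := by fun_prop
  have lim2 := tendsto_integral_kernel (by omega) hΩ.isOpen hΩ.isBounded hy cv
    hh.continuousOn_two hc hl
  have heq : (fun δ : ℝ => ∫ p in frontier Ω, Ψ (p, δ) ∂μHE[n]) =ᶠ[𝓝[>] 0]
      fun δ => ∫ p in Ω, (4 * δ ^ 2 * H (‖p - z‖ ^ 2)) • h₂ (‖p - y‖ ^ 2 + δ ^ 2) := by
    filter_upwards [hev] with δ hδ using integral_frontier_regularized hd hΩ hH hh y z hδ.1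
  have := tendsto_nhds_unique (lim1.congr' heq) lim2
  simpa [hΨ, hα, hβ] using this

end Representation

/-! ### The radiated field and the exact formula for the imaging functional. -/

section RadiatedField

variable {d n : ℕ} {Ω D : Set (EuclideanSpace ℝ (Fin d))} {k : ℝ} {H H₁ H₂ : ℝ → ℝ}
  {h h₁ h₂ : ℝ → ℂ} {f : EuclideanSpace ℝ (Fin d) → ℂ}

/-- Uniform lower and upper bounds for the distance of points near `∂Ω` to sources well inside
`Ω`. -/
theorem exists_norm_sub_bounds (hΩ : IsBoundedC1Domain Ω) (hD : closure D ⊆ Ω) :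
    ∃ r R : ℝ, 0 < r ∧ ∀ p ∈ frontier Ω, ∀ q ∈ Metric.ball p r, ∀ y ∈ D,
      r ≤ ‖q - y‖ ∧ ‖q - y‖ ≤ R := by
  have hdisj : Disjoint (frontier Ω) (closure D) :=
    disjoint_left.mpr fun p hp hpD => (hΩ.isOpen.frontier_eq ▸ hp).2 (hD hpD)
  obtain ⟨s, hs, hlt⟩ := Metric.exists_pos_forall_lt_edist hΩ.isCompact_frontier
    isClosed_closure hdisj
  obtain ⟨R, hR⟩ := hΩ.isBounded.closure.subset_closedBall 0
  -- Half of the gap s between ∂Ω and D is given to the ball around p, the other half remains as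
  -- distance to D.
  refine ⟨s / 2, s / 2 + R + R, by positivity, fun p hp q hq y hy => ?_⟩
  have h1 := hlt p hp y (subset_closure hy)
  rw [edist_nndist, ENNReal.coe_lt_coe] at h1
  have h2 : (s : ℝ) < ‖p - y‖ := by rw [← dist_eq_norm]; exact_mod_cast h1
  have h3 : ‖q - p‖ < s / 2 := by rw [← dist_eq_norm]; exact hq
  have h4 : ‖p‖ ≤ R := mem_closedBall_zero_iff.mp (hR (frontier_subset_closure hp))
  have h5 : ‖y‖ ≤ R := mem_closedBall_zero_iff.mp (hR (subset_closure (hD (subset_closure hy))))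
  have h6 : ‖p - y‖ ≤ ‖q - p‖ + ‖q - y‖ := by
    rw [norm_sub_rev q p]; exact norm_sub_le_norm_sub_add_norm_sub p q y
  have h7 : ‖q - y‖ ≤ ‖q - p‖ + ‖p - y‖ := norm_sub_le_norm_sub_add_norm_sub q p y
  have h8 := norm_sub_le p y
  constructor <;> linarith

theorem exists_bound_on_Icc (hh : IsHelmholtzProfile d k (Ioi 0) h h₁ h₂) {r R : ℝ} (hr : 0 < r) :
    ∃ M, 0 ≤ M ∧ ∀ t, r ≤ t → t ≤ R → ‖h (t ^ 2)‖ ≤ M ∧ ‖h₁ (t ^ 2)‖ ≤ M := by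
  have hmaps : MapsTo (fun t : ℝ => t ^ 2) (Icc r R) (Ioi 0) := fun t ht =>
    pow_pos (hr.trans_le ht.1) 2
  obtain ⟨M, hM⟩ := isCompact_Icc.exists_bound_of_continuousOn
    (hh.continuousOn.comp (continuous_pow 2).continuousOn hmaps)
  obtain ⟨M₁, hM₁⟩ := isCompact_Icc.exists_bound_of_continuousOn
    (hh.continuousOn_one.comp (continuous_pow 2).continuousOn hmaps)
  refine ⟨max 0 (max M M₁), le_max_left _ _, fun t h1 h2 => ⟨?_, ?_⟩⟩
  · exact (hM t ⟨h1, h2⟩).trans ((le_max_left _ _).trans (le_max_right _ _))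
  · exact (hM₁ t ⟨h1, h2⟩).trans ((le_max_right _ _).trans (le_max_right _ _))

/-- The radiated field can be differentiated under the integral sign on `∂Ω`. -/
theorem radiatedField_hasFDerivAt (hh : IsHelmholtzProfile d k (Ioi 0) h h₁ h₂)
    (hg : ∀ x y, x ≠ y → green d k x y = h (‖x - y‖ ^ 2)) (hΩ : IsBoundedC1Domain Ω)
    (hDm : MeasurableSet D) (hD : closure D ⊆ Ω) (hf : IntegrableOn f D)
    {p : EuclideanSpace ℝ (Fin d)} (hp : p ∈ frontier Ω) :
    IntegrableOn (fun y => f y * green d k p y) D ∧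
    radiatedField d k D f p = ∫ y in D, f y * h (‖p - y‖ ^ 2) ∧
    IntegrableOn (fun y => f y * h (‖p - y‖ ^ 2)) D ∧
    DifferentiableAt ℝ (radiatedField d k D f) p ∧
    ∀ w, IntegrableOn (fun y => f y * ((2 * ⟪p - y, w⟫) • h₁ (‖p - y‖ ^ 2))) D ∧
      fderiv ℝ (radiatedField d k D f) p w =
        ∫ y in D, f y * ((2 * ⟪p - y, w⟫) • h₁ (‖p - y‖ ^ 2)) := by
  obtain ⟨r, R, hr, hb⟩ := exists_norm_sub_bounds hΩ hD
  obtain ⟨M, hM0, hM⟩ := exists_bound_on_Icc hh hr (R := R)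
  have hpb : p ∈ Metric.ball p r := Metric.mem_ball_self hr
  have hpos : ∀ q ∈ Metric.ball p r, ∀ y ∈ D, ‖q - y‖ ^ 2 ∈ Ioi (0 : ℝ) := fun q hq y hy =>
    pow_pos (hr.trans_le (hb p hp q hq y hy).1) 2
  have hgreen : ∀ q ∈ Metric.ball p r, ∀ y ∈ D, f y * green d k q y = f y * h (‖q - y‖ ^ 2) := by
    intro q hq y hy
    rw [hg q y]
    rintro rfl
    have := hpos q hq q hy
    simp at this
  have hmeas : ∀ q ∈ Metric.ball p r, AEStronglyMeasurable (fun y => h (‖q - y‖ ^ 2))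
      (volume.restrict D) := fun q hq =>
    (hh.continuousOn.comp (Continuous.continuousOn (by fun_prop))
      (hpos q hq)).aestronglyMeasurable hDm
  have hint : IntegrableOn (fun y => f y * h (‖p - y‖ ^ 2)) D :=
    Integrable.mul_bdd (c := M) hf (hmeas p hpb)
      (ae_restrict_of_forall_mem hDm fun y hy => (hM _ (hb p hp p hpb y hy).1
        (hb p hp p hpb y hy).2).1)
  set G' : EuclideanSpace ℝ (Fin d) → EuclideanSpace ℝ (Fin d) →
      (EuclideanSpace ℝ (Fin d) →L[ℝ] ℂ) := fun q y =>
    f y • ((innerSL ℝ (q - y)).smulRight ((2 : ℝ) • h₁ (‖q - y‖ ^ 2))) with hG'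
  have hG'm : AEStronglyMeasurable (G' p) (volume.restrict D) := by
    refine hf.aestronglyMeasurable.smul (ContinuousOn.aestronglyMeasurable ?_ hDm)
    have c1 : ContinuousOn (fun y => (2 : ℝ) • h₁ (‖p - y‖ ^ 2)) D := by
      have := hh.continuousOn_one.comp (f := fun y => ‖p - y‖ ^ 2)
        (Continuous.continuousOn (by fun_prop)) (hpos p hpb)
      exact this.const_smul (2 : ℝ)
    have c2 : Continuous fun y : EuclideanSpace ℝ (Fin d) => innerSL ℝ (p - y) :=
      (innerSL ℝ).continuous.comp (by fun_prop)
    exact ((ContinuousLinearMap.smulRightL ℝ (EuclideanSpace ℝ (Fin d)) ℂ).continuous.comp_continuousOn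
      c2.continuousOn).clm_apply c1
  have hG'b : ∀ y ∈ D, ∀ q ∈ Metric.ball p r, ‖G' q y‖ ≤ ‖f y‖ * (R * (2 * M)) := by
    intro y hy q hq
    obtain ⟨b1, b2⟩ := hb p hp q hq y hy
    have b3 := (hM _ b1 b2).2
    have hR0 : 0 ≤ R := (norm_nonneg _).trans b2
    rw [hG', norm_smul, ContinuousLinearMap.norm_smulRight_apply, innerSL_apply_norm, norm_smul]
    have : ‖(2 : ℝ)‖ = 2 := by norm_num
    rw [this]
    gcongr
  have key := hasFDerivAt_integral_of_dominated_of_fderiv_le (𝕜 := ℝ) (μ := volume.restrict D)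
    (F := fun q y => f y * h (‖q - y‖ ^ 2)) (F' := G') (x₀ := p)
    (bound := fun y => ‖f y‖ * (R * (2 * M))) (Metric.ball_mem_nhds p hr)
    (by
      filter_upwards [Metric.ball_mem_nhds p hr] with q hq
      exact hf.aestronglyMeasurable.mul (hmeas q hq)) hint hG'm
    (ae_restrict_of_forall_mem hDm hG'b) (hf.norm.mul_const _)
    (ae_restrict_of_forall_mem hDm fun y hy q hq => by
      have hpy := hpos q hq y hy
      have := hasFDerivAt_radial (s := 0) (z := y) (p := q) (f := h) (f' := h₁ (‖q - y‖ ^ 2))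
        (by rw [add_zero]; exact hh.hasDerivAt _ hpy)
      simp only [add_zero] at this
      exact this.const_mul (f y))
  have hG'i : Integrable (G' p) (volume.restrict D) :=
    Integrable.mono' (hf.norm.mul_const (R * (2 * M))) hG'm
      (ae_restrict_of_forall_mem hDm fun y hy => hG'b y hy p hpb)
  have hu : ∀ q ∈ Metric.ball p r,
      radiatedField d k D f q = ∫ y in D, f y * h (‖q - y‖ ^ 2) := fun q hq =>
    setIntegral_congr_fun hDm (hgreen q hq)
  have hder : HasFDerivAt (radiatedField d k D f) (∫ y in D, G' p y) p :=
    key.congr_of_eventuallyEq (by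
      filter_upwards [Metric.ball_mem_nhds p hr] with q hq using hu q hq)
  have hval : ∀ w y, G' p y w = f y * ((2 * ⟪p - y, w⟫) • h₁ (‖p - y‖ ^ 2)) := by
    intro w y
    simp only [hG', _root_.smul_apply, ContinuousLinearMap.smulRight_apply, innerSL_apply_apply,
      smul_eq_mul, Complex.real_smul]
    push_cast
    ring
  refine ⟨hint.congr_fun (fun y hy => (hgreen p hpb y hy).symm) hDm, hu p hpb, hint,
    hder.differentiableAt, fun w => ⟨?_, ?_⟩⟩
  · have := hG'i.apply_continuousLinearMap w
    simp only [hval] at this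
    exact this
  · rw [hder.fderiv, ContinuousLinearMap.integral_apply hG'i]
    simp only [hval]

/-- The imaging functional is the integral of the source against the imaginary part of the Green
function. -/
theorem imagingFunctional_eq (hd : d = n + 1) (hH : IsHelmholtzProfile d k univ H H₁ H₂)
    (hv : ∀ x z, imGreen d k x z = H (‖x - z‖ ^ 2))
    (hh : IsHelmholtzProfile d k (Ioi 0) h h₁ h₂)
    (hg : ∀ x y, x ≠ y → green d k x y = h (‖x - y‖ ^ 2))
    {c : ℝ} (hc : 4 * c * volume.real (Metric.ball (0 : EuclideanSpace ℝ (Fin d)) 1) = 1)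
    (hl : Tendsto (fun t => √t ^ (d + 2) • h₂ t) (𝓝[>] 0) (𝓝 (c : ℂ)))
    (hΩ : IsBoundedC1Domain Ω) (hDm : MeasurableSet D) (hD : closure D ⊆ Ω)
    (hf : IntegrableOn f D) (z : EuclideanSpace ℝ (Fin d)) :
    IntegrableOn (boundaryIntegrand d k Ω (radiatedField d k D f) z) (frontier Ω) μHE[n] ∧
    ∫ p in frontier Ω, boundaryIntegrand d k Ω (radiatedField d k D f) z p ∂μHE[n] =
      ∫ y in D, f y * (imGreen d k y z : ℂ) := by
  set μ : Measure (EuclideanSpace ℝ (Fin d)) := (μHE[n]).restrict (frontier Ω) with hμ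
  have hfm : MeasurableSet (frontier Ω) := isClosed_frontier.measurableSet
  have : IsFiniteMeasure μ := isFiniteMeasure_restrict.mpr (hΩ.measure_frontier_lt_top hd).ne
  set κ : EuclideanSpace ℝ (Fin d) × EuclideanSpace ℝ (Fin d) → ℂ := fun q =>
    (2 * H₁ (‖q.1 - z‖ ^ 2) * ⟪q.1 - z, outwardNormal Ω q.1⟫) • h (‖q.1 - q.2‖ ^ 2) -
      (2 * H (‖q.1 - z‖ ^ 2) * ⟪q.1 - q.2, outwardNormal Ω q.1⟫) • h₁ (‖q.1 - q.2‖ ^ 2) with hκ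
  have hbd : ∀ p ∈ frontier Ω, boundaryIntegrand d k Ω (radiatedField d k D f) z p =
      ∫ y in D, f y * κ (p, y) := by
    intro p hp
    obtain ⟨-, hu, hui, -, hdu⟩ := radiatedField_hasFDerivAt hh hg hΩ hDm hD hf hp
    obtain ⟨hdi, hdu⟩ := hdu (outwardNormal Ω p)
    have hfd : fderiv ℝ (fun q => imGreen d k q z) p (outwardNormal Ω p) =
        2 * H₁ (‖p - z‖ ^ 2) * ⟪p - z, outwardNormal Ω p⟫ := by
      have := hasFDerivAt_radial (s := 0) (z := z) (p := p) (f := H)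
        (hH.hasDerivAt _ (mem_univ _))
      simp only [add_zero] at this
      simp only [hv]
      rw [this.fderiv, ContinuousLinearMap.smulRight_apply, innerSL_apply_apply, smul_eq_mul,
        smul_eq_mul]
      ring
    rw [boundaryIntegrand, hfd, hu, hdu, hv, ← integral_const_mul, ← integral_const_mul,
      ← integral_sub (hui.const_mul _) (hdi.const_mul _)]
    refine integral_congr_ae (ae_of_all _ fun y => ?_)
    simp only [hκ, Complex.real_smul]
    push_cast
    ring
  -- Integrability for Fubini: κ is continuous, hence bounded, on the compact product of ∂Ω with the
  -- closure of D, which does not meet ∂Ω; the other factor f is integrable.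
  have hprod : Integrable (fun q : EuclideanSpace ℝ (Fin d) × EuclideanSpace ℝ (Fin d) =>
      f q.2 * κ q) (μ.prod (volume.restrict D)) := by
    have hrestr : μ.prod (volume.restrict D) =
        (μ.prod (volume.restrict D)).restrict (frontier Ω ×ˢ D) := by
      rw [← Measure.prod_restrict, hμ, Measure.restrict_restrict hfm,
        Measure.restrict_restrict hDm, inter_self, inter_self]
    obtain ⟨r, R, hr, hb⟩ := exists_norm_sub_bounds hΩ hD
    have hpos : MapsTo (fun q : EuclideanSpace ℝ (Fin d) × EuclideanSpace ℝ (Fin d) =>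
        ‖q.1 - q.2‖ ^ 2) (frontier Ω ×ˢ closure D) (Ioi 0) := by
      rintro ⟨p, y⟩ ⟨hp, hy⟩
      have hne : p ≠ y := by
        rintro rfl
        exact (hΩ.isOpen.frontier_eq ▸ hp).2 (hD hy)
      exact pow_pos (norm_pos_iff.mpr (sub_ne_zero.mpr hne)) 2
    have hfst : MapsTo (Prod.fst : EuclideanSpace ℝ (Fin d) × EuclideanSpace ℝ (Fin d) → _)
        (frontier Ω ×ˢ closure D) (frontier Ω) := fun q hq => hq.1
    have cH : Continuous H := continuousOn_univ.mp hH.continuousOn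
    have cH₁ : Continuous H₁ := continuousOn_univ.mp hH.continuousOn_one
    have cν := hΩ.continuousOn_outwardNormal.comp continuous_fst.continuousOn hfst
    have ct : Continuous fun q : EuclideanSpace ℝ (Fin d) × EuclideanSpace ℝ (Fin d) =>
        ‖q.1 - q.2‖ ^ 2 := by fun_prop
    have ch : ContinuousOn (fun q : EuclideanSpace ℝ (Fin d) × EuclideanSpace ℝ (Fin d) =>
        h (‖q.1 - q.2‖ ^ 2)) (frontier Ω ×ˢ closure D) :=
      hh.continuousOn.comp ct.continuousOn hpos
    have ch₁ : ContinuousOn (fun q : EuclideanSpace ℝ (Fin d) × EuclideanSpace ℝ (Fin d) =>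
        h₁ (‖q.1 - q.2‖ ^ 2)) (frontier Ω ×ˢ closure D) :=
      hh.continuousOn_one.comp ct.continuousOn hpos
    have c1 : Continuous fun q : EuclideanSpace ℝ (Fin d) × EuclideanSpace ℝ (Fin d) =>
        2 * H₁ (‖q.1 - z‖ ^ 2) := by fun_prop
    have c2 : Continuous fun q : EuclideanSpace ℝ (Fin d) × EuclideanSpace ℝ (Fin d) =>
        2 * H (‖q.1 - z‖ ^ 2) := by fun_prop
    have c3 : Continuous fun q : EuclideanSpace ℝ (Fin d) × EuclideanSpace ℝ (Fin d) =>
        q.1 - z := by fun_prop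
    have c4 : Continuous fun q : EuclideanSpace ℝ (Fin d) × EuclideanSpace ℝ (Fin d) =>
        q.1 - q.2 := by fun_prop
    have cκ : ContinuousOn κ (frontier Ω ×ˢ closure D) :=
      ((c1.continuousOn.mul (c3.continuousOn.inner cν)).smul ch).sub
        ((c2.continuousOn.mul (c4.continuousOn.inner cν)).smul ch₁)
    have hcomp : IsCompact (closure D) :=
      hΩ.isBounded.isCompact_closure.of_isClosed_subset isClosed_closure
        (hD.trans subset_closure)
    obtain ⟨C, hC⟩ := (hΩ.isCompact_frontier.prod hcomp).exists_bound_of_continuousOn cκ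
    have hsub : frontier Ω ×ˢ D ⊆ frontier Ω ×ˢ closure D := prod_mono le_rfl subset_closure
    refine Integrable.mul_bdd (c := C) (Integrable.comp_snd hf μ) ?_ ?_
    · rw [hrestr]
      exact (cκ.mono hsub).aestronglyMeasurable (hfm.prod hDm)
    · rw [hrestr]
      exact ae_restrict_of_forall_mem (hfm.prod hDm) fun q hq => hC q (hsub hq)
  constructor
  · exact hprod.integral_prod_left.congr
      (ae_restrict_of_forall_mem hfm fun p hp => (hbd p hp).symm)
  · calc ∫ p in frontier Ω, boundaryIntegrand d k Ω (radiatedField d k D f) z p ∂μHE[n]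
        = ∫ p, (∫ y in D, f y * κ (p, y)) ∂μ := setIntegral_congr_fun hfm hbd
      _ = ∫ y in D, (∫ p, f y * κ (p, y) ∂μ) := integral_integral_swap (f := fun p y => f y * κ (p, y)) hprod
      _ = ∫ y in D, f y * (imGreen d k y z : ℂ) := by
          refine setIntegral_congr_fun hDm fun y hy => ?_
          rw [integral_const_mul, hv,
            ← integral_frontier_eq hd hΩ hH hh hc hl (hD (subset_closure hy)) z]

end RadiatedField

/-! ### Freezing the weight on each small source. -/

section Localization

variable {d N : ℕ} {k : ℝ} {H H₁ H₂ : ℝ → ℝ}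

/-- A regular radial solution of the Helmholtz equation is Lipschitz, uniformly in its centre. -/
theorem IsHelmholtzProfile.abs_sub_le (hH : IsHelmholtzProfile d k univ H H₁ H₂) (hd : 1 ≤ d)
    (x y z : EuclideanSpace ℝ (Fin d)) :
    |H (‖x - z‖ ^ 2) - H (‖y - z‖ ^ 2)| ≤ |k| * |H 0| * ‖x - y‖ := by
  refine convex_univ.norm_image_sub_le_of_norm_hasFDerivWithin_le
    (f := fun q => H (‖q - z‖ ^ 2)) (x := y) (y := x)
    (f' := fun p => (innerSL ℝ (p - z)).smulRight ((2 : ℝ) • H₁ (‖p - z‖ ^ 2)))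
    (fun p _ => ?_) (fun p _ => ?_) (mem_univ _) (mem_univ _)
  · have := hasFDerivAt_radial (s := 0) (z := z) (p := p) (f := H) (hH.hasDerivAt _ (mem_univ _))
    simp only [add_zero] at this
    exact this.hasFDerivWithinAt
  · rw [ContinuousLinearMap.norm_smulRight_apply, innerSL_apply_norm, ← abs_mul,
      ← abs_of_nonneg (norm_nonneg (p - z)), Real.norm_eq_abs, ← abs_mul]
    -- After squaring, the gradient bound is the energy estimate at t = |p - z|². Its right-hand
    -- side depends only on k and H 0, whence the uniformity in z.
    refine sq_le_sq.mp ?_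
    have := hH.energy_le hd (sq_nonneg ‖p - z‖)
    rw [smul_eq_mul, abs_of_nonneg (norm_nonneg (p - z))]
    linarith

theorem inclusion_subset_closedBall {ε R : ℝ} (hε : 0 ≤ ε) (x : EuclideanSpace ℝ (Fin d))
    {B : Set (EuclideanSpace ℝ (Fin d))} (hB : B ⊆ Metric.closedBall 0 R) :
    inclusion ε x B ⊆ Metric.closedBall x (ε * R) := by
  rintro _ ⟨w, hw, rfl⟩
  rw [mem_closedBall_iff_norm, add_sub_cancel_left, norm_smul, Real.norm_of_nonneg hε]
  exact mul_le_mul_of_nonneg_left (mem_closedBall_zero_iff.mp (hB hw)) hε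

theorem inclusion_eq_vadd (ε : ℝ) (x : EuclideanSpace ℝ (Fin d))
    (B : Set (EuclideanSpace ℝ (Fin d))) :
    inclusion ε x B = (fun y => x + y) '' ((fun y => ε • y) '' B) := by
  rw [image_image]; rfl

theorem isOpen_inclusion {ε : ℝ} (hε : ε ≠ 0) (x : EuclideanSpace ℝ (Fin d))
    {B : Set (EuclideanSpace ℝ (Fin d))} (hB : IsOpen B) : IsOpen (inclusion ε x B) := by
  rw [inclusion_eq_vadd]
  exact isOpenMap_add_left x _ (isOpenMap_smul₀ hε _ hB)

theorem volume_real_inclusion {ε : ℝ} (hε : 0 ≤ ε) (x : EuclideanSpace ℝ (Fin d))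
    (B : Set (EuclideanSpace ℝ (Fin d))) :
    volume.real (inclusion ε x B) = ε ^ d * volume.real B := by
  rw [inclusion_eq_vadd, measureReal_def, image_add_left, measure_preimage_add, image_smul,
    Measure.addHaar_smul, finrank_euclideanSpace_fin, ENNReal.toReal_mul,
    ENNReal.toReal_ofReal (abs_nonneg _), abs_of_nonneg (pow_nonneg hε d), measureReal_def]

/-- Finitely many distinct points of an open set have disjoint closed balls of a common radius
inside the set. -/
theorem exists_disjoint_closedBalls {E : Type*} [NormedAddCommGroup E] {Ω : Set E}
    (hΩ : IsOpen Ω) {x : Fin N → E} (hx : Function.Injective x) (hxΩ : ∀ j, x j ∈ Ω) :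
    ∃ r > 0, (∀ j, Metric.closedBall (x j) r ⊆ Ω) ∧
      Pairwise fun i j => Disjoint (Metric.closedBall (x i) r) (Metric.closedBall (x j) r) := by
  have h1 : ∀ᶠ r in 𝓝[>] (0 : ℝ), ∀ j, Metric.closedBall (x j) r ⊆ Ω := by
    refine eventually_all.mpr fun j => ?_
    obtain ⟨s, hs, hsub⟩ := Metric.isOpen_iff.mp hΩ (x j) (hxΩ j)
    filter_upwards [Ioo_mem_nhdsGT hs] with r hr
    exact (Metric.closedBall_subset_ball hr.2).trans hsub
  have h2 : ∀ᶠ r in 𝓝[>] (0 : ℝ), ∀ i j, i ≠ j →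
      Disjoint (Metric.closedBall (x i) r) (Metric.closedBall (x j) r) := by
    refine eventually_all.mpr fun i => eventually_all.mpr fun j => ?_
    by_cases hij : i = j
    · exact Eventually.of_forall fun _ h => absurd hij h
    have hpos : 0 < dist (x i) (x j) / 2 := half_pos (dist_pos.mpr (hx.ne hij))
    filter_upwards [Ioo_mem_nhdsGT hpos] with r hr _
    exact Metric.closedBall_disjoint_closedBall (by linarith [hr.2])
  obtain ⟨r, ⟨h1, h2⟩, hr⟩ := ((h1.and h2).and self_mem_nhdsWithin).exists
  exact ⟨r, hr, h1, fun i j hij => h2 i j hij⟩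

/-- Replacing a Lipschitz weight by its values at the centres of small disjoint sets. -/
theorem norm_setIntegral_iUnion_sub_le {E : Type*} [NormedAddCommGroup E] [MeasurableSpace E]
    [BorelSpace E] {μ : Measure E} {S : Fin N → Set E} (hSm : ∀ j, MeasurableSet (S j))
    (hSd : Pairwise fun i j => Disjoint (S i) (S j)) {x : Fin N → E} {ρ L : ℝ} (hL : 0 ≤ L)
    (hS : ∀ j, S j ⊆ Metric.closedBall (x j) ρ) {v : E → ℝ} (hvc : Continuous v)
    (hv : ∀ x y, |v x - v y| ≤ L * ‖x - y‖) {f : E → ℂ} (hf : IntegrableOn f (⋃ j, S j) μ) :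
    ‖∫ y in ⋃ j, S j, f y * (v y : ℂ) ∂μ - ∑ j, (∫ y in S j, f y ∂μ) * (v (x j) : ℂ)‖ ≤
      L * ρ * ∑ j, ∫ y in S j, ‖f y‖ ∂μ := by
  have hfj : ∀ j, IntegrableOn f (S j) μ := fun j => hf.mono_set (subset_iUnion S j)
  have hdiff : ∀ j, ∀ y ∈ S j, ‖((v y - v (x j) : ℝ) : ℂ)‖ ≤ L * ρ := fun j y hy => by
    rw [Complex.norm_real]
    exact (hv y (x j)).trans (mul_le_mul_of_nonneg_left (mem_closedBall_iff_norm.mp (hS j hy)) hL)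
  have hdi : ∀ j, IntegrableOn (fun y => f y * ((v y - v (x j) : ℝ) : ℂ)) (S j) μ := fun j =>
    Integrable.mul_bdd (c := L * ρ) (hfj j)
      (Complex.continuous_ofReal.comp (hvc.sub continuous_const)).aestronglyMeasurable
      (ae_restrict_of_forall_mem (hSm j) (hdiff j))
  have hsplit : ∀ j y, f y * (v y : ℂ) =
      f y * ((v y - v (x j) : ℝ) : ℂ) + f y * (v (x j) : ℂ) := fun j y => by
    push_cast; ring
  have hfv : ∀ j, IntegrableOn (fun y => f y * (v y : ℂ)) (S j) μ := fun j => by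
    simp only [hsplit j]
    exact (hdi j).add ((hfj j).mul_const _)
  rw [integral_iUnion_fintype hSm hSd hfv, ← Finset.sum_sub_distrib, Finset.mul_sum]
  refine norm_sum_le_of_le _ fun j _ => ?_
  have h1 : ∫ y in S j, f y * (v y : ℂ) ∂μ - (∫ y in S j, f y ∂μ) * (v (x j) : ℂ) =
      ∫ y in S j, f y * ((v y - v (x j) : ℝ) : ℂ) ∂μ := by
    simp only [hsplit j]
    rw [integral_add (hdi j) ((hfj j).mul_const _), integral_mul_const, add_sub_cancel_right]
  rw [h1, ← integral_const_mul]
  refine norm_integral_le_of_norm_le ((hfj j).norm.const_mul _)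
    (ae_restrict_of_forall_mem (hSm j) fun y hy => ?_)
  rw [norm_mul, mul_comm]
  exact mul_le_mul_of_nonneg_right (hdiff j y hy) (norm_nonneg _)

/-- The leading term is the sum of the total source strengths weighted by `Im Φ(xⱼ, z)`. -/
theorem leadingTerm_eq {ε : ℝ} (hε : 0 < ε) (x : Fin N → EuclideanSpace ℝ (Fin d))
    {B : Fin N → Set (EuclideanSpace ℝ (Fin d))} (hB : ∀ j, volume.real (B j) ≠ 0)
    (f : EuclideanSpace ℝ (Fin d) → ℂ) (z : EuclideanSpace ℝ (Fin d)) :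
    leadingTerm d k ε x B f z =
      ∑ j, (∫ y in inclusion ε (x j) (B j), f y) * (imGreen d k (x j) z : ℂ) := by
  rw [leadingTerm, Finset.mul_sum]
  refine Finset.sum_congr rfl fun j _ => ?_
  rw [setAverage_eq, volume_real_inclusion hε.le, Complex.real_smul]
  have h1 : (ε : ℂ) ≠ 0 := by exact_mod_cast hε.ne'
  have h2 : (volume.real (B j) : ℂ) ≠ 0 := by exact_mod_cast hB j
  push_cast
  field_simp

theorem setIntegral_inclusion_eq {ε : ℝ} (hε : 0 < ε) (x : EuclideanSpace ℝ (Fin d))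
    {B : Set (EuclideanSpace ℝ (Fin d))} (hB : volume.real B ≠ 0)
    (g : EuclideanSpace ℝ (Fin d) → ℝ) :
    ∫ y in inclusion ε x B, g y =
      ε ^ d * volume.real B * ⨍ y in inclusion ε x B, g y := by
  rw [setAverage_eq, volume_real_inclusion hε.le, smul_eq_mul]
  field_simp

end Localization

/-- Small inclusions in a bounded `C¹` domain are separated and stay away from the boundary. -/
theorem exists_inclusion_subset_closedBall {d N : ℕ} {Ω : Set (EuclideanSpace ℝ (Fin d))}
    (hΩ : IsOpen Ω) {x : Fin N → EuclideanSpace ℝ (Fin d)} (hx : Function.Injective x)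
    (hxΩ : ∀ j, x j ∈ Ω) {B : Fin N → Set (EuclideanSpace ℝ (Fin d))}
    (hB : ∀ j, Bornology.IsBounded (B j)) :
    ∃ ε₀ R : ℝ, 0 < ε₀ ∧ 0 < R ∧ ∀ ε ∈ Ioo 0 ε₀,
      (∀ j, inclusion ε (x j) (B j) ⊆ Metric.closedBall (x j) (ε * R)) ∧
      (∀ j, closure (inclusion ε (x j) (B j)) ⊆ Ω) ∧
      Pairwise fun i j => Disjoint (inclusion ε (x i) (B i)) (inclusion ε (x j) (B j)) := by
  obtain ⟨R, hR, hBR⟩ := ((Bornology.isBounded_iUnion (s := B)).mpr hB).subset_closedBall_lt 0 0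
  obtain ⟨r, hr, hrΩ, hrd⟩ := exists_disjoint_closedBalls hΩ hx hxΩ
  -- R bounds all the Bⱼ at once, so ε < r / R puts each source inside the closed ball of radius r
  -- about its centre.
  refine ⟨r / R, R, div_pos hr hR, hR, fun ε hε => ?_⟩
  have hsub : ∀ j, inclusion ε (x j) (B j) ⊆ Metric.closedBall (x j) (ε * R) := fun j =>
    inclusion_subset_closedBall hε.1.le _ ((subset_iUnion B j).trans hBR)
  have hsub' : ∀ j, inclusion ε (x j) (B j) ⊆ Metric.closedBall (x j) r := fun j =>
    (hsub j).trans (Metric.closedBall_subset_closedBall ((lt_div_iff₀ hR).mp hε.2).le)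
  exact ⟨hsub, fun j => (closure_minimal (hsub' j) Metric.isClosed_closedBall).trans (hrΩ j),
    fun i j hij => (hrd hij).mono (hsub' i) (hsub' j)⟩

end SmallSources

/-! ### The main theorem. -/

open SmallSources in
theorem lemma2 (d : ℕ) (hd : d = 2 ∨ d = 3) (k : ℝ) (hk : 0 < k)
    (Ω : Set (EuclideanSpace ℝ (Fin d))) (hΩ : SmallSources.IsBoundedC1Domain Ω)
    (N : ℕ) (x : Fin N → EuclideanSpace ℝ (Fin d)) (hx : Function.Injective x)
    (hxΩ : ∀ j, x j ∈ Ω)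
    (B : Fin N → Set (EuclideanSpace ℝ (Fin d)))
    (hB_open : ∀ j, IsOpen (B j)) (hB_conn : ∀ j, IsConnected (B j))
    (hB_bdd : ∀ j, Bornology.IsBounded (B j)) :
    ∃ ε₀ : ℝ, 0 < ε₀ ∧
      -- for `ε < ε₀` the sources are disjoint and compactly contained in `Ω`
      (∀ ε ∈ Ioo 0 ε₀,
        (∀ j, closure (SmallSources.inclusion ε (x j) (B j)) ⊆ Ω) ∧
        Pairwise (fun i j => Disjoint (SmallSources.inclusion ε (x i) (B i))
          (SmallSources.inclusion ε (x j) (B j)))) ∧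
      -- the Cauchy data of `u` on the boundary and the boundary integral are well defined
      (∀ ε ∈ Ioo 0 ε₀, ∀ f : EuclideanSpace ℝ (Fin d) → ℂ,
        MemLp f 2 (volume.restrict (SmallSources.sourceSet ε x B)) →
        (∀ p ∈ frontier Ω,
          IntegrableOn (fun y => f y * SmallSources.green d k p y)
            (SmallSources.sourceSet ε x B) ∧
          DifferentiableAt ℝ
            (SmallSources.radiatedField d k (SmallSources.sourceSet ε x B) f) p) ∧
        ∀ z, IntegrableOn
          (SmallSources.boundaryIntegrand d k Ω
            (SmallSources.radiatedField d k (SmallSources.sourceSet ε x B) f) z)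
          (frontier Ω) μHE[d - 1]) ∧
      -- the expansion, with a constant independent of `ε`, `f` and `z`
      (∃ C : ℝ, ∀ ε ∈ Ioo 0 ε₀, ∀ f : EuclideanSpace ℝ (Fin d) → ℂ,
        MemLp f 2 (volume.restrict (SmallSources.sourceSet ε x B)) →
        ∀ z,
          ‖SmallSources.imagingFunctional d k Ω
              (SmallSources.radiatedField d k (SmallSources.sourceSet ε x B) f) z -
            SmallSources.leadingTerm d k ε x B f z‖ ≤
          C * ε ^ (d + 1) * ∑ j, ⨍ y in SmallSources.inclusion ε (x j) (B j), ‖f y‖) ∧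
      -- the expansion as `ε → 0`, for densities whose averages over the sources stay bounded
      (∀ f : ℝ → EuclideanSpace ℝ (Fin d) → ℂ,
        (∀ ε ∈ Ioo 0 ε₀, MemLp (f ε) 2 (volume.restrict (SmallSources.sourceSet ε x B))) →
        (∀ j, (fun ε => ⨍ y in SmallSources.inclusion ε (x j) (B j), ‖f ε y‖)
          =O[𝓝[>] 0] (fun _ => (1 : ℝ))) →
        ∀ z,
          (fun ε => SmallSources.imagingFunctional d k Ω
              (SmallSources.radiatedField d k (SmallSources.sourceSet ε x B) (f ε)) z -
            SmallSources.leadingTerm d k ε x B (f ε) z)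
          =O[𝓝[>] 0] (fun ε => ε ^ (d + 1))) := by
  obtain ⟨H, H₁, H₂, hH, hv⟩ := exists_profile_imGreen hd k
  obtain ⟨h, h₁, h₂, hh, hg, c, hc, hl⟩ := exists_profile_green hd hk
  have hd1 : 1 ≤ d := by omega
  have hd' : d = d - 1 + 1 := by omega
  obtain ⟨ε₀, R, hε₀, hR, hε⟩ :=
    exists_inclusion_subset_closedBall hΩ.isOpen hx hxΩ hB_bdd
  have hBvol : ∀ j, volume.real (B j) ≠ 0 := fun j =>
    (ENNReal.toReal_pos ((hB_open j).measure_pos volume (hB_conn j).nonempty).ne'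
      (hB_bdd j).measure_lt_top.ne).ne'
  have hm : ∀ ε ∈ Ioo 0 ε₀, ∀ j, MeasurableSet (inclusion ε (x j) (B j)) := fun ε h0 j =>
    (isOpen_inclusion h0.1.ne' (x j) (hB_open j)).measurableSet
  have hDm : ∀ ε ∈ Ioo 0 ε₀, MeasurableSet (sourceSet ε x B) := fun ε h0 =>
    MeasurableSet.iUnion (hm ε h0)
  have hDΩ : ∀ ε ∈ Ioo 0 ε₀, closure (sourceSet ε x B) ⊆ Ω := fun ε h0 => by
    rw [sourceSet, closure_iUnion_of_finite]
    exact iUnion_subset (hε ε h0).2.1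
  have hfi : ∀ ε ∈ Ioo 0 ε₀, ∀ f : EuclideanSpace ℝ (Fin d) → ℂ,
      MemLp f 2 (volume.restrict (sourceSet ε x B)) → IntegrableOn f (sourceSet ε x B) := by
    intro ε h0 f hf
    have : IsFiniteMeasure (volume.restrict (sourceSet ε x B)) :=
      isFiniteMeasure_restrict.mpr
        (hΩ.isBounded.subset (subset_closure.trans (hDΩ ε h0))).measure_lt_top.ne
    -- L² is contained in L¹ on a set of finite measure; from here on only integrability of f is
    -- used.
    exact hf.integrable (by norm_num)
  have hexp : ∀ ε ∈ Ioo 0 ε₀, ∀ f : EuclideanSpace ℝ (Fin d) → ℂ,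
      MemLp f 2 (volume.restrict (sourceSet ε x B)) → ∀ z,
      ‖imagingFunctional d k Ω (radiatedField d k (sourceSet ε x B) f) z -
          leadingTerm d k ε x B f z‖ ≤
        (|k| * |H 0| * R * ∑ j, volume.real (B j)) * ε ^ (d + 1) *
          ∑ j, ⨍ y in inclusion ε (x j) (B j), ‖f y‖ := by
    intro ε h0 f hf z
    have hcH : Continuous fun y => imGreen d k y z := by
      simp only [hv]
      exact (continuousOn_univ.mp hH.continuousOn).comp (by fun_prop)
    have havg : ∀ j, 0 ≤ ⨍ y in inclusion ε (x j) (B j), ‖f y‖ := fun j => by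
      rw [setAverage_eq]
      exact smul_nonneg (inv_nonneg.mpr measureReal_nonneg)
        (integral_nonneg fun _ => norm_nonneg _)
    rw [imagingFunctional, (imagingFunctional_eq hd' hH hv hh hg hc hl hΩ (hDm ε h0) (hDΩ ε h0)
      (hfi ε h0 f hf) z).2, leadingTerm_eq h0.1 x hBvol]
    refine (norm_setIntegral_iUnion_sub_le (L := |k| * |H 0|) (hm ε h0) (hε ε h0).2.2 (by positivity)
      (hε ε h0).1 hcH (fun a b => by simpa only [hv] using hH.abs_sub_le hd1 a b z)
      (hfi ε h0 f hf)).trans ?_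
    simp only [setIntegral_inclusion_eq h0.1 _ (hBvol _)]
    -- One power of ε comes from the Lipschitz bound on balls of radius ε R, the other d from the
    -- volumes of the sources. Each |Bⱼ| is bounded by the sum of all of them to get a single
    -- constant.
    calc |k| * |H 0| * (ε * R) * ∑ j, ε ^ d * volume.real (B j) *
          ⨍ y in inclusion ε (x j) (B j), ‖f y‖
        ≤ |k| * |H 0| * (ε * R) * ∑ j, ε ^ d * (∑ i, volume.real (B i)) *
          ⨍ y in inclusion ε (x j) (B j), ‖f y‖ := by
          have := h0.1.le
          gcongr with j
          · exact havg j
          · exact Finset.single_le_sum (f := fun i => volume.real (B i))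
              (fun i _ => measureReal_nonneg) (Finset.mem_univ j)
      _ = (|k| * |H 0| * R * ∑ j, volume.real (B j)) * ε ^ (d + 1) *
          ∑ j, ⨍ y in inclusion ε (x j) (B j), ‖f y‖ := by
          rw [← Finset.mul_sum]
          ring
  refine ⟨ε₀, hε₀, fun ε h0 => (hε ε h0).2, fun ε h0 f hf => ⟨fun p hp => ?_, fun z => ?_⟩,
    ⟨_, hexp⟩, fun f hf hfb z => ?_⟩
  · obtain ⟨h1, -, -, h2, -⟩ := radiatedField_hasFDerivAt hh hg hΩ (hDm ε h0) (hDΩ ε h0)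
      (hfi ε h0 f hf) hp
    exact ⟨h1, h2⟩
  · exact (imagingFunctional_eq hd' hH hv hh hg hc hl hΩ (hDm ε h0) (hDΩ ε h0)
      (hfi ε h0 f hf) z).1
  · set A := |k| * |H 0| * R * ∑ j, volume.real (B j)
    have hsum : (fun ε => ∑ j, ⨍ y in inclusion ε (x j) (B j), ‖f ε y‖)
        =O[𝓝[>] 0] (fun _ => (1 : ℝ)) := Asymptotics.IsBigO.fun_sum fun j _ => hfb j
    have hle : (fun ε => imagingFunctional d k Ω
          (radiatedField d k (sourceSet ε x B) (f ε)) z - leadingTerm d k ε x B (f ε) z)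
        =O[𝓝[>] 0] fun ε => A * ε ^ (d + 1) *
          ∑ j, ⨍ y in inclusion ε (x j) (B j), ‖f ε y‖ := by
      -- The constant A is already part of the comparison function, so the uniform estimate gives
      -- the bound with constant 1 once ε < ε₀.
      refine Asymptotics.IsBigO.of_bound 1 ?_
      filter_upwards [Ioo_mem_nhdsGT hε₀] with ε h0
      rw [one_mul]
      exact (hexp ε h0 (f ε) (hf ε h0) z).trans (le_abs_self _)
    refine hle.trans ?_
    simpa using ((Asymptotics.isBigO_refl (fun ε : ℝ => ε ^ (d + 1)) (𝓝[>] 0)).const_mul_left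
      A).mul hsum
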